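/- Setting. Let $a:\mathbb R^d\to\mathbb R$ satisfy $a\ge 0$, $\int_{\mathbb R^d}a(z)\,dz=1$, $\int_{\mathbb R^d}|z|^2a(z)\,dz<\infty$. Let $(\Omega,\mathcal F,P)$ be a probability space with an ergodic measure-preserving dynamical system $\tau_s:\Omega\to\Omega$, $s\in\mathbb R$ (so $\tau_0=\mathrm{id}$, $\tau_{s+t}=\tau_s\tau_t$, each $\tau_s$ preserves $P$, and a measurable $B\subset\Omega$ with $\tau_s^{-1}B=B$ for all $s$ has $P(B)\in\{0,1\}$). A (jointly measurable) process $X_\omega(s)$, $\omega\in\Omega$, $s\in\mathbb R$, is called stationary if $X_\omega(t+s)=X_{\tau_s\omega}(t)$ for all $t,s\in\mathbb R$, $\omega\in\Omega$. Let $\mu_\omega(x,y;t)$ be a measurable function of $(\omega,t,x,y)$ that is periodic in $x$ and in $y$ with respect to $\mathbb Z^d$ and satisfies $0<\alpha_1\le\mu_\omega(x,y;t)\le\alpha_2$ for all $\omega,t,x,y$, with constants $\alpha_1,\alpha_2$, and suppose that $\mu$ is stationary: $\mu_\omega(\cdot,\cdot;t+s)=\mu_{\tau_s\omega}(\cdot,\cdot;t)$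 in $L^\infty(\mathbb T^{2d})$ for all $t,s,\omega$. Let $A_\omega(s)$ be the bounded operator on the real space $L^2(\mathbb T^d)$, $\mathbb T^d=\mathbb R^d/\mathbb Z^d$, $$A_\omega(s)v(\xi)=\int_{\mathbb R^d}\big(v(\xi-z)-v(\xi)\big)\,a(z)\,\mu_\omega(\xi,\xi-z;s)\,dz,$$ and $A_\omega^*(s)$ its adjoint. For $N\in\mathbb R$ let $p^N$ be the solution of $-\partial_t p^N=A_\omega^*(t)p^N$ for $t\le N$, $p^N|_{t=N}=1$, and put $p_\infty(\cdot,s)=\lim_{N\to\infty}p^N(\cdot,s)$ in $L^2(\mathbb T^d)$. Solutions of evolution equations are continuous $L^2(\mathbb T^d)$-valued functions of time that satisfy the time-integrated equation. Lemma. Let $g_\omega(\xi,s)$ be a stationary process with values in $L^2(\mathbb T^d)$ such that $g_\omega\in L^\infty((-\infty,+\infty);L^2(\mathbb T^d))$ for a.e. $\omega$, and assume that the process $(g_\omega(\cdot,s),p_\infty(\cdot,s))$ is also stationary. If for a.e. $\omega$ $$\int_{\mathbb T^d}g_\omega(\xi,s)\,p_\infty(\xi,s)\,d\xi=0\qquad\text{for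 all } s\in\mathbb R,$$ then there is a stationary process $v_\omega(\xi,s)$ with values in $L^2(\mathbb T^d)$ such that, for a.e. $\omega$, $v_\omega\in L^\infty((-\infty,+\infty);L^2(\mathbb T^d))$ and $$\partial_s v_\omega(\xi,s)=A_\omega(s)v_\omega(\xi,s)+g_\omega(\xi,s),\qquad(\xi,s)\in\mathbb T^d\times\mathbb R .$$ It is unique up to an additive constant: if $u$ is any stationary process with values in $L^2(\mathbb T^d)$ that solves the same equation for a.e. $\omega$, then there is a (deterministic) constant $c\in\mathbb R$ such that for a.e. $\omega$, $u_\omega(\cdot,s)=v_\omega(\cdot,s)+c$ for all $s\in\mathbb R$. -/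

import Mathlib

open MeasureTheory Set Filter Topology

/-- The space `L²(𝕋^d)` of real functions on the unit torus `𝕋^d = ℝ^d / ℤ^d` with its Lebesgue
measure. -/
abbrev TorusL2 (d : ℕ) : Type :=
  Lp ℝ 2 (volume : Measure (UnitAddTorus (Fin d)))

/-- The covering map `ℝ^d → 𝕋^d`. -/
def toTorus {d : ℕ} (z : EuclideanSpace ℝ (Fin d)) : UnitAddTorus (Fin d) :=
  fun i => (z i : UnitAddCircle)

/-- The constant function `c` as an element of `L²(𝕋^d)`. -/
noncomputable def torusConst (d : ℕ) (c : ℝ) : TorusL2 d :=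
  Lp.const 2 (volume : Measure (UnitAddTorus (Fin d))) c

/-- The conditions on the jump kernel: `a ≥ 0`, `∫ a = 1`, `∫ |z|² a(z) dz < ∞`. -/
structure IsJumpKernel {d : ℕ} (a : EuclideanSpace ℝ (Fin d) → ℝ) : Prop where
  nonneg : ∀ z, 0 ≤ a z
  integrable : Integrable a
  integral_eq_one : ∫ z, a z = 1
  second_moment : Integrable (fun z => ‖z‖ ^ 2 * a z)

/-- The pointwise formula `ξ ↦ ∫_{ℝ^d} (f(ξ - z) - f(ξ)) a(z) m(ξ, ξ - z) dz`, where the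
coefficient `m`, periodic in both variables, is regarded as a function on `𝕋^d × 𝕋^d`. -/
noncomputable def jumpIntegral {d : ℕ} (a : EuclideanSpace ℝ (Fin d) → ℝ)
    (m : UnitAddTorus (Fin d) → UnitAddTorus (Fin d) → ℝ)
    (f : UnitAddTorus (Fin d) → ℝ) (ξ : UnitAddTorus (Fin d)) : ℝ :=
  ∫ z, (f (ξ - toTorus z) - f ξ) * a z * m ξ (ξ - toTorus z)

/-- `T` is the bounded operator on `L²(𝕋^d)` given by `jumpIntegral a m`. -/
def IsJumpOperator {d : ℕ} (a : EuclideanSpace ℝ (Fin d) → ℝ)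
    (m : UnitAddTorus (Fin d) → UnitAddTorus (Fin d) → ℝ)
    (T : TorusL2 d →L[ℝ] TorusL2 d) : Prop :=
  ∀ f : TorusL2 d, T f =ᵐ[volume] jumpIntegral a m f

open Classical in
/-- The bounded operator on `L²(𝕋^d)` given by `jumpIntegral a m`. It is unique when it exists, and
it exists whenever `a` is a jump kernel and `m` is measurable
and bounded (`exists_isJumpOperator`); otherwise the value is `0`. -/
noncomputable def jumpOperator {d : ℕ} (a : EuclideanSpace ℝ (Fin d) → ℝ)
    (m : UnitAddTorus (Fin d) → UnitAddTorus (Fin d) → ℝ) : TorusL2 d →L[ℝ] TorusL2 d :=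
  if h : ∃ T, IsJumpOperator a m T then h.choose else 0

theorem measurable_toTorus {d : ℕ} : Measurable (toTorus (d := d)) := by
  refine measurable_pi_lambda _ fun i => ?_
  exact AddCircle.measurable_mk'.comp (by fun_prop)

theorem jump_ae {d : ℕ} {q : UnitAddTorus (Fin d) → Prop} (hq : ∀ᵐ x, q x) :
    ∀ᵐ ξ : UnitAddTorus (Fin d), ∀ᵐ z : EuclideanSpace ℝ (Fin d), q (ξ - toTorus z) := by
  obtain ⟨s, hs, hsm, hs0⟩ := exists_measurable_superset_of_null (ae_iff.1 hq)
  have hmeas : Measurable fun w : UnitAddTorus (Fin d) × EuclideanSpace ℝ (Fin d) =>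
      w.1 - toTorus w.2 := measurable_fst.sub (measurable_toTorus.comp measurable_snd)
  have hM : MeasurableSet {w : UnitAddTorus (Fin d) × EuclideanSpace ℝ (Fin d) |
      w.1 - toTorus w.2 ∈ sᶜ} := hmeas hsm.compl
  have h1 : ∀ᵐ z : EuclideanSpace ℝ (Fin d), ∀ᵐ ξ : UnitAddTorus (Fin d),
      ξ - toTorus z ∈ sᶜ := by
    refine Eventually.of_forall fun z => ?_
    exact (measurePreserving_sub_right volume (toTorus z)).quasiMeasurePreserving.ae
      (measure_eq_zero_iff_ae_notMem.1 hs0)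
  have h2 := (Measure.ae_ae_comm (μ := (volume : Measure (UnitAddTorus (Fin d))))
    (ν := (volume : Measure (EuclideanSpace ℝ (Fin d)))) (p := fun ξ z => ξ - toTorus z ∈ sᶜ) hM).2 h1
  filter_upwards [h2] with ξ hξ
  filter_upwards [hξ] with z hz
  by_contra hcon
  exact hz (hs hcon)

/-- The integrand of `jumpIntegral`. -/
noncomputable def jumpIntegrand {d : ℕ} (a : EuclideanSpace ℝ (Fin d) → ℝ)
    (m : UnitAddTorus (Fin d) → UnitAddTorus (Fin d) → ℝ)
    (f : UnitAddTorus (Fin d) → ℝ) (ξ : UnitAddTorus (Fin d))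
    (z : EuclideanSpace ℝ (Fin d)) : ℝ :=
  (f (ξ - toTorus z) - f ξ) * a z * m ξ (ξ - toTorus z)

theorem jump_bound {d : ℕ} {a : EuclideanSpace ℝ (Fin d) → ℝ} (ha : IsJumpKernel a)
    {m : UnitAddTorus (Fin d) → UnitAddTorus (Fin d) → ℝ} {C : ℝ} (hC : ∀ x y, |m x y| ≤ C)
    (f : UnitAddTorus (Fin d) → ℝ) (hf : StronglyMeasurable f) :
    ∫⁻ ξ, (∫⁻ z, ‖jumpIntegrand a m f ξ z‖ₑ) ^ 2 ≤
      ENNReal.ofReal C ^ 2 * (2 * eLpNorm f 2 volume) ^ 2 := by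
  set ρ : Measure (EuclideanSpace ℝ (Fin d)) :=
    volume.withDensity fun z => ENNReal.ofReal (a z) with hρ
  have haA : AEMeasurable (fun z => ENNReal.ofReal (a z)) volume :=
    ha.integrable.aestronglyMeasurable.aemeasurable.ennreal_ofReal
  have hρ1 : IsProbabilityMeasure ρ := by
    refine ⟨?_⟩
    rw [hρ, withDensity_apply _ MeasurableSet.univ, Measure.restrict_univ,
      ← ofReal_integral_eq_lintegral_ofReal ha.integrable (Eventually.of_forall ha.nonneg),
      ha.integral_eq_one, ENNReal.ofReal_one]
  have hmap : Measurable fun w : UnitAddTorus (Fin d) × EuclideanSpace ℝ (Fin d) =>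
      w.1 - toTorus w.2 := measurable_fst.sub (measurable_toTorus.comp measurable_snd)
  have hD : StronglyMeasurable fun w : UnitAddTorus (Fin d) × EuclideanSpace ℝ (Fin d) =>
      f (w.1 - toTorus w.2) - f w.1 :=
    (hf.comp_measurable hmap).sub (hf.comp_measurable measurable_fst)
  have key : ∀ h : EuclideanSpace ℝ (Fin d) → ℝ, StronglyMeasurable h →
      (∫⁻ z, ‖h z‖ₑ ∂ρ) ^ 2 ≤ ∫⁻ z, ‖h z‖ₑ ^ 2 ∂ρ := by
    intro h hh
    have h1 := eLpNorm_le_eLpNorm_of_exponent_le (μ := ρ) (p := 1) (q := 2) (by norm_num)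
      hh.aestronglyMeasurable
    rw [eLpNorm_one_eq_lintegral_enorm] at h1
    have h2 := eLpNorm_nnreal_pow_eq_lintegral (μ := ρ) (f := h) (p := 2) (by norm_num)
    have h3 : eLpNorm h 2 ρ ^ 2 = ∫⁻ z, ‖h z‖ₑ ^ 2 ∂ρ := by simpa only [NNReal.coe_ofNat, ENNReal.coe_ofNat, ENNReal.rpow_ofNat] using h2
    rw [← h3]
    gcongr
  have hstep : ∀ ξ, (∫⁻ z, ‖jumpIntegrand a m f ξ z‖ₑ) ^ 2 ≤
      ENNReal.ofReal C ^ 2 * ∫⁻ z, ‖f (ξ - toTorus z) - f ξ‖ₑ ^ 2 ∂ρ := by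
    intro ξ
    have hDξ : StronglyMeasurable fun z => f (ξ - toTorus z) - f ξ :=
      hD.comp_measurable measurable_prodMk_left
    have h1 : ∫⁻ z, ‖jumpIntegrand a m f ξ z‖ₑ ≤
        ENNReal.ofReal C * ∫⁻ z, ‖f (ξ - toTorus z) - f ξ‖ₑ ∂ρ := by
      rw [hρ, lintegral_withDensity_eq_lintegral_mul₀ haA hDξ.enorm.aemeasurable,
        ← lintegral_const_mul' _ _ ENNReal.ofReal_ne_top]
      refine lintegral_mono fun z => ?_
      simp only [jumpIntegrand, enorm_mul, Pi.mul_apply]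
      rw [Real.enorm_of_nonneg (ha.nonneg z)]
      have : ‖m ξ (ξ - toTorus z)‖ₑ ≤ ENNReal.ofReal C := by
        rw [← ofReal_norm]
        exact ENNReal.ofReal_le_ofReal (hC _ _)
      calc _ ≤ ‖f (ξ - toTorus z) - f ξ‖ₑ * ENNReal.ofReal (a z) * ENNReal.ofReal C := by gcongr
        _ = _ := by ring
    calc _ ≤ (ENNReal.ofReal C * ∫⁻ z, ‖f (ξ - toTorus z) - f ξ‖ₑ ∂ρ) ^ 2 := by gcongr
      _ = ENNReal.ofReal C ^ 2 * (∫⁻ z, ‖f (ξ - toTorus z) - f ξ‖ₑ ∂ρ) ^ 2 := by ring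
      _ ≤ _ := by gcongr; exact key _ hDξ
  calc _ ≤ ∫⁻ ξ, ENNReal.ofReal C ^ 2 * ∫⁻ z, ‖f (ξ - toTorus z) - f ξ‖ₑ ^ 2 ∂ρ :=
        lintegral_mono hstep
    _ = ENNReal.ofReal C ^ 2 * ∫⁻ ξ, ∫⁻ z, ‖f (ξ - toTorus z) - f ξ‖ₑ ^ 2 ∂ρ := by
        rw [lintegral_const_mul' _ _ (by simp)]
    _ = ENNReal.ofReal C ^ 2 * ∫⁻ z, (∫⁻ ξ, ‖f (ξ - toTorus z) - f ξ‖ₑ ^ 2) ∂ρ := by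
        rw [lintegral_lintegral_swap]
        exact (hD.enorm.pow_const 2).aemeasurable
    _ ≤ ENNReal.ofReal C ^ 2 * ∫⁻ z, (2 * eLpNorm f 2 volume) ^ 2 ∂ρ := by
        gcongr with z
        have h2 := eLpNorm_nnreal_pow_eq_lintegral
          (μ := (volume : Measure (UnitAddTorus (Fin d))))
          (f := fun ξ => f (ξ - toTorus z) - f ξ) (p := 2) (by norm_num)
        have h3 : eLpNorm (fun ξ => f (ξ - toTorus z) - f ξ) 2 volume ^ 2 =
          ∫⁻ ξ, ‖f (ξ - toTorus z) - f ξ‖ₑ ^ 2 := by simpa only [NNReal.coe_ofNat, ENNReal.coe_ofNat, ENNReal.rpow_ofNat] using h2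
        rw [← h3]
        gcongr
        have hmp := measurePreserving_sub_right
          (volume : Measure (UnitAddTorus (Fin d))) (toTorus z)
        have h4 : eLpNorm (fun ξ => f (ξ - toTorus z)) 2 volume = eLpNorm f 2 volume :=
          eLpNorm_comp_measurePreserving hf.aestronglyMeasurable hmp
        calc _ ≤ eLpNorm (fun ξ => f (ξ - toTorus z)) 2 volume + eLpNorm f 2 volume :=
              eLpNorm_sub_le (hf.comp_measurable hmp.measurable).aestronglyMeasurable
                hf.aestronglyMeasurable (by norm_num)
          _ = _ := by rw [h4, two_mul]
    _ = _ := by simp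

theorem jumpIntegrand_aesm {d : ℕ} {a : EuclideanSpace ℝ (Fin d) → ℝ} (ha : IsJumpKernel a)
    {m : UnitAddTorus (Fin d) → UnitAddTorus (Fin d) → ℝ}
    (hm : Measurable fun q : UnitAddTorus (Fin d) × UnitAddTorus (Fin d) => m q.1 q.2)
    (f : UnitAddTorus (Fin d) → ℝ) (hf : StronglyMeasurable f) :
    AEStronglyMeasurable (fun w : UnitAddTorus (Fin d) × EuclideanSpace ℝ (Fin d) =>
      jumpIntegrand a m f w.1 w.2) (volume.prod volume) := by
  have hmap : Measurable fun w : UnitAddTorus (Fin d) × EuclideanSpace ℝ (Fin d) =>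
      w.1 - toTorus w.2 := measurable_fst.sub (measurable_toTorus.comp measurable_snd)
  have hD : StronglyMeasurable fun w : UnitAddTorus (Fin d) × EuclideanSpace ℝ (Fin d) =>
      f (w.1 - toTorus w.2) - f w.1 :=
    (hf.comp_measurable hmap).sub (hf.comp_measurable measurable_fst)
  have h2 : AEStronglyMeasurable (fun w : UnitAddTorus (Fin d) × EuclideanSpace ℝ (Fin d) =>
      a w.2) (volume.prod volume) := ha.integrable.aestronglyMeasurable.comp_snd
  have h3 : Measurable fun w : UnitAddTorus (Fin d) × EuclideanSpace ℝ (Fin d) =>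
      m w.1 (w.1 - toTorus w.2) := hm.comp (measurable_fst.prodMk hmap)
  exact (hD.aestronglyMeasurable.mul h2).mul h3.aestronglyMeasurable

theorem jumpIntegrand_integrable {d : ℕ} {a : EuclideanSpace ℝ (Fin d) → ℝ} (ha : IsJumpKernel a)
    {m : UnitAddTorus (Fin d) → UnitAddTorus (Fin d) → ℝ}
    (hm : Measurable fun q : UnitAddTorus (Fin d) × UnitAddTorus (Fin d) => m q.1 q.2)
    {C : ℝ} (hC : ∀ x y, |m x y| ≤ C) (f : TorusL2 d) :
    ∀ᵐ ξ, Integrable (jumpIntegrand a m f ξ) := by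
  have hf : StronglyMeasurable f := Lp.stronglyMeasurable f
  have hb := jump_bound ha hC f hf
  have hA := jumpIntegrand_aesm ha hm f hf
  have hfin : ∫⁻ ξ, (∫⁻ z, ‖jumpIntegrand a m f ξ z‖ₑ) ^ 2 ≠ ⊤ := by
    refine ne_top_of_le_ne_top ?_ hb
    have := (Lp.memLp f).eLpNorm_ne_top
    finiteness
  have h1 := ae_lt_top' ((hA.enorm.lintegral_prod_right').pow_const 2) hfin
  filter_upwards [h1, hA.prodMk_left] with ξ h2 h3
  refine ⟨h3, ?_⟩
  rw [HasFiniteIntegral]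
  by_contra hcon
  rw [not_lt, top_le_iff] at hcon
  simp [hcon] at h2

theorem jumpIntegral_bound {d : ℕ} {a : EuclideanSpace ℝ (Fin d) → ℝ} (ha : IsJumpKernel a)
    {m : UnitAddTorus (Fin d) → UnitAddTorus (Fin d) → ℝ}
    (hm : Measurable fun q : UnitAddTorus (Fin d) × UnitAddTorus (Fin d) => m q.1 q.2)
    {C : ℝ} (hC : ∀ x y, |m x y| ≤ C) (f : TorusL2 d) :
    AEStronglyMeasurable (jumpIntegral a m f) volume ∧
      eLpNorm (jumpIntegral a m f) 2 volume ≤ ENNReal.ofReal C * (2 * eLpNorm f 2 volume) := by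
  have hf : StronglyMeasurable f := Lp.stronglyMeasurable f
  refine ⟨(jumpIntegrand_aesm ha hm f hf).integral_prod_right', ?_⟩
  have h2 := eLpNorm_nnreal_pow_eq_lintegral
    (μ := (volume : Measure (UnitAddTorus (Fin d))))
    (f := jumpIntegral a m f) (p := 2) (by norm_num)
  have h3 : eLpNorm (jumpIntegral a m f) 2 volume ^ 2 =
    ∫⁻ ξ, ‖jumpIntegral a m f ξ‖ₑ ^ 2 := by simpa only [NNReal.coe_ofNat, ENNReal.coe_ofNat, ENNReal.rpow_ofNat] using h2
  rw [← ENNReal.pow_le_pow_left_iff two_ne_zero, h3, mul_pow]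
  refine le_trans (lintegral_mono fun ξ => ?_) (jump_bound ha hC f hf)
  have : ‖jumpIntegral a m f ξ‖ₑ ≤ ∫⁻ z, ‖jumpIntegrand a m f ξ z‖ₑ :=
    enorm_integral_le_lintegral_enorm _
  gcongr

/-- The jump operator exists for every jump kernel and every bounded measurable coefficient. -/
theorem exists_isJumpOperator {d : ℕ} {a : EuclideanSpace ℝ (Fin d) → ℝ} (ha : IsJumpKernel a)
    {m : UnitAddTorus (Fin d) → UnitAddTorus (Fin d) → ℝ}
    (hm : Measurable fun q : UnitAddTorus (Fin d) × UnitAddTorus (Fin d) => m q.1 q.2)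
    {C : ℝ} (hC : ∀ x y, |m x y| ≤ C) : ∃ T, IsJumpOperator a m T := by
  have hmem : ∀ f : TorusL2 d, MemLp (jumpIntegral a m f) 2 volume := fun f =>
    ⟨(jumpIntegral_bound ha hm hC f).1, lt_of_le_of_lt (jumpIntegral_bound ha hm hC f).2 (by
      have := (Lp.memLp f).eLpNorm_ne_top
      finiteness)⟩
  have hC0 : 0 ≤ C := (abs_nonneg _).trans (hC 0 0)
  let L : TorusL2 d →ₗ[ℝ] TorusL2 d :=
    { toFun := fun f => (hmem f).toLp
      map_add' := by
        intro f g
        rw [← MemLp.toLp_add, MemLp.toLp_eq_toLp_iff]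
        filter_upwards [jumpIntegrand_integrable ha hm hC f, jumpIntegrand_integrable ha hm hC g,
          Lp.coeFn_add f g, jump_ae (Lp.coeFn_add f g)] with ξ h1 h2 h3 h4
        simp only [Pi.add_apply]
        unfold jumpIntegral
        erw [← integral_add h1 h2]
        refine integral_congr_ae ?_
        filter_upwards [h4] with z hz
        simp only [jumpIntegrand, hz, h3, Pi.add_apply]
        ring
      map_smul' := by
        intro c f
        rw [RingHom.id_apply, ← MemLp.toLp_const_smul, MemLp.toLp_eq_toLp_iff]
        filter_upwards [Lp.coeFn_smul c f, jump_ae (Lp.coeFn_smul c f)] with ξ h3 h4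
        simp only [Pi.smul_apply, smul_eq_mul]
        unfold jumpIntegral
        rw [← integral_const_mul]
        refine integral_congr_ae ?_
        filter_upwards [h4] with z hz
        simp only [hz, h3, Pi.smul_apply, smul_eq_mul]
        ring }
  refine ⟨L.mkContinuous (C * 2) fun f => ?_, fun f => (hmem f).coeFn_toLp⟩
  change ‖(hmem f).toLp‖ ≤ _
  rw [Lp.norm_toLp, Lp.norm_def]
  refine (ENNReal.toReal_mono ?_ (jumpIntegral_bound ha hm hC f).2).trans_eq ?_
  · have := (Lp.memLp f).eLpNorm_ne_top
    finiteness
  · rw [ENNReal.toReal_mul, ENNReal.toReal_mul, ENNReal.toReal_ofReal hC0]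
    simp [mul_assoc]

/-- `v : ℝ → L²(𝕋^d)` solves `∂_s v = A(s) v + g(s)` on `ℝ`, in integrated form: `v` is continuous
(hence locally absolutely continuous) and `v(t) - v(s) = ∫_s^t (A(r) v(r) + g(r)) dr`. -/
def IsEvolutionSolution {d : ℕ} (A : ℝ → TorusL2 d →L[ℝ] TorusL2 d) (g v : ℝ → TorusL2 d) : Prop :=
  Continuous v ∧ ∀ s t : ℝ,
    IntervalIntegrable (fun r => A r (v r) + g r) volume s t ∧
    v t - v s = ∫ r in s..t, (A r (v r) + g r)

/-- `p` solves the backward problem `-∂_t p = A*(t) p` for `t ≤ N`, `p(N) = 1`, in integrated form.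
Only the values of `p` on `(-∞, N]` matter. -/
def IsBackwardSolution {d : ℕ} (A : ℝ → TorusL2 d →L[ℝ] TorusL2 d) (N : ℝ)
    (p : ℝ → TorusL2 d) : Prop :=
  ContinuousOn p (Iic N) ∧ ∀ t ≤ N,
    IntervalIntegrable (fun r => ContinuousLinearMap.adjoint (A r) (p r)) volume t N ∧
    p t = torusConst d 1 + ∫ r in t..N, ContinuousLinearMap.adjoint (A r) (p r)

open Classical in
/-- The solution `p^N` of the backward problem with `p^N(N) = 1` (`0` if there is none). -/
noncomputable def backwardSolution {d : ℕ} (A : ℝ → TorusL2 d →L[ℝ] TorusL2 d) (N : ℝ) :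
    ℝ → TorusL2 d :=
  if h : ∃ p, IsBackwardSolution A N p then h.choose else 0

/-- `p_∞(s) = lim_{N → ∞} p^N(s)`, the limit being taken in `L²(𝕋^d)`. -/
noncomputable def pInfty {d : ℕ} (A : ℝ → TorusL2 d →L[ℝ] TorusL2 d) (s : ℝ) : TorusL2 d :=
  limUnder atTop (fun N : ℝ => backwardSolution A N s)

/-- `τ` is an ergodic measure preserving dynamical system on `(Ω, P)` with time `ℝ`. -/
structure IsErgodicFlow {Ω : Type*} [MeasurableSpace Ω] (P : Measure Ω) (τ : ℝ → Ω → Ω) :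
    Prop where
  map_zero : ∀ ω, τ 0 ω = ω
  map_add : ∀ s t ω, τ (s + t) ω = τ s (τ t ω)
  measurePreserving : ∀ s, MeasurePreserving (τ s) P P
  ergodic : ∀ B : Set Ω, MeasurableSet B → (∀ s, τ s ⁻¹' B = B) → P B = 0 ∨ P B = 1

/-- A measurable process `X_ω(s)` is stationary, with respect to the dynamical system `τ`, if
`X_ω(t + s) = X_{τ_s ω}(t)`. -/
def IsStationaryProcess {Ω E : Type*} [MeasurableSpace Ω] [TopologicalSpace E]
    (τ : ℝ → Ω → Ω) (X : Ω → ℝ → E) : Prop :=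
  StronglyMeasurable (fun q : Ω × ℝ => X q.1 q.2) ∧
    ∀ (t s : ℝ) (ω : Ω), X ω (t + s) = X (τ s ω) t

/-- A stationary random coefficient `μ_ω(x, y; t)`, periodic in `x` and `y`, with
`α₁ ≤ μ ≤ α₂`. For fixed `ω`, `t` it is regarded as an element of `L^∞(𝕋^d × 𝕋^d)`, so that
`μ_ω(·, ·; t + s) = μ_{τ_s ω}(·, ·; t)` is equality almost everywhere. -/
structure IsStationaryCoefficient {Ω : Type*} [MeasurableSpace Ω] {d : ℕ} (τ : ℝ → Ω → Ω)
    (α₁ α₂ : ℝ) (μ : Ω → ℝ → UnitAddTorus (Fin d) → UnitAddTorus (Fin d) → ℝ) : Prop where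
  measurable : Measurable
    (fun q : (Ω × ℝ) × (UnitAddTorus (Fin d) × UnitAddTorus (Fin d)) =>
      μ q.1.1 q.1.2 q.2.1 q.2.2)
  bounds : ∀ ω t x y, α₁ ≤ μ ω t x y ∧ μ ω t x y ≤ α₂
  stationary : ∀ (t s : ℝ) (ω : Ω),
    ∀ᵐ q : UnitAddTorus (Fin d) × UnitAddTorus (Fin d),
      μ ω (t + s) q.1 q.2 = μ (τ s ω) t q.1 q.2

/-! ### Functions with bounded derivative in the integrated sense -/

section BoundedDeriv

variable {E : Type*} [NormedAddCommGroup E] [NormedSpace ℝ E]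

/-! The operators `A ω s` generate positive evolutions that fix constants, so the adjoint backward
evolution preserves sign and mean. The heart of the proof is a decay estimate uniform in the
coefficient. Let K be convolution with a on the torus. For f ≥ 0 one has A f + α₂ f ≥ α₁ K f, so a
forward solution dominates each term of the exponential series of α₁ K, up to the factor exp(-α₂ t).
The torus is compact and connected, hence finitely many powers of K together dominate a multiple of
the mean (`exists_doeblin`). After unit time a nonnegative solution therefore lies above a fixed
fraction of its initial mean; by duality the backward evolution contracts the L¹ norm of mean-zero
data (`IsMarkovData.exists_norm₁_contraction`).

L¹ decay becomes L² decay through the energy inequality ⟨A q, q⟩ ≤ M ‖q‖₁² - κ ‖q‖². It holds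
because the jump law is a part with bounded density, which costs only the L¹ norm, plus a part of
small mass, which the loss term absorbs (`exists_inner_jumpAverage_le`,
`IsMarkovData.exists_decay`). Hence p^N converges exponentially fast, and every backward solution
approaches its mean times p_∞. Dually, if g is orthogonal to p_∞, the pairing of a forward solution
with p_∞ is constant in time, and a solution orthogonal to p_∞ forgets its initial value
exponentially and stays bounded (`IsMarkovData.exists_forward_bounds`).

Existence is a pullback limit: start from 0 at time s - M, evaluate at time s, let M → ∞. The result
depends only on the coefficients seen from s, so it is stationary; ergodicity makes the bound on g
deterministic.

For uniqueness, let w be the difference of two stationary solutions. Its pairing with p_∞ is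
constant in time, hence deterministic by ergodicity. The distance from w to that constant function
is stationary and yet decays exponentially; since the flow preserves P, it vanishes. No bound on the
second solution is needed. -/

/-- On `[s, t]` the function `v` is a primitive of the bounded measurable function `F`. -/
structure HasBoundedDerivOn (F v : ℝ → E) (s t : ℝ) : Prop where
  aesm : AEStronglyMeasurable F (volume.restrict (Icc s t))
  bdd : ∃ C, ∀ r ∈ Icc s t, ‖F r‖ ≤ C
  eq_integral : ∀ r ∈ Icc s t, v r = v s + ∫ x in s..r, F x

namespace HasBoundedDerivOn

variable {F v : ℝ → E} {s t : ℝ}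

theorem integrableOn (h : HasBoundedDerivOn F v s t) : IntegrableOn F (Icc s t) := by
  obtain ⟨C, hC⟩ := h.bdd
  refine Integrable.of_bound h.aesm C ?_
  exact (ae_restrict_iff' measurableSet_Icc).2 (Eventually.of_forall hC)

theorem intervalIntegrable (h : HasBoundedDerivOn F v s t) {x y : ℝ} (hx : x ∈ Icc s t)
    (hy : y ∈ Icc s t) : IntervalIntegrable F volume x y :=
  intervalIntegrable_iff.2 (h.integrableOn.mono_set
    (uIoc_subset_uIcc.trans (uIcc_subset_Icc hx hy)))

theorem sub_eq (h : HasBoundedDerivOn F v s t) {x y : ℝ} (hx : x ∈ Icc s t)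
    (hy : y ∈ Icc s t) : v y - v x = ∫ r in x..y, F r := by
  have hs : s ∈ Icc s t := ⟨le_rfl, hx.1.trans hx.2⟩
  rw [h.eq_integral x hx, h.eq_integral y hy, add_sub_add_left_eq_sub,
    intervalIntegral.integral_interval_sub_left (h.intervalIntegrable hs hy)
      (h.intervalIntegrable hs hx)]

theorem mono (h : HasBoundedDerivOn F v s t) {s' t' : ℝ} (hs : s ≤ s') (ht : t' ≤ t) :
    HasBoundedDerivOn F v s' t' := by
  have hsub : Icc s' t' ⊆ Icc s t := Icc_subset_Icc hs ht
  refine ⟨h.aesm.mono_measure (Measure.restrict_mono hsub le_rfl), ?_, fun r hr => ?_⟩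
  · obtain ⟨C, hC⟩ := h.bdd
    exact ⟨C, fun r hr => hC r (hsub hr)⟩
  · rw [← h.sub_eq (hsub ⟨le_rfl, hr.1.trans hr.2⟩) (hsub hr)]
    abel

theorem exists_lipschitzOnWith (h : HasBoundedDerivOn F v s t) :
    ∃ K, LipschitzOnWith K v (Icc s t) := by
  obtain ⟨C, hC⟩ := h.bdd
  refine ⟨Real.toNNReal C, LipschitzOnWith.of_dist_le_mul fun x hx y hy => ?_⟩
  rw [dist_eq_norm, h.sub_eq hy hx]
  refine (intervalIntegral.norm_integral_le_of_norm_le_const (C := Real.toNNReal C)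
    fun r hr => ?_).trans_eq ?_
  · exact (hC r (uIcc_subset_Icc hy hx (uIoc_subset_uIcc hr))).trans (Real.le_coe_toNNReal C)
  · rw [Real.dist_eq]

theorem continuousOn (h : HasBoundedDerivOn F v s t) : ContinuousOn v (Icc s t) :=
  h.exists_lipschitzOnWith.choose_spec.continuousOn

theorem exists_norm_le (h : HasBoundedDerivOn F v s t) : ∃ C, ∀ r ∈ Icc s t, ‖v r‖ ≤ C :=
  isCompact_Icc.exists_bound_of_continuousOn h.continuousOn

theorem ae_hasDerivAt [CompleteSpace E] (h : HasBoundedDerivOn F v s t) :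
    ∀ᵐ x, x ∈ Icc s t → HasDerivAt v (F x) x := by
  rcases lt_or_ge t s with hst | hst
  · exact Eventually.of_forall fun x hx => absurd (hx.1.trans hx.2) hst.not_ge
  have hs : s ∈ Icc s t := ⟨le_rfl, hst⟩
  -- The endpoints are discarded: the formula for `v` is known only inside the interval, while the
  -- derivative is two-sided.
  have h1 : ∀ᵐ x : ℝ, x ≠ s := by simp [ae_iff]
  have h2 : ∀ᵐ x : ℝ, x ≠ t := by simp [ae_iff]
  filter_upwards [(h.intervalIntegrable hs ⟨hst, le_rfl⟩).ae_hasDerivAt_integral, h1, h2]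
    with x hx hxs hxt hmem
  have hd := (hx (by rwa [uIcc_of_le hst]) s (by simp)).const_add (v s)
  refine hd.congr_of_eventuallyEq ?_
  filter_upwards [Icc_mem_nhds (lt_of_le_of_ne hmem.1 hxs.symm) (lt_of_le_of_ne hmem.2 hxt)]
    with y hy
  exact h.eq_integral y hy

/-- A converse to Lebesgue differentiation: minus the primitive of `F`, the function is absolutely
continuous with derivative zero almost everywhere, hence constant. -/
theorem of_lipschitz [CompleteSpace E] {K : NNReal} (hv : LipschitzOnWith K v (Icc s t))
    (hF : AEStronglyMeasurable F (volume.restrict (Icc s t))) (hb : ∃ C, ∀ r ∈ Icc s t, ‖F r‖ ≤ C)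
    (hd : ∀ᵐ x, x ∈ Icc s t → HasDerivAt v (F x) x) : HasBoundedDerivOn F v s t := by
  rcases lt_or_ge t s with hst | hst
  · exact ⟨hF, hb, fun x hx => absurd (hx.1.trans hx.2) hst.not_ge⟩
  refine ⟨hF, hb, ?_⟩
  let w : ℝ → E := fun r => ∫ x in s..r, F x
  have hw : HasBoundedDerivOn F w s t := ⟨hF, hb, fun r _ => by simp [w]⟩
  obtain ⟨K', hK'⟩ := hw.exists_lipschitzOnWith
  have hac : AbsolutelyContinuousOnInterval (v - w) s t := by
    refine AbsolutelyContinuousOnInterval.sub ?_ ?_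
    · exact LipschitzOnWith.absolutelyContinuousOnInterval (by rwa [uIcc_of_le hst])
    · exact LipschitzOnWith.absolutelyContinuousOnInterval (by rwa [uIcc_of_le hst])
  obtain ⟨c, hc⟩ := hac.const_of_ae_hasDerivAt_zero (by
    filter_upwards [hd, hw.ae_hasDerivAt] with x h1 h2 hx
    rw [uIcc_of_le hst] at hx
    simpa using (h1 hx).sub (h2 hx))
  intro r hr
  have h1 := hc r (by rwa [uIcc_of_le hst])
  have h2 := hc s (by simp)
  simp only [Pi.sub_apply, w, intervalIntegral.integral_same, sub_zero] at h1 h2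
  rw [h2, ← h1]
  abel

/-- The product rule holds at almost every time, and a product of bounded Lipschitz functions is
Lipschitz, so it can be integrated back. All duality and energy identities below are instances. -/
theorem bilinear {E' G : Type*} [NormedAddCommGroup E'] [NormedSpace ℝ E'] [NormedAddCommGroup G]
    [NormedSpace ℝ G] [CompleteSpace E] [CompleteSpace E'] [CompleteSpace G]
    (L : E →L[ℝ] E' →L[ℝ] G) (h : HasBoundedDerivOn F v s t) {F' v' : ℝ → E'}
    (h' : HasBoundedDerivOn F' v' s t) :
    HasBoundedDerivOn (fun r => L (F r) (v' r) + L (v r) (F' r)) (fun r => L (v r) (v' r)) s t := by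
  obtain ⟨C, hC⟩ := h.bdd
  obtain ⟨C', hC'⟩ := h'.bdd
  obtain ⟨D, hD⟩ := h.exists_norm_le
  obtain ⟨D', hD'⟩ := h'.exists_norm_le
  obtain ⟨K, hK⟩ := h.exists_lipschitzOnWith
  obtain ⟨K', hK'⟩ := h'.exists_lipschitzOnWith
  have hLc : Continuous fun q : E × E' => L q.1 q.2 := L.continuous₂
  have hL : ∀ x y, ‖L x y‖ ≤ ‖L‖ * ‖x‖ * ‖y‖ := L.le_opNorm₂
  refine of_lipschitz (K := Real.toNNReal (‖L‖ * K * D' + ‖L‖ * D * K')) ?_ ?_ ?_ ?_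
  · refine LipschitzOnWith.of_dist_le_mul fun x hx y hy => ?_
    have e1 := hK.dist_le_mul x hx y hy
    have e2 := hK'.dist_le_mul x hx y hy
    have hD0 : 0 ≤ D := (norm_nonneg _).trans (hD x hx)
    rw [dist_eq_norm] at e1 e2 ⊢
    have : L (v x) (v' x) - L (v y) (v' y) = L (v x - v y) (v' x) + L (v y) (v' x - v' y) := by
      simp
    rw [this]
    calc _ ≤ ‖L‖ * ‖v x - v y‖ * ‖v' x‖ + ‖L‖ * ‖v y‖ * ‖v' x - v' y‖ :=
          (norm_add_le _ _).trans (add_le_add (hL _ _) (hL _ _))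
      _ ≤ ‖L‖ * (K * dist x y) * D' + ‖L‖ * D * (K' * dist x y) := by
          gcongr
          · exact hD' x hx
          · exact hD y hy
      _ = (‖L‖ * K * D' + ‖L‖ * D * K') * dist x y := by ring
      _ ≤ _ := by
          gcongr
          exact Real.le_coe_toNNReal _
  · have m1 := h.continuousOn.aestronglyMeasurable (μ := volume) measurableSet_Icc
    have m2 := h'.continuousOn.aestronglyMeasurable (μ := volume) measurableSet_Icc
    exact (hLc.comp_aestronglyMeasurable (h.aesm.prodMk m2)).add
      (hLc.comp_aestronglyMeasurable (m1.prodMk h'.aesm))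
  · refine ⟨‖L‖ * C * D' + ‖L‖ * D * C', fun r hr => (norm_add_le _ _).trans ?_⟩
    have hC0 : 0 ≤ C := (norm_nonneg _).trans (hC r hr)
    have hD0 : 0 ≤ D := (norm_nonneg _).trans (hD r hr)
    refine add_le_add ((hL _ _).trans ?_) ((hL _ _).trans ?_)
    · gcongr
      · exact hC r hr
      · exact hD' r hr
    · gcongr
      · exact hD r hr
      · exact hC' r hr
  · filter_upwards [h.ae_hasDerivAt, h'.ae_hasDerivAt] with x h1 h2 hx
    have h3 := L.hasFDerivAt_of_bilinear (h1 hx).hasFDerivAt (h2 hx).hasFDerivAt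
    have h4 := h3.hasDerivAt
    simpa [add_comm] using h4

theorem sub {F' v' : ℝ → E} (h : HasBoundedDerivOn F v s t) (h' : HasBoundedDerivOn F' v' s t) :
    HasBoundedDerivOn (fun r => F r - F' r) (fun r => v r - v' r) s t := by
  obtain ⟨C, hC⟩ := h.bdd
  obtain ⟨C', hC'⟩ := h'.bdd
  refine ⟨h.aesm.sub h'.aesm, ⟨C + C', fun r hr => (norm_sub_le _ _).trans
    (add_le_add (hC r hr) (hC' r hr))⟩, fun r hr => ?_⟩
  have hs : s ∈ Icc s t := ⟨le_rfl, hr.1.trans hr.2⟩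
  rw [h.eq_integral r hr, h'.eq_integral r hr, intervalIntegral.integral_sub
    (h.intervalIntegrable hs hr) (h'.intervalIntegrable hs hr)]
  abel

theorem const_smul (h : HasBoundedDerivOn F v s t) (c : ℝ) :
    HasBoundedDerivOn (fun r => c • F r) (fun r => c • v r) s t := by
  obtain ⟨C, hC⟩ := h.bdd
  refine ⟨h.aesm.const_smul c, ⟨|c| * C, fun r hr => ?_⟩, fun r hr => ?_⟩
  · rw [norm_smul, Real.norm_eq_abs]
    exact mul_le_mul_of_nonneg_left (hC r hr) (abs_nonneg c)
  · rw [h.eq_integral r hr, intervalIntegral.integral_smul, smul_add]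

theorem congr {F' v' : ℝ → E} (h : HasBoundedDerivOn F v s t) (hF : ∀ r ∈ Icc s t, F' r = F r)
    (hv : ∀ r ∈ Icc s t, v' r = v r) : HasBoundedDerivOn F' v' s t := by
  obtain ⟨C, hC⟩ := h.bdd
  refine ⟨h.aesm.congr ?_, ⟨C, fun r hr => by rw [hF r hr]; exact hC r hr⟩, fun r hr => ?_⟩
  · exact (ae_restrict_iff' measurableSet_Icc).2 (Eventually.of_forall fun r hr => (hF r hr).symm)
  · have hs : s ∈ Icc s t := ⟨le_rfl, hr.1.trans hr.2⟩
    rw [hv r hr, hv s hs, h.eq_integral r hr]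
    congr 1
    refine intervalIntegral.integral_congr fun x hx => ?_
    exact (hF x (uIcc_subset_Icc hs hr hx)).symm

theorem comp_add_left (h : HasBoundedDerivOn F v s t) (a : ℝ) :
    HasBoundedDerivOn (fun r => F (a + r)) (fun r => v (a + r)) (s - a) (t - a) := by
  have hmem : ∀ r ∈ Icc (s - a) (t - a), a + r ∈ Icc s t := fun r hr =>
    ⟨by linarith [hr.1], by linarith [hr.2]⟩
  refine ⟨?_, ?_, fun r hr => ?_⟩
  · have hmp : MeasurePreserving (fun r : ℝ => a + r) volume volume :=
      measurePreserving_add_left volume a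
    have := hmp.restrict_preimage (s := Icc s t) measurableSet_Icc
    rw [preimage_const_add_Icc] at this
    exact h.aesm.comp_measurePreserving this
  · obtain ⟨C, hC⟩ := h.bdd
    exact ⟨C, fun r hr => hC _ (hmem r hr)⟩
  · rw [intervalIntegral.integral_comp_add_left (fun x => F x) a, h.eq_integral _ (hmem r hr)]
    simp

/-- Time reversal, which turns the backward equation into a forward one started at time 0. -/
theorem comp_sub_left (h : HasBoundedDerivOn F v s t) (a : ℝ) :
    HasBoundedDerivOn (fun r => -F (a - r)) (fun r => v (a - r)) (a - t) (a - s) := by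
  have hmem : ∀ r ∈ Icc (a - t) (a - s), a - r ∈ Icc s t := fun r hr =>
    ⟨by linarith [hr.2], by linarith [hr.1]⟩
  refine ⟨?_, ?_, fun r hr => ?_⟩
  · have hmp : MeasurePreserving (fun r : ℝ => a - r) volume volume :=
      Measure.measurePreserving_sub_left volume a
    have := hmp.restrict_preimage (s := Icc s t) measurableSet_Icc
    rw [preimage_const_sub_Icc] at this
    exact (h.aesm.comp_measurePreserving this).neg
  · obtain ⟨C, hC⟩ := h.bdd
    exact ⟨C, fun r hr => by rw [norm_neg]; exact hC _ (hmem r hr)⟩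
  · have ht : t ∈ Icc s t := ⟨by linarith [hr.1, hr.2], le_rfl⟩
    rw [intervalIntegral.integral_neg, intervalIntegral.integral_comp_sub_left (fun x => F x) a,
      ← h.sub_eq (hmem r hr) (by simpa using ht)]
    abel

theorem of_hasDerivAt [CompleteSpace E] (hd : ∀ r, HasDerivAt v (F r) r) (hF : Continuous F) :
    HasBoundedDerivOn F v s t := by
  refine ⟨hF.aestronglyMeasurable, isCompact_Icc.exists_bound_of_continuousOn hF.continuousOn,
    fun r _ => ?_⟩
  rw [intervalIntegral.integral_eq_sub_of_hasDerivAt (fun x _ => hd x)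
    (hF.intervalIntegrable _ _)]
  abel

/-- An integrating factor; it serves both to remove the shift `β` from the generator and to weight
the energy identity. -/
theorem exp_smul [CompleteSpace E] (h : HasBoundedDerivOn F v s t) (c : ℝ) :
    HasBoundedDerivOn (fun r => Real.exp (c * r) • (F r + c • v r))
      (fun r => Real.exp (c * r) • v r) s t := by
  have h1 : HasBoundedDerivOn (fun r => Real.exp (c * r) * c) (fun r => Real.exp (c * r)) s t := by
    refine of_hasDerivAt (fun r => ?_) (by fun_prop)
    simpa using ((hasDerivAt_id r).const_mul c).exp
  refine (h1.bilinear (ContinuousLinearMap.lsmul ℝ ℝ) h).congr (fun r _ => ?_) fun r _ => ?_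
  · simp [smul_smul, add_comm]
  · simp

end HasBoundedDerivOn

end BoundedDeriv

/-! ### Linear evolution equations with bounded measurable coefficients -/

section Picard

variable {E : Type*} [NormedAddCommGroup E] [NormedSpace ℝ E]

/-- Picard iterates for `w' = b(r) w + h(r)`, `w(0) = f`. -/
noncomputable def picardIter (b : ℝ → E →L[ℝ] E) (h : ℝ → E) (f : E) : ℕ → ℝ → E
  | 0 => fun _ => f
  | n + 1 => fun r => f + ∫ x in (0 : ℝ)..r, (b x (picardIter b h f n x) + h x)

/-- The solution of `w' = b(r) w + h(r)`, `w(0) = f`, on `[0, ∞)`. -/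
noncomputable def picardSol [Nonempty E] (b : ℝ → E →L[ℝ] E) (h : ℝ → E) (f : E) (r : ℝ) : E :=
  limUnder atTop fun n => picardIter b h f n r

/-- A Carathéodory argument: measurable in the parameter and continuous in the vector, hence jointly
measurable. Only strong-operator measurability is asked, since the operator norm topology is not
separable in general. -/
theorem MeasureTheory.StronglyMeasurable.apply_clm {Θ : Type*} [MeasurableSpace Θ]
    [SecondCountableTopology E] {B : Θ → E →L[ℝ] E} (hB : ∀ x, StronglyMeasurable fun θ => B θ x)
    {w : Θ → E} (hw : StronglyMeasurable w) : StronglyMeasurable fun θ => B θ (w θ) := by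
  borelize E
  have h := stronglyMeasurable_uncurry_of_continuous_of_stronglyMeasurable
    (u := fun (x : E) (θ : Θ) => B θ x) (fun θ => (B θ).continuous) hB
  exact h.comp_measurable (hw.measurable.prodMk measurable_id)

/-- The moving endpoint is absorbed into an indicator, one for each orientation of the interval, so
that measurability of parameter integrals over a fixed space applies. -/
theorem MeasureTheory.StronglyMeasurable.intervalIntegral_prod {Θ : Type*} [MeasurableSpace Θ]
    {F : Θ × ℝ → E} (hF : StronglyMeasurable F) :
    StronglyMeasurable fun q : Θ × ℝ => ∫ x in (0 : ℝ)..q.2, F (q.1, x) := by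
  have aux : ∀ S : Set ((Θ × ℝ) × ℝ), MeasurableSet S →
      StronglyMeasurable fun q : Θ × ℝ => ∫ x, S.indicator (fun z => F (z.1.1, z.2)) (q, x) := by
    intro S hS
    refine StronglyMeasurable.integral_prod_right (f := fun q x =>
      S.indicator (fun z : (Θ × ℝ) × ℝ => F (z.1.1, z.2)) (q, x)) ?_
    exact (hF.comp_measurable (by fun_prop)).indicator hS
  have h1 := aux {z | z.2 ∈ Ioc 0 z.1.2} (by measurability)
  have h2 := aux {z | z.2 ∈ Ioc z.1.2 0} (by measurability)
  have key : (fun q : Θ × ℝ => ∫ x in (0 : ℝ)..q.2, F (q.1, x)) = fun q =>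
      (∫ x, {z : (Θ × ℝ) × ℝ | z.2 ∈ Ioc 0 z.1.2}.indicator (fun z => F (z.1.1, z.2)) (q, x)) -
      ∫ x, {z : (Θ × ℝ) × ℝ | z.2 ∈ Ioc z.1.2 0}.indicator (fun z => F (z.1.1, z.2)) (q, x) := by
    funext q
    rw [intervalIntegral, ← integral_indicator measurableSet_Ioc,
      ← integral_indicator measurableSet_Ioc]
    rfl
  rw [key]
  exact h1.sub h2

theorem stronglyMeasurable_picardIter {Θ : Type*} [MeasurableSpace Θ]
    [SecondCountableTopology E] {b : Θ → ℝ → E →L[ℝ] E} {h : Θ → ℝ → E}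
    (hb : ∀ x, StronglyMeasurable fun q : Θ × ℝ => b q.1 q.2 x)
    (hh : StronglyMeasurable fun q : Θ × ℝ => h q.1 q.2) (f : E) (n : ℕ) :
    StronglyMeasurable fun q : Θ × ℝ => picardIter (b q.1) (h q.1) f n q.2 := by
  induction n with
  | zero => exact stronglyMeasurable_const
  | succ n ih =>
    exact stronglyMeasurable_const.add
      (StronglyMeasurable.intervalIntegral_prod (F := fun q : Θ × ℝ =>
        b q.1 q.2 (picardIter (b q.1) (h q.1) f n q.2) + h q.1 q.2)
        ((StronglyMeasurable.apply_clm hb ih).add hh))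

/-- The reason for solving by explicit iteration: a pointwise limit is measurable in all parameters,
including at points (such as negative times) where convergence is not claimed. -/
theorem stronglyMeasurable_picardSol {Θ : Type*} [MeasurableSpace Θ] [CompleteSpace E]
    [SecondCountableTopology E] {b : Θ → ℝ → E →L[ℝ] E} {h : Θ → ℝ → E}
    (hb : ∀ x, StronglyMeasurable fun q : Θ × ℝ => b q.1 q.2 x)
    (hh : StronglyMeasurable fun q : Θ × ℝ => h q.1 q.2) (f : E) :
    StronglyMeasurable fun q : Θ × ℝ => picardSol (b q.1) (h q.1) f q.2 :=
  StronglyMeasurable.limUnder fun n => stronglyMeasurable_picardIter hb hh f n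

section Convergence

variable {b : ℝ → E →L[ℝ] E} {h : ℝ → E} {C R : ℝ}

theorem intervalIntegrable_clm_apply_add [SecondCountableTopology E]
    (hb : ∀ x, StronglyMeasurable fun r => b r x) (hbC : ∀ r, ‖b r‖ ≤ C)
    (hh : StronglyMeasurable h) (hhR : ∀ r, ‖h r‖ ≤ R) {w : ℝ → E} (hw : Continuous w) (s t : ℝ) :
    IntervalIntegrable (fun x => b x (w x) + h x) volume s t := by
  have hC : Continuous fun x => C * ‖w x‖ + R := by fun_prop
  refine (hC.intervalIntegrable s t).mono_fun
    ((StronglyMeasurable.apply_clm hb hw.stronglyMeasurable).add hh).aestronglyMeasurable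
    (Eventually.of_forall fun x => ?_)
  refine (norm_add_le _ _).trans ((add_le_add ?_ (hhR x)).trans (le_abs_self _))
  exact (b x).le_of_opNorm_le (hbC x) _

/-- The coefficients `b` and the source `h` are measurable and bounded by `C` and `R`. -/
structure IsPicardData (b : ℝ → E →L[ℝ] E) (h : ℝ → E) (C R : ℝ) : Prop where
  meas : ∀ x, StronglyMeasurable fun r => b r x
  one_le : 1 ≤ C
  norm_le : ∀ r, ‖b r‖ ≤ C
  source_meas : StronglyMeasurable h
  source_norm_le : ∀ r, ‖h r‖ ≤ R

variable [SecondCountableTopology E]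

theorem continuous_picardIter (hd : IsPicardData b h C R) (f : E) (n : ℕ) :
    Continuous (picardIter b h f n) := by
  induction n with
  | zero => exact continuous_const
  | succ n ih =>
    exact continuous_const.add (intervalIntegral.continuous_primitive
      (fun s t => intervalIntegrable_clm_apply_add hd.meas hd.norm_le hd.source_meas
        hd.source_norm_le ih s t) 0)

/-- In the sup norm weighted by `exp (-2 C r)` the Picard map contracts by 1/2, so convergence on
the whole half-line needs no subdivision of time. -/
theorem norm_picardIter_succ_sub_le (hd : IsPicardData b h C R) (f : E) (n : ℕ) {r : ℝ}
    (hr : 0 ≤ r) :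
    ‖picardIter b h f (n + 1) r - picardIter b h f n r‖ ≤
      (C * ‖f‖ + R) * Real.exp (2 * C * r) / 2 ^ n := by
  have hR : 0 ≤ R := (norm_nonneg _).trans (hd.source_norm_le 0)
  have hC1 := hd.one_le
  induction n generalizing r with
  | zero =>
    simp only [picardIter, add_sub_cancel_left, pow_zero, div_one]
    refine (intervalIntegral.norm_integral_le_of_norm_le_const (C := C * ‖f‖ + R)
      fun x _ => (norm_add_le _ _).trans (add_le_add ((b x).le_of_opNorm_le (hd.norm_le x) _)
      (hd.source_norm_le x))).trans ?_
    rw [sub_zero, abs_of_nonneg hr]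
    gcongr
    -- Here `1 ≤ C` enters: r ≤ 2Cr + 1 ≤ exp(2Cr).
    nlinarith [Real.add_one_le_exp (2 * C * r)]
  | succ n ih =>
    have i1 := intervalIntegrable_clm_apply_add hd.meas hd.norm_le hd.source_meas hd.source_norm_le
      (continuous_picardIter hd f (n + 1)) 0 r
    have i2 := intervalIntegrable_clm_apply_add hd.meas hd.norm_le hd.source_meas hd.source_norm_le
      (continuous_picardIter hd f n) 0 r
    have e : picardIter b h f (n + 1 + 1) r - picardIter b h f (n + 1) r =
        ∫ x in (0 : ℝ)..r, b x (picardIter b h f (n + 1) x - picardIter b h f n x) := by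
      have e1 : ∀ m, picardIter b h f (m + 1) r =
          f + ∫ x in (0 : ℝ)..r, (b x (picardIter b h f m x) + h x) := fun _ => rfl
      rw [e1, e1, add_sub_add_left_eq_sub, ← intervalIntegral.integral_sub i1 i2]
      simp
    rw [e]
    have hD : 0 ≤ C * ‖f‖ + R := by positivity
    set D := C * ‖f‖ + R with hDdef
    have hder : ∀ x, HasDerivAt (fun x => D / 2 ^ (n + 1) * Real.exp (2 * C * x))
        (C * (D * Real.exp (2 * C * x) / 2 ^ n)) x := by
      intro x
      have h1 := (((hasDerivAt_id x).const_mul (2 * C)).exp).const_mul (D / 2 ^ (n + 1))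
      refine h1.congr_deriv ?_
      simp only [id, pow_succ]
      field_simp
    have hcont : Continuous fun x => C * (D * Real.exp (2 * C * x) / 2 ^ n) := by fun_prop
    refine (intervalIntegral.norm_integral_le_of_norm_le hr (Eventually.of_forall fun x hx => ?_)
      (hcont.intervalIntegrable 0 r)).trans ?_
    · refine ((b x).le_of_opNorm_le (hd.norm_le x) _).trans ?_
      gcongr
      exact ih hx.1.le
    · rw [intervalIntegral.integral_eq_sub_of_hasDerivAt (fun x _ => hder x)
        (hcont.intervalIntegrable _ _)]
      simp only [mul_zero, Real.exp_zero, mul_one]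
      have : 0 ≤ D / 2 ^ (n + 1) := by positivity
      calc _ ≤ D / 2 ^ (n + 1) * Real.exp (2 * C * r) := by linarith
        _ = _ := by ring

variable [CompleteSpace E]

theorem tendsto_picardIter (hd : IsPicardData b h C R) (f : E) {r : ℝ} (hr : 0 ≤ r) :
    Tendsto (fun n => picardIter b h f n r) atTop (𝓝 (picardSol b h f r)) := by
  refine (cauchySeq_of_le_geometric_two (C := 2 * ((C * ‖f‖ + R) * Real.exp (2 * C * r)))
    fun n => ?_).tendsto_limUnder
  rw [dist_comm, dist_eq_norm]
  refine (norm_picardIter_succ_sub_le hd f n hr).trans_eq ?_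
  ring

/-- A bound independent of `n`, for dominated convergence. The initial iterate and the n-th one both
lie within twice the geometric constant of the limit, whence the factor 4. -/
theorem norm_picardIter_le (hd : IsPicardData b h C R) (f : E) (n : ℕ) {r : ℝ}
    (hr : 0 ≤ r) :
    ‖picardIter b h f n r‖ ≤ ‖f‖ + 4 * ((C * ‖f‖ + R) * Real.exp (2 * C * r)) := by
  have hR : 0 ≤ R := (norm_nonneg _).trans (hd.source_norm_le 0)
  have hC1 := hd.one_le
  have hD : 0 ≤ (C * ‖f‖ + R) * Real.exp (2 * C * r) := by positivity
  have hstep : ∀ n, dist (picardIter b h f n r) (picardIter b h f (n + 1) r) ≤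
      2 * ((C * ‖f‖ + R) * Real.exp (2 * C * r)) / 2 / 2 ^ n := by
    intro n
    rw [dist_comm, dist_eq_norm]
    refine (norm_picardIter_succ_sub_le hd f n hr).trans_eq ?_
    ring
  have ht := tendsto_picardIter hd f hr
  have h0 := dist_le_of_le_geometric_two_of_tendsto hstep ht 0
  have hn := dist_le_of_le_geometric_two_of_tendsto hstep ht n
  have e0 : picardIter b h f 0 r = f := rfl
  have hn' : 2 * ((C * ‖f‖ + R) * Real.exp (2 * C * r)) / 2 ^ n ≤
      2 * ((C * ‖f‖ + R) * Real.exp (2 * C * r)) :=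
    div_le_self (by positivity) (one_le_pow₀ one_le_two)
  have h3 := dist_triangle_right (picardIter b h f n r) f (picardSol b h f r)
  rw [e0, pow_zero, div_one] at h0
  have h4 : ‖picardIter b h f n r‖ ≤ ‖f‖ + dist (picardIter b h f n r) f := by
    rw [dist_eq_norm]
    have := norm_add_le f (picardIter b h f n r - f)
    rwa [add_sub_cancel] at this
  linarith

theorem picardSol_zero (hd : IsPicardData b h C R) (f : E) : picardSol b h f 0 = f := by
  refine tendsto_nhds_unique (tendsto_picardIter hd f le_rfl) ?_
  have : (fun n => picardIter b h f n 0) = fun _ => f := by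
    funext n
    cases n <;> simp [picardIter]
  rw [this]
  exact tendsto_const_nhds

theorem hasBoundedDerivOn_picardSol (hd : IsPicardData b h C R) (f : E) (T : ℝ) :
    HasBoundedDerivOn (fun r => b r (picardSol b h f r) + h r) (picardSol b h f) 0 T := by
  have hR : 0 ≤ R := (norm_nonneg _).trans (hd.source_norm_le 0)
  have hC1 := hd.one_le
  have ht := fun {r : ℝ} (hr : 0 ≤ r) => tendsto_picardIter hd f hr
  have hF : ∀ r, 0 ≤ r → Tendsto (fun n => b r (picardIter b h f n r) + h r) atTop
      (𝓝 (b r (picardSol b h f r) + h r)) := fun r hr =>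
    (((b r).continuous.tendsto _).comp (ht hr)).add_const _
  have hm : ∀ n, StronglyMeasurable fun r => b r (picardIter b h f n r) + h r := fun n =>
    (StronglyMeasurable.apply_clm hd.meas
      (continuous_picardIter hd f n).stronglyMeasurable).add hd.source_meas
  set D : ℝ → ℝ := fun r => C * (‖f‖ + 4 * ((C * ‖f‖ + R) * Real.exp (2 * C * r))) + R with hD
  have hDc : Continuous D := by fun_prop
  have hbd : ∀ n r, 0 ≤ r → ‖b r (picardIter b h f n r) + h r‖ ≤ D r := by
    intro n r hr
    refine (norm_add_le _ _).trans (add_le_add (((b r).le_of_opNorm_le (hd.norm_le r) _).trans ?_)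
      (hd.source_norm_le r))
    gcongr
    exact norm_picardIter_le hd f n hr
  refine ⟨?_, ?_, fun r hr => ?_⟩
  · refine aestronglyMeasurable_of_tendsto_ae atTop (fun n => (hm n).aestronglyMeasurable) ?_
    exact (ae_restrict_iff' measurableSet_Icc).2 (Eventually.of_forall fun r hr => hF r hr.1)
  · obtain ⟨M, hM⟩ := (isCompact_Icc (a := (0 : ℝ)) (b := T)).exists_bound_of_continuousOn
      hDc.continuousOn
    refine ⟨M, fun r hr => ?_⟩
    refine (le_of_tendsto' (hF r hr.1).norm fun n => hbd n r hr.1).trans ?_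
    exact (le_abs_self _).trans (hM r hr)
  · rw [picardSol_zero hd f]
    have h1 : Tendsto (fun n => picardIter b h f (n + 1) r) atTop (𝓝 (picardSol b h f r)) :=
      (tendsto_add_atTop_iff_nat 1).2 (ht hr.1)
    refine tendsto_nhds_unique h1 ?_
    simp only [picardIter]
    refine Tendsto.const_add _ ?_
    refine intervalIntegral.tendsto_integral_filter_of_dominated_convergence D
      (Eventually.of_forall fun n => (hm n).aestronglyMeasurable)
      (Eventually.of_forall fun n => Eventually.of_forall fun x hx => ?_)
      (hDc.intervalIntegrable 0 r) (Eventually.of_forall fun x hx => ?_)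
    · rw [uIoc_of_le hr.1] at hx
      exact hbd n x hx.1.le
    · rw [uIoc_of_le hr.1] at hx
      exact hF x hx.1.le

end Convergence

end Picard

/-! ### Weak measurability -/

/-- Expand in a Hilbert basis, which is countable by separability. It makes adjoints and jump
operators measurable, as these are only accessible through scalar products. -/
theorem stronglyMeasurable_of_inner {Θ H : Type*} [MeasurableSpace Θ] [NormedAddCommGroup H]
    [InnerProductSpace ℝ H] [CompleteSpace H] [SecondCountableTopology H] {f : Θ → H}
    (hf : ∀ x, Measurable fun θ => inner ℝ (f θ) x) : StronglyMeasurable f := by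
  obtain ⟨w, b, hb⟩ := exists_hilbertBasis ℝ H
  have hw : Countable w := by
    -- Orthonormal vectors are at distance √2; the cruder bound 1 already makes the balls of radius
    -- 1/2 disjoint, and a separable space holds only countably many.
    have hdist : ∀ i j : w, i ≠ j → 1 ≤ dist (b i) (b j) := by
      intro i j hij
      have h1 := b.orthonormal.1 i
      have h2 := b.orthonormal.1 j
      have h3 : inner ℝ (b i) (b j) = 0 := b.orthonormal.2 hij
      have h4 := norm_sub_sq_real (b i) (b j)
      rw [h1, h2, h3] at h4
      rw [dist_eq_norm]
      nlinarith [norm_nonneg (b i - b j)]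
    have hdisj : (univ : Set w).PairwiseDisjoint fun i => Metric.ball (b i) (1 / 2) := by
      intro i _ j _ hij
      exact Metric.ball_disjoint_ball (by linarith [hdist i j hij])
    have := hdisj.countable_of_isOpen (fun _ _ => Metric.isOpen_ball)
      fun i _ => ⟨b i, Metric.mem_ball_self (by norm_num)⟩
    exact countable_univ_iff.1 this
  have hs : ∀ θ, Tendsto (fun S : Finset w => ∑ i ∈ S, inner ℝ (f θ) (b i) • b i) atTop
      (𝓝 (f θ)) := by
    intro θ
    have := b.hasSum_repr (f θ)
    simp only [b.repr_apply_apply, real_inner_comm] at this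
    exact this
  refine stronglyMeasurable_of_tendsto atTop (f := fun S θ => ∑ i ∈ S, inner ℝ (f θ) (b i) • b i)
    (fun S => ?_) (tendsto_pi_nhds.2 hs)
  exact Finset.stronglyMeasurable_fun_sum _ fun i _ => (hf (b i)).stronglyMeasurable.smul_const _

/-! ### Order and duality in `L²(𝕋^d)` -/

section TorusL2

variable {d : ℕ}

instance : IsProbabilityMeasure (volume : Measure (UnitAddTorus (Fin d))) := by
  refine ⟨?_⟩
  rw [volume_pi, Measure.pi_univ]
  simp

instance : SecondCountableTopology (TorusL2 d) := by
  have : Fact ((2 : ENNReal) ≠ ⊤) := ⟨by simp⟩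
  infer_instance

instance : IsOrderedModule ℝ (TorusL2 d) := by
  refine IsOrderedModule.of_smul_nonneg fun c hc x hx => ?_
  rw [← Lp.coeFn_nonneg] at hx ⊢
  filter_upwards [hx, Lp.coeFn_smul c x] with ξ h1 h2
  rw [h2]
  exact mul_nonneg hc h1

theorem TorusL2.inner_eq (f g : TorusL2 d) : inner ℝ f g = ∫ ξ, f ξ * g ξ := by
  rw [L2.inner_def]
  simp [mul_comm]

theorem TorusL2.integrable_mul (f g : TorusL2 d) : Integrable fun ξ => f ξ * g ξ := by
  have := L2.integrable_inner (𝕜 := ℝ) f g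
  simpa [mul_comm] using this

theorem torusConst_coeFn (c : ℝ) : torusConst d c =ᵐ[volume] fun _ => c := Lp.coeFn_const ..

theorem inner_torusConst_one (f : TorusL2 d) : inner ℝ f (torusConst d 1) = ∫ ξ, f ξ := by
  rw [TorusL2.inner_eq]
  refine integral_congr_ae ?_
  filter_upwards [torusConst_coeFn (d := d) 1] with ξ h
  rw [h, mul_one]

theorem torusConst_eq_smul (c : ℝ) : torusConst d c = c • torusConst d 1 := by
  refine Lp.ext ?_
  filter_upwards [torusConst_coeFn (d := d) 1, torusConst_coeFn (d := d) c,
    Lp.coeFn_smul c (torusConst d 1)] with ξ h1 h2 h3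
  rw [h3, h2, Pi.smul_apply, h1, smul_eq_mul, mul_one]

theorem inner_torusConst_one_self : inner ℝ (torusConst d 1) (torusConst d 1) = (1 : ℝ) := by
  rw [inner_torusConst_one, integral_congr_ae (torusConst_coeFn (d := d) 1)]
  simp

theorem norm_torusConst_one : ‖torusConst d 1‖ = 1 := by
  have h := inner_torusConst_one_self (d := d)
  rw [real_inner_self_eq_norm_sq] at h
  exact (pow_eq_one_iff_of_nonneg (norm_nonneg _) two_ne_zero).1 h

theorem torusConst_one_nonneg : 0 ≤ torusConst d 1 := by
  rw [← Lp.coeFn_nonneg]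
  filter_upwards [torusConst_coeFn (d := d) 1] with ξ h
  rw [h]
  exact zero_le_one

theorem TorusL2.inner_nonneg {f g : TorusL2 d} (hf : 0 ≤ f) (hg : 0 ≤ g) :
    (0 : ℝ) ≤ inner ℝ f g := by
  rw [TorusL2.inner_eq]
  refine integral_nonneg_of_ae ?_
  rw [← Lp.coeFn_nonneg] at hf hg
  filter_upwards [hf, hg] with ξ h1 h2 using mul_nonneg h1 h2

theorem TorusL2.inner_posPart_negPart (f : TorusL2 d) : (inner ℝ f⁺ f⁻ : ℝ) = 0 := by
  rw [TorusL2.inner_eq]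
  refine integral_eq_zero_of_ae ?_
  filter_upwards [Lp.coeFn_sup f 0, Lp.coeFn_sup (-f) 0, Lp.coeFn_neg f,
    Lp.coeFn_zero ℝ 2 (volume : Measure (UnitAddTorus (Fin d)))] with ξ h1 h2 h3 h4
  rw [posPart_def, negPart_def, h1, h2]
  simp only [Pi.sup_apply, h3, Pi.neg_apply, h4, Pi.zero_apply]
  rcases le_total (f ξ) 0 with h | h
  · simp [h]
  · simp [h]

/-- Test against the negative part: ⟨f, f⁻⟩ = -‖f⁻‖². This is how order properties of forward
solutions are transferred to the backward equation. -/
theorem TorusL2.nonneg_of_inner {f : TorusL2 d}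
    (hf : ∀ g : TorusL2 d, 0 ≤ g → (0 : ℝ) ≤ inner ℝ f g) : 0 ≤ f := by
  have h1 := hf f⁻ (negPart_nonneg f)
  have h2 : (inner ℝ f f⁻ : ℝ) = -‖f⁻‖ ^ 2 := by
    nth_rewrite 1 [← posPart_sub_negPart f]
    rw [inner_sub_left, TorusL2.inner_posPart_negPart, real_inner_self_eq_norm_sq]
    ring
  have h3 : ‖f⁻‖ = 0 := by nlinarith [sq_nonneg ‖f⁻‖]
  rw [← negPart_eq_zero, ← norm_eq_zero]
  exact h3

theorem TorusL2.integral_nonneg {F : ℝ → TorusL2 d} {s t : ℝ} (hst : s ≤ t)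
    (hF : ∀ r ∈ Ioc s t, 0 ≤ F r) : 0 ≤ ∫ r in s..t, F r := by
  rw [intervalIntegral.integral_of_le hst]
  exact integral_nonneg_of_ae ((ae_restrict_iff' measurableSet_Ioc).2 (Eventually.of_forall hF))

/-- The `L¹` norm of an element of `L²(𝕋^d)`. -/
noncomputable def TorusL2.norm₁ (f : TorusL2 d) : ℝ := inner ℝ |f| (torusConst d 1)

theorem TorusL2.norm₁_nonneg (f : TorusL2 d) : 0 ≤ f.norm₁ :=
  TorusL2.inner_nonneg (abs_nonneg f) torusConst_one_nonneg

theorem TorusL2.norm₁_le (f : TorusL2 d) : f.norm₁ ≤ ‖f‖ := by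
  have := real_inner_le_norm |f| (torusConst d 1)
  rwa [norm_torusConst_one, mul_one, norm_abs_eq_norm] at this

theorem TorusL2.norm₁_of_nonneg {f : TorusL2 d} (hf : 0 ≤ f) :
    f.norm₁ = inner ℝ f (torusConst d 1) := by
  rw [TorusL2.norm₁, abs_of_nonneg hf]

/-- Integrate |f - g| ≤ f + g. The L¹ contraction uses it after a common lower bound has been
removed from both terms. -/
theorem TorusL2.norm₁_sub_le {f g : TorusL2 d} (hf : 0 ≤ f) (hg : 0 ≤ g) :
    (f - g).norm₁ ≤ inner ℝ f (torusConst d 1) + inner ℝ g (torusConst d 1) := by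
  rw [← inner_add_left, TorusL2.norm₁, ← sub_nonneg, ← inner_sub_left]
  refine TorusL2.inner_nonneg (sub_nonneg.2 ?_) torusConst_one_nonneg
  have h2 : |f - g| = (f - g) ⊔ -(f - g) := rfl
  rw [h2, neg_sub]
  refine sup_le ?_ ?_
  · rw [← sub_nonneg]
    convert add_nonneg hg hg using 1
    abel
  · rw [← sub_nonneg]
    convert add_nonneg hf hf using 1
    abel

theorem TorusL2.norm₁_eq_add (f : TorusL2 d) :
    f.norm₁ = inner ℝ f⁺ (torusConst d 1) + inner ℝ f⁻ (torusConst d 1) := by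
  rw [TorusL2.norm₁, ← inner_add_left, posPart_add_negPart]

end TorusL2

/-! ### Evolution families of Markov generators on `L²(𝕋^d)` -/

section MarkovFamily

variable {d : ℕ}

/-- A positive operator `K` whose powers satisfy a Doeblin minorization, together with admissible
constants. -/
structure IsMarkovData (K : TorusL2 d →L[ℝ] TorusL2 d) (α β C M κ c : ℝ) (m : ℕ) : Prop where
  nonneg : ∀ f, 0 ≤ f → 0 ≤ K f
  doeblin : ∀ f, 0 ≤ f → (c * inner ℝ f (torusConst d 1)) • torusConst d 1 ≤
    ∑ k ∈ Finset.range m, (K ^ k) f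
  alpha_pos : 0 < α
  beta_nonneg : 0 ≤ β
  one_le : 1 ≤ C
  M_nonneg : 0 ≤ M
  kappa_pos : 0 < κ
  c_pos : 0 < c

/-- A measurable family of bounded generators of Markov evolutions whose jump part dominates a
multiple of `K`. -/
structure IsMarkovFamily (K : TorusL2 d →L[ℝ] TorusL2 d) (α β C M κ : ℝ)
    (A : ℝ → TorusL2 d →L[ℝ] TorusL2 d) : Prop where
  meas : ∀ x, StronglyMeasurable fun r => A r x
  norm_le : ∀ r, ‖A r‖ ≤ C
  map_one : ∀ r, A r (torusConst d 1) = 0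
  lower : ∀ r f, 0 ≤ f → α • K f ≤ A r f + β • f
  energy : ∀ r q, inner ℝ (A r q) q ≤ M * q.norm₁ ^ 2 - κ * ‖q‖ ^ 2

/-- `Q` solves `-∂_r Q = A*(r) Q` on `[s, a]`. -/
def IsBackwardOn (A : ℝ → TorusL2 d →L[ℝ] TorusL2 d) (Q : ℝ → TorusL2 d) (s a : ℝ) : Prop :=
  HasBoundedDerivOn (fun r => -ContinuousLinearMap.adjoint (A r) (Q r)) Q s a

theorem picardIter_nonneg {b : ℝ → TorusL2 d →L[ℝ] TorusL2 d}
    (hb : ∀ r f, 0 ≤ f → 0 ≤ b r f) {f : TorusL2 d} (hf : 0 ≤ f) (n : ℕ) {r : ℝ} (hr : 0 ≤ r) :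
    0 ≤ picardIter b (fun _ => 0) f n r := by
  induction n generalizing r with
  | zero => exact hf
  | succ n ih =>
    refine add_nonneg hf (TorusL2.integral_nonneg hr fun x hx => ?_)
    rw [add_zero]
    exact hb x _ (ih hx.1.le)

variable {K : TorusL2 d →L[ℝ] TorusL2 d} {α β C M κ c : ℝ} {m : ℕ}

theorem IsMarkovData.mono (hK : IsMarkovData K α β C M κ c m) {x y : TorusL2 d} (hxy : x ≤ y) :
    K x ≤ K y := by
  have := hK.nonneg (y - x) (sub_nonneg.2 hxy)
  rwa [map_sub, sub_nonneg] at this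

/-- Since w' ≥ α K w, feeding the k-th lower bound into the integral equation and integrating the
monomial yields the next one: `w` dominates every term of the series of exp(α r K) f. -/
theorem IsMarkovData.pow_smul_le (hK : IsMarkovData K α β C M κ c m)
    {b : ℝ → TorusL2 d →L[ℝ] TorusL2 d} (hb : ∀ r f, 0 ≤ f → α • K f ≤ b r f)
    {f : TorusL2 d} (hf : 0 ≤ f) {w : ℝ → TorusL2 d} (hw0 : w 0 = f)
    (hw : ∀ T, HasBoundedDerivOn (fun r => b r (w r)) w 0 T) (hpos : ∀ r, 0 ≤ r → 0 ≤ w r)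
    (k : ℕ) {r : ℝ} (hr : 0 ≤ r) : ((α * r) ^ k / k.factorial) • (K ^ k) f ≤ w r := by
  have hα := hK.alpha_pos
  have hbnn : ∀ r f, 0 ≤ f → 0 ≤ b r f := fun r f hf =>
    (smul_nonneg hα.le (hK.nonneg f hf)).trans (hb r f hf)
  induction k generalizing r with
  | zero =>
    have h1 := (hw r).eq_integral r ⟨hr, le_rfl⟩
    rw [h1, hw0]
    simp only [pow_zero, Nat.factorial_zero, Nat.cast_one, div_one, one_smul]
    exact le_add_of_nonneg_right
      (TorusL2.integral_nonneg hr fun x hx => hbnn x _ (hpos x hx.1.le))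
  | succ k ih =>
    have h1 := (hw r).eq_integral r ⟨hr, le_rfl⟩
    have hcont : Continuous fun x : ℝ => α * ((α * x) ^ k / k.factorial) := by fun_prop
    have h2 : ∫ x in (0 : ℝ)..r, (α * ((α * x) ^ k / k.factorial)) • (K ^ (k + 1)) f =
        ((α * r) ^ (k + 1) / (k + 1).factorial) • (K ^ (k + 1)) f := by
      rw [intervalIntegral.integral_smul_const]
      congr 1
      have hd : ∀ x, HasDerivAt (fun x : ℝ => (α * x) ^ (k + 1) / (k + 1).factorial)
          (α * ((α * x) ^ k / k.factorial)) x := by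
        intro x
        refine ((((hasDerivAt_id x).const_mul α).pow (k + 1)).div_const _).congr_deriv ?_
        rw [Nat.factorial_succ]
        push_cast
        simp only [id, mul_one]
        field_simp
      rw [intervalIntegral.integral_eq_sub_of_hasDerivAt (fun x _ => hd x)
        (hcont.intervalIntegrable _ _)]
      simp
    have i2 : IntervalIntegrable (fun x : ℝ => (α * ((α * x) ^ k / k.factorial)) •
        (K ^ (k + 1)) f) volume 0 r :=
      (hcont.smul continuous_const).intervalIntegrable _ _
    rw [h1, hw0, ← h2, ← sub_nonneg, add_sub_assoc, ← intervalIntegral.integral_sub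
      ((hw r).intervalIntegrable ⟨le_rfl, hr⟩ ⟨hr, le_rfl⟩) i2]
    refine add_nonneg hf (TorusL2.integral_nonneg hr fun x hx => sub_nonneg.2 ?_)
    refine le_trans ?_ (hb x _ (hpos x hx.1.le))
    rw [mul_smul, pow_succ', mul_apply_eq_comp, ← map_smul]
    exact smul_le_smul_of_nonneg_left (hK.mono (ih hx.1.le)) hα.le

namespace IsMarkovFamily

variable {A : ℝ → TorusL2 d →L[ℝ] TorusL2 d}

/-- Adding `β` times the identity makes the generator a positive operator, for which all Picard
iterates are nonnegative; the factor exp(-β(t - s)) undoes the shift. -/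
theorem exists_forward (hK : IsMarkovData K α β C M κ c m) (hA : IsMarkovFamily K α β C M κ A)
    (s : ℝ) {f : TorusL2 d} (hf : 0 ≤ f) :
    ∃ v : ℝ → TorusL2 d, v s = f ∧ (∀ t, HasBoundedDerivOn (fun r => A r (v r)) v s t) ∧
      ∀ t, s ≤ t → 0 ≤ v t ∧ ∀ k : ℕ,
        (Real.exp (-β * (t - s)) * ((α * (t - s)) ^ k / k.factorial)) • (K ^ k) f ≤ v t := by
  set b : ℝ → TorusL2 d →L[ℝ] TorusL2 d := fun r => A (s + r) + β • ContinuousLinearMap.id ℝ _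
    with hbdef
  have hα := hK.alpha_pos
  have hβ := hK.beta_nonneg
  have hb : ∀ r f, 0 ≤ f → α • K f ≤ b r f := fun r f hf => hA.lower (s + r) f hf
  have hbnn : ∀ r f, 0 ≤ f → 0 ≤ b r f := fun r f hf =>
    (smul_nonneg hα.le (hK.nonneg f hf)).trans (hb r f hf)
  have hd : IsPicardData b (fun _ => 0) (C + β) 0 := by
    refine ⟨fun x => ?_, by linarith [hK.one_le], fun r => ?_, stronglyMeasurable_const, by simp⟩
    · exact ((hA.meas x).comp_measurable (measurable_const_add s)).add stronglyMeasurable_const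
    · refine (norm_add_le _ _).trans (add_le_add (hA.norm_le _) ?_)
      rw [norm_smul, Real.norm_of_nonneg hβ]
      exact mul_le_of_le_one_right hβ ContinuousLinearMap.norm_id_le
  set w := picardSol b (fun _ => 0) f with hwdef
  have hw0 : w 0 = f := picardSol_zero hd f
  have hw : ∀ T, HasBoundedDerivOn (fun r => b r (w r)) w 0 T := fun T =>
    (hasBoundedDerivOn_picardSol hd f T).congr (fun r _ => by simp [hwdef]) fun r _ => rfl
  have hwpos : ∀ r, 0 ≤ r → 0 ≤ w r := fun r hr =>
    ge_of_tendsto' (tendsto_picardIter hd f hr) fun n => picardIter_nonneg hbnn hf n hr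
  refine ⟨fun r => Real.exp (-β * (r - s)) • w (r - s), by simp [hw0], fun t => ?_,
    fun t ht => ⟨?_, fun k => ?_⟩⟩
  · have h1 := (((hw (t - s)).comp_add_left (-s)).exp_smul (-β)).const_smul (Real.exp (β * s))
    rw [zero_sub, neg_neg, sub_neg_eq_add, sub_add_cancel] at h1
    have he : ∀ r, Real.exp (-β * (r - s)) = Real.exp (β * s) * Real.exp (-β * r) := by
      intro r
      rw [← Real.exp_add]
      ring_nf
    refine h1.congr (fun r _ => ?_) fun r _ => ?_
    · rw [map_smul, he, mul_smul, neg_add_eq_sub]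
      congr 2
      simp [hbdef]
    · rw [he, mul_smul, neg_add_eq_sub]
  · exact smul_nonneg (Real.exp_pos _).le (hwpos _ (sub_nonneg.2 ht))
  · rw [mul_smul]
    exact smul_le_smul_of_nonneg_left (hK.pow_smul_le hb hf hw0 hw hwpos k (sub_nonneg.2 ht))
      (Real.exp_pos _).le

theorem exists_backward (hC : 1 ≤ C) (hA : IsMarkovFamily K α β C M κ A) (a : ℝ) (q : TorusL2 d) :
    ∃ Q : ℝ → TorusL2 d, Q a = q ∧ ∀ s, IsBackwardOn A Q s a := by
  have hd : IsPicardData (fun r => ContinuousLinearMap.adjoint (A (a - r)))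
      (fun _ => (0 : TorusL2 d)) C 0 := by
    refine ⟨fun x => ?_, hC, fun r => ?_, stronglyMeasurable_const, by simp⟩
    · refine stronglyMeasurable_of_inner fun y => ?_
      simp only [ContinuousLinearMap.adjoint_inner_left]
      exact ((continuous_const.inner continuous_id).comp_stronglyMeasurable
        ((hA.meas y).comp_measurable (measurable_const_sub a))).measurable
    · rw [LinearIsometryEquiv.norm_map]
      exact hA.norm_le _
  refine ⟨fun r => picardSol (fun r => ContinuousLinearMap.adjoint (A (a - r)))
      (fun _ => (0 : TorusL2 d)) q (a - r), ?_, fun s => ?_⟩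
  · simp only [sub_self]
    exact picardSol_zero hd q
  have h1 := (hasBoundedDerivOn_picardSol hd q (a - s)).comp_sub_left a
  rw [sub_sub_cancel, sub_zero] at h1
  exact h1.congr (fun r _ => by simp) fun r _ => rfl

end IsMarkovFamily

theorem IsBackwardOn.mono {A : ℝ → TorusL2 d →L[ℝ] TorusL2 d} {Q : ℝ → TorusL2 d} {s a s' a' : ℝ}
    (h : IsBackwardOn A Q s a) (hs : s ≤ s') (ha : a' ≤ a) : IsBackwardOn A Q s' a' :=
  HasBoundedDerivOn.mono h hs ha

theorem IsBackwardOn.sub {A : ℝ → TorusL2 d →L[ℝ] TorusL2 d} {Q Q' : ℝ → TorusL2 d} {s a : ℝ}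
    (h : IsBackwardOn A Q s a) (h' : IsBackwardOn A Q' s a) :
    IsBackwardOn A (fun r => Q r - Q' r) s a :=
  (HasBoundedDerivOn.sub h h').congr (fun r _ => by simp only [map_sub]; abel) fun r _ => rfl

theorem IsBackwardOn.const_smul {A : ℝ → TorusL2 d →L[ℝ] TorusL2 d} {Q : ℝ → TorusL2 d} {s a : ℝ}
    (h : IsBackwardOn A Q s a) (x : ℝ) : IsBackwardOn A (fun r => x • Q r) s a :=
  (HasBoundedDerivOn.const_smul h x).congr (fun r _ => by simp) fun r _ => rfl

/-- Duality between the forward equation with source `g` and the backward equation. -/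
theorem IsBackwardOn.inner_eq {A : ℝ → TorusL2 d →L[ℝ] TorusL2 d} {Q g v : ℝ → TorusL2 d}
    {s t : ℝ} (hst : s ≤ t) (hQ : IsBackwardOn A Q s t)
    (hv : HasBoundedDerivOn (fun r => A r (v r) + g r) v s t) :
    inner ℝ (v t) (Q t) = inner ℝ (v s) (Q s) + ∫ r in s..t, inner ℝ (g r) (Q r) := by
  have h : inner ℝ (v t) (Q t) = inner ℝ (v s) (Q s) + ∫ r in s..t,
      (inner ℝ (A r (v r) + g r) (Q r) +
        inner ℝ (v r) (-ContinuousLinearMap.adjoint (A r) (Q r))) :=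
    (hv.bilinear (innerSL ℝ) hQ).eq_integral t ⟨hst, le_rfl⟩
  rw [h]
  congr 1
  refine intervalIntegral.integral_congr fun r _ => ?_
  simp only [inner_add_left, inner_neg_right, ContinuousLinearMap.adjoint_inner_right]
  ring

theorem IsBackwardOn.inner_eq_of_homogeneous {A : ℝ → TorusL2 d →L[ℝ] TorusL2 d}
    {Q v : ℝ → TorusL2 d} {s t : ℝ} (hst : s ≤ t) (hQ : IsBackwardOn A Q s t)
    (hv : HasBoundedDerivOn (fun r => A r (v r)) v s t) :
    inner ℝ (v t) (Q t) = inner ℝ (v s) (Q s) := by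
  have := hQ.inner_eq (g := fun _ => 0) hst (hv.congr (fun r _ => by simp) fun r _ => rfl)
  simpa using this

end MarkovFamily

/-! ### Exponential decay of the backward evolution -/

section Decay

variable {d : ℕ} {K : TorusL2 d →L[ℝ] TorusL2 d} {α β C M κ c : ℝ} {m : ℕ}
  {A : ℝ → TorusL2 d →L[ℝ] TorusL2 d} {Q : ℝ → TorusL2 d} {s a : ℝ}

namespace IsBackwardOn

/-- By duality ⟨Q(s), f⟩ = ⟨Q(a), v(a)⟩ for the forward solution started from `f ≥ 0`, which stays
nonnegative. -/
theorem nonneg (hK : IsMarkovData K α β C M κ c m) (hA : IsMarkovFamily K α β C M κ A)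
    (hsa : s ≤ a) (hQ : IsBackwardOn A Q s a) (h0 : 0 ≤ Q a) : 0 ≤ Q s := by
  refine TorusL2.nonneg_of_inner fun f hf => ?_
  obtain ⟨v, hv0, hv, hpos⟩ := hA.exists_forward hK s hf
  have := hQ.inner_eq_of_homogeneous hsa (hv a)
  rw [hv0] at this
  rw [real_inner_comm, ← this]
  exact TorusL2.inner_nonneg (hpos a hsa).1 h0

/-- Uniqueness from positivity, applied to `Q` and `-Q`. -/
theorem eq_zero (hK : IsMarkovData K α β C M κ c m) (hA : IsMarkovFamily K α β C M κ A)
    (hsa : s ≤ a) (hQ : IsBackwardOn A Q s a) (h0 : Q a = 0) : Q s = 0 := by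
  refine le_antisymm ?_ (hQ.nonneg hK hA hsa h0.ge)
  have := (hQ.const_smul (-1)).nonneg hK hA hsa (by simp [h0])
  simpa using this

/-- Constants solve the forward equation, so duality conserves the mean of backward solutions. -/
theorem inner_one (hA : IsMarkovFamily K α β C M κ A) (hsa : s ≤ a) (hQ : IsBackwardOn A Q s a) :
    inner ℝ (Q s) (torusConst d 1) = inner ℝ (Q a) (torusConst d 1) := by
  have hv : HasBoundedDerivOn (fun r => A r (torusConst d 1)) (fun _ => torusConst d 1) s a := by
    simp only [hA.map_one]
    exact HasBoundedDerivOn.of_hasDerivAt (fun r => hasDerivAt_const r _) continuous_const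
  have := hQ.inner_eq_of_homogeneous hsa hv
  rw [real_inner_comm, ← this, real_inner_comm]

end IsBackwardOn

/-- Over one unit of time each of the powers of K in Doeblin's condition is present in the solution
with a definite weight. The fraction `δ` depends neither on the family `A` nor on the time. -/
theorem IsMarkovData.exists_minorization (hK : IsMarkovData K α β C M κ c m) :
    ∃ δ : ℝ, 0 < δ ∧ ∀ A, IsMarkovFamily K α β C M κ A → ∀ (s : ℝ) (f : TorusL2 d), 0 ≤ f →
      ∃ v : ℝ → TorusL2 d, v s = f ∧ HasBoundedDerivOn (fun r => A r (v r)) v s (s + 1) ∧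
        (δ * inner ℝ f (torusConst d 1)) • torusConst d 1 ≤ v (s + 1) := by
  have hα := hK.alpha_pos
  set φ : ℕ → ℝ := fun k => Real.exp (-β) * (α ^ k / k.factorial) with hφ
  -- One index more than needed keeps the finite minimum over a nonempty set when `m = 0`.
  set η := (Finset.range (m + 1)).inf' ⟨0, by simp⟩ φ with hη
  have hη0 : 0 < η := (Finset.lt_inf'_iff _).2 fun k _ => by positivity
  have hηle : ∀ k ∈ Finset.range m, η ≤ φ k := fun k hk =>
    Finset.inf'_le _ (Finset.mem_range.2 ((Finset.mem_range.1 hk).trans (Nat.lt_succ_self m)))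
  refine ⟨η * c / (m + 1), by have := hK.c_pos; positivity, fun A hA s f hf => ?_⟩
  obtain ⟨v, hv0, hv, hpos⟩ := hA.exists_forward hK s hf
  refine ⟨v, hv0, hv _, ?_⟩
  obtain ⟨hv1, hvk⟩ := hpos (s + 1) (by linarith)
  simp only [add_sub_cancel_left, mul_one] at hvk
  have hKpow : ∀ k, 0 ≤ (K ^ k) f := by
    intro k
    induction k with
    | zero => exact hf
    | succ k ih =>
      rw [pow_succ', mul_apply_eq_comp]
      exact hK.nonneg _ ih
  have h1 : η • ((c * inner ℝ f (torusConst d 1)) • torusConst d 1) ≤ (m + 1 : ℝ) • v (s + 1) := by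
    calc _ ≤ η • ∑ k ∈ Finset.range m, (K ^ k) f :=
          smul_le_smul_of_nonneg_left (hK.doeblin f hf) hη0.le
      _ = ∑ k ∈ Finset.range m, η • (K ^ k) f := Finset.smul_sum
      _ ≤ ∑ k ∈ Finset.range m, v (s + 1) := Finset.sum_le_sum fun k hk =>
          (smul_le_smul_of_nonneg_right (hηle k hk) (hKpow k)).trans (hvk k)
      _ = (m : ℝ) • v (s + 1) := by simp [Nat.cast_smul_eq_nsmul]
      _ ≤ _ := smul_le_smul_of_nonneg_right (by linarith) hv1
  have hm : (0 : ℝ) < m + 1 := by positivity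
  have h2 := smul_le_smul_of_nonneg_left h1 (inv_nonneg.2 hm.le)
  rw [smul_smul, smul_smul, smul_smul, inv_mul_cancel₀ hm.ne', one_smul] at h2
  rwa [show (m + 1 : ℝ)⁻¹ * η * (c * inner ℝ f (torusConst d 1)) =
    η * c / (m + 1) * inner ℝ f (torusConst d 1) by ring] at h2

namespace IsBackwardOn

theorem exists_posPart_negPart (hK : IsMarkovData K α β C M κ c m)
    (hA : IsMarkovFamily K α β C M κ A) (hsa : s ≤ a) (hQ : IsBackwardOn A Q s a) :
    ∃ Q₁ Q₂ : ℝ → TorusL2 d, IsBackwardOn A Q₁ s a ∧ IsBackwardOn A Q₂ s a ∧ Q₁ a = (Q a)⁺ ∧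
      Q₂ a = (Q a)⁻ ∧ Q s = Q₁ s - Q₂ s := by
  obtain ⟨Q₁, h1, hb1⟩ := hA.exists_backward hK.one_le a (Q a)⁺
  obtain ⟨Q₂, h2, hb2⟩ := hA.exists_backward hK.one_le a (Q a)⁻
  refine ⟨Q₁, Q₂, hb1 s, hb2 s, h1, h2, ?_⟩
  have := (hQ.sub ((hb1 s).sub (hb2 s))).eq_zero hK hA hsa
    (by rw [h1, h2, posPart_sub_negPart, sub_self])
  exact sub_eq_zero.1 this

theorem norm₁_le (hK : IsMarkovData K α β C M κ c m) (hA : IsMarkovFamily K α β C M κ A)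
    (hsa : s ≤ a) (hQ : IsBackwardOn A Q s a) : (Q s).norm₁ ≤ (Q a).norm₁ := by
  obtain ⟨Q₁, Q₂, hb1, hb2, h1, h2, h⟩ := hQ.exists_posPart_negPart hK hA hsa
  rw [h, TorusL2.norm₁_eq_add (Q a), ← h1, ← h2, ← hb1.inner_one hA hsa, ← hb2.inner_one hA hsa]
  exact TorusL2.norm₁_sub_le (hb1.nonneg hK hA hsa (h1 ▸ posPart_nonneg _))
    (hb2.nonneg hK hA hsa (h2 ▸ negPart_nonneg _))

end IsBackwardOn

/-- Doeblin coupling: the solutions issued from the positive and negative parts have equal mass x,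
and at time `s` both lie above the constant δx. This common floor cancels in the difference, leaving
L¹ norm at most 2x - 2δx. -/
theorem IsMarkovData.exists_norm₁_contraction (hK : IsMarkovData K α β C M κ c m) :
    ∃ δ : ℝ, 0 < δ ∧ ∀ A, IsMarkovFamily K α β C M κ A → ∀ (s : ℝ) (Q : ℝ → TorusL2 d),
      IsBackwardOn A Q s (s + 1) → inner ℝ (Q (s + 1)) (torusConst d 1) = (0 : ℝ) →
        (Q s).norm₁ ≤ (1 - δ) * (Q (s + 1)).norm₁ := by
  obtain ⟨δ, hδ, hmin⟩ := hK.exists_minorization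
  refine ⟨δ, hδ, fun A hA s Q hQ h0 => ?_⟩
  have hs : s ≤ s + 1 := by linarith
  -- The forward minorization, dualised by testing against nonnegative functions.
  have key : ∀ Q', IsBackwardOn A Q' s (s + 1) → 0 ≤ Q' (s + 1) →
      (δ * inner ℝ (Q' (s + 1)) (torusConst d 1)) • torusConst d 1 ≤ Q' s := by
    intro Q' hQ' hpos
    rw [← sub_nonneg]
    refine TorusL2.nonneg_of_inner fun f hf => ?_
    obtain ⟨v, hv0, hv, hv1⟩ := hmin A hA s f hf
    have h1 := hQ'.inner_eq_of_homogeneous hs hv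
    rw [hv0] at h1
    have h2 := TorusL2.inner_nonneg hpos (sub_nonneg.2 hv1)
    rw [inner_sub_right, inner_smul_right, real_inner_comm, h1] at h2
    rw [inner_sub_left, real_inner_smul_left, real_inner_comm f (Q' s), real_inner_comm f]
    linarith
  obtain ⟨Q₁, Q₂, hb1, hb2, h1, h2, h⟩ := hQ.exists_posPart_negPart hK hA hs
  have k1 := key Q₁ hb1 (h1 ▸ posPart_nonneg _)
  have k2 := key Q₂ hb2 (h2 ▸ negPart_nonneg _)
  have hsum : (Q (s + 1)).norm₁ = inner ℝ (Q₁ (s + 1)) (torusConst d 1) +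
      inner ℝ (Q₂ (s + 1)) (torusConst d 1) := by
    rw [h1, h2, TorusL2.norm₁_eq_add]
  have heq : inner ℝ (Q₁ (s + 1)) (torusConst d 1) =
      (inner ℝ (Q₂ (s + 1)) (torusConst d 1) : ℝ) := by
    rw [← sub_eq_zero, ← inner_sub_left, h1, h2, posPart_sub_negPart, h0]
  rw [heq] at k1
  have h3 := TorusL2.norm₁_sub_le (sub_nonneg.2 k1) (sub_nonneg.2 k2)
  rw [sub_sub_sub_cancel_right, ← h, inner_sub_left, inner_sub_left, inner_smul_left,
    inner_torusConst_one_self, hb1.inner_one hA hs, hb2.inner_one hA hs] at h3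
  rw [hsum, heq]
  rw [heq] at h3
  refine h3.trans_eq ?_
  simp only [conj_trivial]
  ring

/-- The energy estimate for the backward equation. -/
theorem IsBackwardOn.norm_sq_le (hK : IsMarkovData K α β C M κ c m)
    (hA : IsMarkovFamily K α β C M κ A) (hsa : s ≤ a) (hQ : IsBackwardOn A Q s a) {Y γ : ℝ}
    (hγκ : γ ≤ κ / 2) (hY : ∀ r ∈ Icc s a, (Q r).norm₁ ≤ Y * Real.exp (-γ * (a - r))) :
    ‖Q s‖ ^ 2 ≤ Real.exp (-2 * κ * (a - s)) * ‖Q a‖ ^ 2 +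
      2 * M / κ * Y ^ 2 * Real.exp (-2 * γ * (a - s)) := by
  have hκ := hK.kappa_pos
  have hM := hK.M_nonneg
  -- With this weight the derivative of exp(-2κr)‖Q‖² equals -2 exp(-2κr)(⟨AQ, Q⟩ + κ‖Q‖²), in which
  -- the energy inequality leaves only the L¹ norm.
  have he := HasBoundedDerivOn.exp_smul hQ (-κ)
  have hb := he.bilinear (innerSL ℝ) he
  set G : ℝ → ℝ := fun r => inner ℝ (Real.exp (-κ * r) • (-ContinuousLinearMap.adjoint (A r) (Q r) +
    -κ • Q r)) (Real.exp (-κ * r) • Q r) + inner ℝ (Real.exp (-κ * r) • Q r) (Real.exp (-κ * r) •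
      (-ContinuousLinearMap.adjoint (A r) (Q r) + -κ • Q r)) with hG
  have hb' : HasBoundedDerivOn G
    (fun r => (inner ℝ (Real.exp (-κ * r) • Q r) (Real.exp (-κ * r) • Q r) : ℝ)) s a := hb
  have h1 := hb'.eq_integral a ⟨hsa, le_rfl⟩
  have hnorm : ∀ r, (inner ℝ (Real.exp (-κ * r) • Q r) (Real.exp (-κ * r) • Q r) : ℝ) =
      Real.exp (-2 * κ * r) * ‖Q r‖ ^ 2 := by
    intro r
    rw [real_inner_self_eq_norm_sq, norm_smul, mul_pow, Real.norm_of_nonneg (Real.exp_pos _).le,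
      ← Real.exp_nat_mul]
    congr 2
    push_cast
    ring
  rw [hnorm, hnorm] at h1
  set H : ℝ → ℝ := fun r => 2 * M * Y ^ 2 * Real.exp (-2 * γ * a) *
    Real.exp (-2 * (κ - γ) * r) with hH
  have hHc : Continuous H := by fun_prop
  have hGH : ∀ r ∈ Icc s a, -H r ≤ G r := by
    intro r hr
    have e1 : G r = -(2 * Real.exp (-2 * κ * r) * (inner ℝ (A r (Q r)) (Q r) + κ * ‖Q r‖ ^ 2)) := by
      have : Real.exp (-2 * κ * r) = Real.exp (-κ * r) * Real.exp (-κ * r) := by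
        rw [← Real.exp_add]
        ring_nf
      have hdag : ∀ x y, (inner ℝ (ContinuousLinearMap.adjoint (A r) x) y : ℝ) =
          inner ℝ (A r y) x := fun x y => by
        rw [ContinuousLinearMap.adjoint_inner_left, real_inner_comm]
      have hdag' : ∀ x y, (inner ℝ x (ContinuousLinearMap.adjoint (A r) y) : ℝ) =
          inner ℝ (A r x) y := fun x y => ContinuousLinearMap.adjoint_inner_right _ _ _
      simp only [hG, inner_smul_left, inner_smul_right, inner_add_left, inner_add_right,
        inner_neg_left, inner_neg_right, hdag, hdag',
        real_inner_self_eq_norm_sq, conj_trivial, this]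
      ring
    have e2 := hA.energy r (Q r)
    have e3 : (Q r).norm₁ ^ 2 ≤ Y ^ 2 * Real.exp (-2 * γ * (a - r)) := by
      have := pow_le_pow_left₀ (TorusL2.norm₁_nonneg _) (hY r hr) 2
      rw [mul_pow, ← Real.exp_nat_mul] at this
      rwa [show ((2 : ℕ) : ℝ) * (-γ * (a - r)) = -2 * γ * (a - r) by push_cast; ring] at this
    have e4 : H r = 2 * Real.exp (-2 * κ * r) * (M * (Y ^ 2 * Real.exp (-2 * γ * (a - r)))) := by
      have : Real.exp (-2 * γ * a) * Real.exp (-2 * (κ - γ) * r) =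
          Real.exp (-2 * κ * r) * Real.exp (-2 * γ * (a - r)) := by
        rw [← Real.exp_add, ← Real.exp_add]
        congr 1
        ring
      rw [hH]
      linear_combination (2 * M * Y ^ 2) * this
    rw [e1, e4]
    gcongr
    have := mul_le_mul_of_nonneg_left e3 hM
    linarith
  have hint : ∫ r in s..a, -H r ≤ ∫ r in s..a, G r :=
    intervalIntegral.integral_mono_on hsa (hHc.neg.intervalIntegrable _ _)
      (hb'.intervalIntegrable ⟨le_rfl, hsa⟩ ⟨hsa, le_rfl⟩) hGH
  have hκγ : 0 < κ - γ := by linarith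
  have hHint : ∫ r in s..a, H r ≤ M / (κ - γ) * Y ^ 2 * Real.exp (-2 * γ * a) *
      Real.exp (-2 * (κ - γ) * s) := by
    have hd : ∀ r, HasDerivAt (fun r => -(M / (κ - γ) * Y ^ 2 * Real.exp (-2 * γ * a)) *
        Real.exp (-2 * (κ - γ) * r)) (H r) r := by
      intro r
      refine ((((hasDerivAt_id r).const_mul (-2 * (κ - γ))).exp).const_mul
        (-(M / (κ - γ) * Y ^ 2 * Real.exp (-2 * γ * a)))).congr_deriv ?_
      simp only [id, hH]
      field_simp
    rw [intervalIntegral.integral_eq_sub_of_hasDerivAt (fun x _ => hd x)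
      (hHc.intervalIntegrable _ _)]
    have : 0 ≤ M / (κ - γ) * Y ^ 2 * Real.exp (-2 * γ * a) * Real.exp (-2 * (κ - γ) * a) := by
      positivity
    linarith
  rw [intervalIntegral.integral_neg] at hint
  have h2 : Real.exp (-2 * κ * s) * ‖Q s‖ ^ 2 ≤ Real.exp (-2 * κ * a) * ‖Q a‖ ^ 2 +
      M / (κ - γ) * Y ^ 2 * Real.exp (-2 * γ * a) * Real.exp (-2 * (κ - γ) * s) := by linarith
  have h3 := mul_le_mul_of_nonneg_left h2 (Real.exp_pos (2 * κ * s)).le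
  have i1 : Real.exp (2 * κ * s) * (Real.exp (-2 * κ * s) * ‖Q s‖ ^ 2) = ‖Q s‖ ^ 2 := by
    rw [← mul_assoc, ← Real.exp_add]
    ring_nf
    simp
  have i2 : Real.exp (2 * κ * s) * (Real.exp (-2 * κ * a) * ‖Q a‖ ^ 2 +
      M / (κ - γ) * Y ^ 2 * Real.exp (-2 * γ * a) * Real.exp (-2 * (κ - γ) * s)) =
      Real.exp (-2 * κ * (a - s)) * ‖Q a‖ ^ 2 +
        M / (κ - γ) * Y ^ 2 * Real.exp (-2 * γ * (a - s)) := by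
    have j1 : Real.exp (-2 * κ * (a - s)) = Real.exp (2 * κ * s) * Real.exp (-2 * κ * a) := by
      rw [← Real.exp_add]; ring_nf
    have j2 : Real.exp (-2 * γ * (a - s)) = Real.exp (2 * κ * s) * (Real.exp (-2 * γ * a) *
        Real.exp (-2 * (κ - γ) * s)) := by
      rw [← Real.exp_add, ← Real.exp_add]; ring_nf
    rw [j1, j2]
    ring
  rw [i1, i2] at h3
  -- The assumption γ ≤ κ/2 keeps κ - γ at least κ/2.
  have h4 : M / (κ - γ) ≤ 2 * M / κ := by
    rw [div_le_div_iff₀ hκγ hκ]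
    nlinarith
  refine h3.trans ?_
  gcongr

/-- Uniform `L²` bounds for the backward equation: exponential decay on mean-zero data. -/
theorem IsMarkovData.exists_decay (hK : IsMarkovData K α β C M κ c m) :
    ∃ γ D : ℝ, 0 < γ ∧ 1 ≤ D ∧ ∀ A, IsMarkovFamily K α β C M κ A → ∀ (Q : ℝ → TorusL2 d) (s a : ℝ),
      s ≤ a → IsBackwardOn A Q s a →
        (inner ℝ (Q a) (torusConst d 1) = (0 : ℝ) →
          ‖Q s‖ ≤ D * Real.exp (-γ * (a - s)) * ‖Q a‖) ∧ ‖Q s‖ ≤ D * ‖Q a‖ := by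
  obtain ⟨δ, hδ, hcon⟩ := hK.exists_norm₁_contraction
  have hκ := hK.kappa_pos
  have hM := hK.M_nonneg
  -- The rate must satisfy 1 - δ ≤ exp(-γ) for the L¹ steps and γ ≤ κ/2 for the energy estimate.
  set γ := min δ (κ / 2) with hγdef
  have hγ : 0 < γ := lt_min hδ (by linarith)
  -- The factor exp(2γ) pays, after squaring, for rounding a - s down to whole unit steps.
  set D := Real.sqrt (1 + 2 * M / κ * Real.exp (2 * γ)) with hD
  have hDsq : D ^ 2 = 1 + 2 * M / κ * Real.exp (2 * γ) := Real.sq_sqrt (by positivity)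
  have hD1 : 1 ≤ D := by
    rw [hD, Real.one_le_sqrt]
    have : 0 ≤ 2 * M / κ * Real.exp (2 * γ) := by positivity
    linarith
  refine ⟨γ, D, hγ, hD1, fun A hA Q s a hsa hQ => ⟨fun h0 => ?_, ?_⟩⟩
  · have hstep : ∀ n : ℕ, ∀ r, s ≤ r → r + n ≤ a →
        (Q r).norm₁ ≤ Real.exp (-γ * n) * (Q a).norm₁ := by
      intro n
      induction n with
      | zero =>
        intro r hr hra
        simpa using (hQ.mono hr le_rfl).norm₁_le hK hA (by simpa using hra)
      | succ n ih =>
        intro r hr hra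
        push_cast at hra
        have hn : (0 : ℝ) ≤ n := Nat.cast_nonneg n
        have h1 := ih (r + 1) (by linarith) (by linarith)
        have h2 := hcon A hA r Q (hQ.mono hr (by linarith))
          (by rw [(hQ.mono (s' := r + 1) (by linarith) le_rfl).inner_one hA (by linarith), h0])
        have h3 : 1 - δ ≤ Real.exp (-γ) := by
          have := Real.add_one_le_exp (-γ)
          have := min_le_left δ (κ / 2)
          linarith
        calc (Q r).norm₁ ≤ Real.exp (-γ) * (Q (r + 1)).norm₁ :=
              h2.trans (mul_le_mul_of_nonneg_right h3 (TorusL2.norm₁_nonneg _))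
          _ ≤ Real.exp (-γ) * (Real.exp (-γ * n) * (Q a).norm₁) := by gcongr
          _ = _ := by
            rw [← mul_assoc, ← Real.exp_add]
            push_cast
            ring_nf
    have hY : ∀ r ∈ Icc s a, (Q r).norm₁ ≤ (Real.exp γ * ‖Q a‖) * Real.exp (-γ * (a - r)) := by
      intro r hr
      have hf := Nat.floor_le (sub_nonneg.2 hr.2)
      have hf' := Nat.lt_floor_add_one (a - r)
      refine (hstep ⌊a - r⌋₊ r hr.1 (by linarith)).trans ?_
      calc _ ≤ Real.exp (γ + -γ * (a - r)) * ‖Q a‖ := by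
            refine mul_le_mul (Real.exp_le_exp.2 ?_) (TorusL2.norm₁_le _)
              (TorusL2.norm₁_nonneg _) (Real.exp_pos _).le
            nlinarith
        _ = _ := by rw [Real.exp_add]; ring
    have h1 := hQ.norm_sq_le hK hA hsa (min_le_right _ _) hY
    have h2 : ‖Q s‖ ^ 2 ≤ (D * Real.exp (-γ * (a - s)) * ‖Q a‖) ^ 2 := by
      refine h1.trans ?_
      have e1 : (Real.exp (-γ * (a - s))) ^ 2 = Real.exp (-2 * γ * (a - s)) := by
        rw [← Real.exp_nat_mul]; push_cast; ring_nf
      have e2 : Real.exp γ ^ 2 = Real.exp (2 * γ) := by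
        rw [← Real.exp_nat_mul]; push_cast; rfl
      rw [mul_pow, mul_pow, mul_pow, e1, e2, hDsq]
      have e3 : Real.exp (-2 * κ * (a - s)) ≤ Real.exp (-2 * γ * (a - s)) := by
        apply Real.exp_le_exp.2
        have := min_le_right δ (κ / 2)
        nlinarith [sub_nonneg.2 hsa]
      have := mul_le_mul_of_nonneg_right e3 (sq_nonneg ‖Q a‖)
      linarith
    exact le_of_sq_le_sq h2 (by positivity)
  -- Without the mean-zero condition the L¹ norm is merely nonincreasing, so the energy estimate is
  -- used with rate 0.
  · have h1 := hQ.norm_sq_le hK hA hsa (Y := ‖Q a‖) (γ := 0) (by linarith) fun r hr => by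
      simpa using ((hQ.mono hr.1 le_rfl).norm₁_le hK hA hr.2).trans (TorusL2.norm₁_le _)
    have h2 : ‖Q s‖ ^ 2 ≤ (D * ‖Q a‖) ^ 2 := by
      refine h1.trans ?_
      rw [mul_pow, hDsq]
      have e1 : Real.exp (-2 * κ * (a - s)) ≤ 1 := by
        rw [Real.exp_le_one_iff]
        nlinarith [sub_nonneg.2 hsa]
      have e2 : 1 ≤ Real.exp (2 * γ) := Real.one_le_exp (by linarith)
      have := mul_le_mul_of_nonneg_right e1 (sq_nonneg ‖Q a‖)
      have e3 : 2 * M / κ * ‖Q a‖ ^ 2 ≤ 2 * M / κ * Real.exp (2 * γ) * ‖Q a‖ ^ 2 := by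
        gcongr
        exact le_mul_of_one_le_right (by positivity) e2
      simp only [mul_zero, zero_mul, Real.exp_zero, mul_one]
      linarith
    exact le_of_sq_le_sq h2 (by positivity)

end Decay

/-! ### Convergence to p_∞ and the dual forward estimates -/

section PInfty

variable {d : ℕ} {K : TorusL2 d →L[ℝ] TorusL2 d} {α β C M κ c : ℝ} {m : ℕ}
  {A : ℝ → TorusL2 d →L[ℝ] TorusL2 d}

/-- The chosen solution is known only through its integral equation; the bounded integrand required
by the calculus above comes from continuity on compact intervals. -/
theorem IsMarkovFamily.backwardSolution_spec (hC : 1 ≤ C) (hA : IsMarkovFamily K α β C M κ A)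
    (N : ℝ) : backwardSolution A N N = torusConst d 1 ∧
      ∀ s, IsBackwardOn A (backwardSolution A N) s N := by
  have hex : ∃ p, IsBackwardSolution A N p := by
    obtain ⟨Q, hQN, hQ⟩ := hA.exists_backward hC N (torusConst d 1)
    refine ⟨Q, fun t ht => ?_, fun t ht => ⟨?_, ?_⟩⟩
    · have h1 := (hQ (t - 1)).continuousOn t ⟨by linarith, ht⟩
      refine h1.mono_of_mem_nhdsWithin ?_
      have : Ioi (t - 1) ∈ 𝓝 t := Ioi_mem_nhds (by linarith)
      filter_upwards [mem_nhdsWithin_of_mem_nhds this, self_mem_nhdsWithin] with r hr hr'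
      exact ⟨le_of_lt hr, hr'⟩
    · have := (hQ t).intervalIntegrable ⟨le_rfl, ht⟩ ⟨ht, le_rfl⟩
      simpa only [Pi.neg_def, neg_neg] using this.neg
    · have := (hQ t).sub_eq ⟨le_rfl, ht⟩ ⟨ht, le_rfl⟩
      rw [intervalIntegral.integral_neg, hQN] at this
      rw [← sub_eq_iff_eq_add', ← neg_sub, this, neg_neg]
  have hspec : IsBackwardSolution A N (backwardSolution A N) := by
    rw [backwardSolution, dif_pos hex]
    exact hex.choose_spec
  obtain ⟨hcont, hint⟩ := hspec
  have hN : backwardSolution A N N = torusConst d 1 := by simpa using (hint N le_rfl).2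
  refine ⟨hN, fun s => ?_⟩
  obtain ⟨B, hB⟩ := isCompact_Icc.exists_bound_of_continuousOn
    (hcont.mono (Icc_subset_Iic_self : Icc s N ⊆ Iic N))
  rcases lt_or_ge N s with hsN | hsN
  · refine ⟨?_, ⟨0, fun r hr => ?_⟩, fun r hr => ?_⟩
    · rw [Icc_eq_empty hsN.not_ge, Measure.restrict_empty]
      exact aestronglyMeasurable_zero_measure _
    · exact absurd (hr.1.trans hr.2) hsN.not_ge
    · exact absurd (hr.1.trans hr.2) hsN.not_ge
  refine ⟨?_, ⟨C * B, fun r hr => ?_⟩, fun r hr => ?_⟩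
  · have h1 := (hint s hsN).1.neg.1.1
    rwa [restrict_Ioc_eq_restrict_Icc] at h1
  · rw [norm_neg]
    refine (ContinuousLinearMap.le_of_opNorm_le _ ?_ _).trans
      (mul_le_mul_of_nonneg_left (hB r hr) (by linarith))
    rw [LinearIsometryEquiv.norm_map]
    exact hA.norm_le r
  · have h1 := (hint r hr.2).2
    have h2 := (hint s hsN).2
    have h3 : IntervalIntegrable (fun r => ContinuousLinearMap.adjoint (A r)
        (backwardSolution A N r)) volume s r := by
      refine (hint s hsN).1.mono_set ?_
      rw [uIcc_of_le hr.1, uIcc_of_le hsN]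
      exact Icc_subset_Icc_right hr.2
    rw [h1, h2, intervalIntegral.integral_neg,
      ← intervalIntegral.integral_add_adjacent_intervals h3 (hint r hr.2).1]
    abel

theorem tendsto_exp_neg_mul_sub_atTop {γ : ℝ} (hγ : 0 < γ) (s : ℝ) :
    Tendsto (fun N : ℝ => Real.exp (-γ * (N - s))) atTop (𝓝 0) := by
  refine Real.tendsto_exp_atBot.comp ?_
  exact (tendsto_atTop_add_const_right atTop (-s) tendsto_id).const_mul_atTop_of_neg (by linarith)

/-- For N ≤ N', both p^N and p^{N'} solve the backward equation up to time N and have mean one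
there, so their difference decays like exp(-γ(N - s)) and p^N(s) is Cauchy. Likewise `Q` minus its
mean times p^a is mean-zero at time `a`. -/
theorem IsMarkovData.exists_tendsto_pInfty (hK : IsMarkovData K α β C M κ c m) :
    ∃ γ D : ℝ, 0 < γ ∧ 0 ≤ D ∧ ∀ A, IsMarkovFamily K α β C M κ A →
      (∀ s, Tendsto (fun N => backwardSolution A N s) atTop (𝓝 (pInfty A s))) ∧
      (∀ s, ‖pInfty A s‖ ≤ D) ∧ (∀ s, inner ℝ (pInfty A s) (torusConst d 1) = (1 : ℝ)) ∧
      ∀ (Q : ℝ → TorusL2 d) (s a : ℝ), s ≤ a → IsBackwardOn A Q s a →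
        ‖Q s - (inner ℝ (Q a) (torusConst d 1) : ℝ) • pInfty A s‖ ≤
          D * Real.exp (-γ * (a - s)) * ‖Q a‖ := by
  obtain ⟨γ, D, hγ, hD, hdec⟩ := hK.exists_decay
  -- The first summand bounds p^a - p_∞; the second bounds `Q` minus its mean times p^a, whose datum
  -- has norm at most 2‖Q a‖.
  refine ⟨γ, D * (1 + D) + 2 * D, hγ, by positivity, fun A hA => ?_⟩
  have hsol := fun N => hA.backwardSolution_spec hK.one_le N
  have hbd : ∀ s N, s ≤ N → ‖backwardSolution A N s‖ ≤ D := by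
    intro s N hsN
    have := (hdec A hA _ s N hsN ((hsol N).2 s)).2
    rwa [(hsol N).1, norm_torusConst_one, mul_one] at this
  have hone : ∀ s N, s ≤ N → inner ℝ (backwardSolution A N s) (torusConst d 1) = (1 : ℝ) := by
    intro s N hsN
    rw [((hsol N).2 s).inner_one hA hsN, (hsol N).1, inner_torusConst_one_self]
  have hdiff : ∀ s N N', s ≤ N → N ≤ N' → ‖backwardSolution A N s - backwardSolution A N' s‖ ≤
      D * (1 + D) * Real.exp (-γ * (N - s)) := by
    intro s N N' hsN hNN
    have h1 := ((hsol N).2 s).sub (((hsol N').2 s).mono le_rfl hNN)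
    refine ((hdec A hA _ s N hsN h1).1 ?_).trans ?_
    · rw [inner_sub_left, hone N N le_rfl, hone N N' hNN, sub_self]
    · have : ‖backwardSolution A N N - backwardSolution A N' N‖ ≤ 1 + D := by
        refine (norm_sub_le _ _).trans (add_le_add ?_ (hbd _ _ hNN))
        rw [(hsol N).1, norm_torusConst_one]
      calc _ ≤ D * Real.exp (-γ * (N - s)) * (1 + D) := by gcongr
        _ = _ := by ring
  have htend : ∀ s, Tendsto (fun N => backwardSolution A N s) atTop (𝓝 (pInfty A s)) := by
    intro s
    refine (CauchySeq.tendsto_limUnder ?_)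
    have h0 := (tendsto_exp_neg_mul_sub_atTop hγ s).const_mul (2 * (D * (1 + D)))
    rw [mul_zero] at h0
    rw [Metric.cauchySeq_iff']
    intro ε hε
    obtain ⟨N, hN⟩ := ((h0.eventually_lt_const hε).and (eventually_ge_atTop s)).exists
    refine ⟨N, fun n hn => ?_⟩
    rw [dist_comm, dist_eq_norm]
    have hpos : 0 ≤ D * (1 + D) * Real.exp (-γ * (N - s)) := by positivity
    linarith [hdiff s N n hN.2 hn, hN.1]
  have hone' : ∀ s, inner ℝ (pInfty A s) (torusConst d 1) = (1 : ℝ) := by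
    intro s
    refine tendsto_nhds_unique ((htend s).inner tendsto_const_nhds) ?_
    refine tendsto_const_nhds.congr' ?_
    filter_upwards [eventually_ge_atTop s] with N hN using (hone s N hN).symm
  refine ⟨htend, fun s => ?_, hone', fun Q s a hsa hQ => ?_⟩
  · refine le_of_tendsto (htend s).norm ?_
    filter_upwards [eventually_ge_atTop s] with N hN
    refine (hbd s N hN).trans ?_
    nlinarith
  · have h1 : ‖backwardSolution A a s - pInfty A s‖ ≤
        D * (1 + D) * Real.exp (-γ * (a - s)) := by
      refine le_of_tendsto (tendsto_const_nhds.sub (htend s)).norm ?_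
      filter_upwards [eventually_ge_atTop a] with N hN using hdiff s a N hsa hN
    set x : ℝ := inner ℝ (Q a) (torusConst d 1) with hx
    have hxle : |x| ≤ ‖Q a‖ := by
      have := abs_real_inner_le_norm (Q a) (torusConst d 1)
      rwa [norm_torusConst_one, mul_one] at this
    have h2 := (hdec A hA _ s a hsa (hQ.sub (((hsol a).2 s).const_smul x))).1 (by
      rw [inner_sub_left, inner_smul_left, hone a a le_rfl, ← hx]
      simp)
    have h3 : ‖Q a - x • backwardSolution A a a‖ ≤ 2 * ‖Q a‖ := by
      refine (norm_sub_le _ _).trans ?_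
      rw [norm_smul, (hsol a).1, norm_torusConst_one, Real.norm_eq_abs]
      linarith
    have h4 : Q s - x • pInfty A s = (Q s - x • backwardSolution A a s) +
        x • (backwardSolution A a s - pInfty A s) := by
      rw [smul_sub]
      abel
    rw [h4]
    refine (norm_add_le _ _).trans ?_
    rw [norm_smul, Real.norm_eq_abs]
    calc _ ≤ D * Real.exp (-γ * (a - s)) * (2 * ‖Q a‖) +
          ‖Q a‖ * (D * (1 + D) * Real.exp (-γ * (a - s))) := by
          gcongr
          exact h2.trans (by gcongr)
      _ = _ := by ring

/-- Properties of `p_∞` and of solutions of the forward equation, with uniform constants. -/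
theorem IsMarkovData.exists_forward_bounds (hK : IsMarkovData K α β C M κ c m) :
    ∃ γ D : ℝ, 0 < γ ∧ 0 ≤ D ∧ ∀ A, IsMarkovFamily K α β C M κ A →
      (∀ s, ‖pInfty A s‖ ≤ D) ∧ (∀ s, inner ℝ (pInfty A s) (torusConst d 1) = (1 : ℝ)) ∧
      ∀ (g v : ℝ → TorusL2 d) (s t : ℝ), s ≤ t →
        HasBoundedDerivOn (fun r => A r (v r) + g r) v s t →
        (∀ r ∈ Icc s t, inner ℝ (g r) (pInfty A r) = (0 : ℝ)) →
        (inner ℝ (v t) (pInfty A t) : ℝ) = inner ℝ (v s) (pInfty A s) ∧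
        ∀ R, (∀ r ∈ Icc s t, ‖g r‖ ≤ R) → inner ℝ (v s) (pInfty A s) = (0 : ℝ) →
          ‖v t‖ ≤ D * Real.exp (-γ * (t - s)) * ‖v s‖ + D * R := by
  obtain ⟨γ, D, hγ, hD, hdec⟩ := hK.exists_tendsto_pInfty
  -- The quotient D/γ comes from integrating exp(-γ(t - r)) against the source.
  refine ⟨γ, D + D / γ, hγ, by positivity, fun A hA => ?_⟩
  obtain ⟨htend, hpD, hone, hclose⟩ := hdec A hA
  have hDγ : D ≤ D + D / γ := le_add_of_nonneg_right (by positivity)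
  refine ⟨fun s => (hpD s).trans hDγ, hone, fun g v s t hst hv hg => ?_⟩
  -- Orthogonality to p_∞ lets the multiple of p_∞ be subtracted from `Q` for free, so only the
  -- exponentially small remainder pairs with the source.
  have hgle : ∀ (Q : ℝ → TorusL2 d) (a : ℝ), t ≤ a → IsBackwardOn A Q s a → ∀ r ∈ Icc s t,
      |inner ℝ (g r) (Q r)| ≤ ‖g r‖ * (D * Real.exp (-γ * (a - r)) * ‖Q a‖) := by
    intro Q a hta hQ r hr
    have h1 := hclose Q r a (hr.2.trans hta) (hQ.mono hr.1 le_rfl)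
    have h2 : (inner ℝ (g r) (Q r) : ℝ) =
        inner ℝ (g r) (Q r - (inner ℝ (Q a) (torusConst d 1) : ℝ) • pInfty A r) := by
      rw [inner_sub_right, inner_smul_right, hg r hr, mul_zero, sub_zero]
    rw [h2]
    exact (abs_real_inner_le_norm _ _).trans (by gcongr)
  constructor
  -- A bound on the source alone is recovered from those on the full right-hand side and on `v`.
  · obtain ⟨B, hB⟩ : ∃ B, ∀ r ∈ Icc s t, ‖g r‖ ≤ B := by
      obtain ⟨B₁, hB₁⟩ := hv.bdd
      obtain ⟨B₂, hB₂⟩ := hv.exists_norm_le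
      refine ⟨B₁ + C * B₂, fun r hr => ?_⟩
      have : g r = (A r (v r) + g r) - A r (v r) := by abel
      rw [this]
      refine (norm_sub_le _ _).trans (add_le_add (hB₁ r hr) ?_)
      exact ((A r).le_of_opNorm_le (hA.norm_le r) _).trans
        (mul_le_mul_of_nonneg_left (hB₂ r hr) (by linarith [hK.one_le]))
    have hsol := fun N => hA.backwardSolution_spec hK.one_le N
    have h1 : Tendsto (fun N => inner ℝ (v t) (backwardSolution A N t) -
        (inner ℝ (v s) (backwardSolution A N s) : ℝ)) atTop
        (𝓝 (inner ℝ (v t) (pInfty A t) - inner ℝ (v s) (pInfty A s))) :=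
      (tendsto_const_nhds.inner (htend t)).sub (tendsto_const_nhds.inner (htend s))
    -- Conservation is proved for p^N up to an error ∫⟨g, p^N⟩ that vanishes as N → ∞; an equation
    -- for p_∞ itself is never needed.
    have h2 : Tendsto (fun N => inner ℝ (v t) (backwardSolution A N t) -
        (inner ℝ (v s) (backwardSolution A N s) : ℝ)) atTop (𝓝 0) := by
      have h0 := (tendsto_exp_neg_mul_sub_atTop hγ t).const_mul (B * D * |t - s|)
      rw [mul_zero] at h0
      refine squeeze_zero_norm' ?_ h0
      filter_upwards [eventually_ge_atTop t] with N hN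
      rw [(((hsol N).2 s).mono le_rfl hN).inner_eq hst hv, add_sub_cancel_left]
      refine (intervalIntegral.norm_integral_le_of_norm_le_const
        (C := B * D * Real.exp (-γ * (N - t))) fun r hr => ?_).trans_eq (by ring)
      rw [uIoc_of_le hst] at hr
      have hr' : r ∈ Icc s t := ⟨hr.1.le, hr.2⟩
      refine (hgle _ N hN ((hsol N).2 s) r hr').trans ?_
      rw [(hsol N).1, norm_torusConst_one, mul_one, mul_assoc B]
      have hB0 : 0 ≤ B := (norm_nonneg _).trans (hB r hr')
      have he : Real.exp (-γ * (N - r)) ≤ Real.exp (-γ * (N - t)) :=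
        Real.exp_le_exp.2 (by nlinarith [hr.2])
      gcongr
      exact hB r hr'
    exact sub_eq_zero.1 (tendsto_nhds_unique h1 h2)
  · intro R hR h0
    have hR0 : 0 ≤ R := (norm_nonneg _).trans (hR s ⟨le_rfl, hst⟩)
    -- Taking `v t` itself as terminal datum turns duality into an identity for ‖v(t)‖², from which
    -- one factor ‖v(t)‖ is cancelled.
    obtain ⟨Q, hQt, hQ⟩ := hA.exists_backward hK.one_le t (v t)
    have h1 := (hQ s).inner_eq hst hv
    rw [hQt, real_inner_self_eq_norm_sq] at h1
    have h2 : inner ℝ (v s) (Q s) ≤ D * Real.exp (-γ * (t - s)) * ‖v s‖ * ‖v t‖ := by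
      have e1 := hclose Q s t hst (hQ s)
      rw [hQt] at e1
      have e2 : (inner ℝ (v s) (Q s) : ℝ) =
          inner ℝ (v s) (Q s - (inner ℝ (v t) (torusConst d 1) : ℝ) • pInfty A s) := by
        rw [inner_sub_right, inner_smul_right, h0, mul_zero, sub_zero]
      rw [e2]
      calc _ ≤ ‖v s‖ * (D * Real.exp (-γ * (t - s)) * ‖v t‖) :=
            (real_inner_le_norm _ _).trans (by gcongr)
        _ = _ := by ring
    have hcont : Continuous fun r => R * D * ‖v t‖ * Real.exp (-γ * (t - r)) := by fun_prop
    have h3 : ‖∫ r in s..t, (inner ℝ (g r) (Q r) : ℝ)‖ ≤ R * D * ‖v t‖ / γ := by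
      refine (intervalIntegral.norm_integral_le_of_norm_le hst (Eventually.of_forall fun r hr => ?_)
        (hcont.intervalIntegrable s t)).trans ?_
      · have hr' : r ∈ Icc s t := ⟨hr.1.le, hr.2⟩
        have := hgle Q t le_rfl (hQ s) r hr'
        rw [hQt] at this
        refine this.trans ?_
        calc _ ≤ R * (D * Real.exp (-γ * (t - r)) * ‖v t‖) := by
              gcongr
              exact hR r hr'
          _ = _ := by ring
      · have hd : ∀ r, HasDerivAt (fun r => R * D * ‖v t‖ / γ * Real.exp (-γ * (t - r)))
            (R * D * ‖v t‖ * Real.exp (-γ * (t - r))) r := by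
          intro r
          refine ((((hasDerivAt_id r).const_sub t).const_mul (-γ)).exp.const_mul
            (R * D * ‖v t‖ / γ)).congr_deriv ?_
          simp only [id]
          field_simp
        rw [intervalIntegral.integral_eq_sub_of_hasDerivAt (fun x _ => hd x)
          (hcont.intervalIntegrable _ _)]
        have : 0 ≤ R * D * ‖v t‖ / γ * Real.exp (-γ * (t - s)) := by positivity
        simp only [sub_self, mul_zero, Real.exp_zero, mul_one]
        linarith
    have h4 : ‖v t‖ ^ 2 ≤ (D * Real.exp (-γ * (t - s)) * ‖v s‖ + D / γ * R) * ‖v t‖ := by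
      have := (le_abs_self _).trans h3
      rw [h1]
      calc _ ≤ D * Real.exp (-γ * (t - s)) * ‖v s‖ * ‖v t‖ + R * D * ‖v t‖ / γ :=
            add_le_add h2 this
        _ = _ := by ring
    have h5 : ‖v t‖ ≤ D * Real.exp (-γ * (t - s)) * ‖v s‖ + D / γ * R := by
      rcases (norm_nonneg (v t)).eq_or_lt with h | h
      · rw [← h]
        positivity
      · exact le_of_mul_le_mul_right (by rwa [← sq]) h
    refine h5.trans ?_
    have : D / γ ≤ D + D / γ := le_add_of_nonneg_left hD
    gcongr

end PInfty

/-! ### Jump operators -/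

section Jump

variable {d : ℕ}

theorem toTorus_sub (x y : EuclideanSpace ℝ (Fin d)) :
    toTorus (x - y) = toTorus x - toTorus y := by
  funext i
  simp [toTorus]

theorem toTorus_surjective : Function.Surjective (toTorus (d := d)) := by
  intro ξ
  choose x hx using fun i => QuotientAddGroup.mk_surjective (ξ i)
  exact ⟨WithLp.toLp 2 x, funext hx⟩

/-- Almost everywhere properties pull back along every translate of the covering map. -/
theorem ae_sub_toTorus {q : UnitAddTorus (Fin d) → Prop} (hq : ∀ᵐ x, q x)
    (ξ : UnitAddTorus (Fin d)) : ∀ᵐ z : EuclideanSpace ℝ (Fin d), q (ξ - toTorus z) := by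
  -- One good base point suffices: changing the base point is a translation of z, which preserves
  -- Lebesgue measure.
  obtain ⟨ξ₀, h₀⟩ := (jump_ae hq).exists
  obtain ⟨w, rfl⟩ := toTorus_surjective ξ₀
  obtain ⟨x, rfl⟩ := toTorus_surjective ξ
  have hmp := measurePreserving_add_right (volume : Measure (EuclideanSpace ℝ (Fin d))) (w - x)
  filter_upwards [hmp.quasiMeasurePreserving.ae h₀] with z hz
  rw [← toTorus_sub] at hz ⊢
  convert hz using 2
  abel

variable {a : EuclideanSpace ℝ (Fin d) → ℝ}
  {m m' : UnitAddTorus (Fin d) → UnitAddTorus (Fin d) → ℝ}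

/-- This converts stationarity of the coefficient, which holds only almost everywhere on the torus,
into exact equality of operators. -/
theorem jumpOperator_congr (h : ∀ᵐ q : UnitAddTorus (Fin d) × UnitAddTorus (Fin d),
    m q.1 q.2 = m' q.1 q.2) : jumpOperator a m = jumpOperator a m' := by
  have h1 : ∀ f : UnitAddTorus (Fin d) → ℝ, jumpIntegral a m f =ᵐ[volume] jumpIntegral a m' f := by
    intro f
    rw [Measure.volume_eq_prod] at h
    filter_upwards [Measure.ae_ae_of_ae_prod h] with ξ hξ
    refine integral_congr_ae ?_
    filter_upwards [ae_sub_toTorus hξ ξ] with z hz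
    rw [hz]
  have h2 : IsJumpOperator a m = IsJumpOperator a m' := by
    funext T
    refine propext ⟨fun hT f => (hT f).trans (h1 f), fun hT f => (hT f).trans (h1 f).symm⟩
  unfold jumpOperator
  -- The operator is selected by choice from a predicate, so equal predicates must first be
  -- identified as such.
  generalize IsJumpOperator a m = X at h2 ⊢
  subst h2
  rfl

theorem jumpOperator_spec (ha : IsJumpKernel a)
    (hm : Measurable fun q : UnitAddTorus (Fin d) × UnitAddTorus (Fin d) => m q.1 q.2)
    {C : ℝ} (hC : ∀ x y, |m x y| ≤ C) : IsJumpOperator a m (jumpOperator a m) := by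
  have hex := exists_isJumpOperator ha hm hC
  rw [jumpOperator, dif_pos hex]
  exact hex.choose_spec

theorem norm_jumpOperator_le (ha : IsJumpKernel a)
    (hm : Measurable fun q : UnitAddTorus (Fin d) × UnitAddTorus (Fin d) => m q.1 q.2)
    {C : ℝ} (hC : ∀ x y, |m x y| ≤ C) : ‖jumpOperator a m‖ ≤ 2 * C := by
  have hC0 : 0 ≤ C := (abs_nonneg _).trans (hC 0 0)
  refine ContinuousLinearMap.opNorm_le_bound _ (by positivity) fun f => ?_
  rw [Lp.norm_def, Lp.norm_def, eLpNorm_congr_ae (jumpOperator_spec ha hm hC f)]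
  refine (ENNReal.toReal_mono ?_ (jumpIntegral_bound ha hm hC f).2).trans_eq ?_
  · have := (Lp.memLp f).eLpNorm_ne_top
    finiteness
  · rw [ENNReal.toReal_mul, ENNReal.toReal_mul, ENNReal.toReal_ofReal hC0]
    simp
    ring

theorem jumpOperator_torusConst (ha : IsJumpKernel a)
    (hm : Measurable fun q : UnitAddTorus (Fin d) × UnitAddTorus (Fin d) => m q.1 q.2)
    {C : ℝ} (hC : ∀ x y, |m x y| ≤ C) (x : ℝ) : jumpOperator a m (torusConst d x) = 0 := by
  refine Lp.ext ?_
  filter_upwards [jumpOperator_spec ha hm hC (torusConst d x), torusConst_coeFn (d := d) x,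
    jump_ae (torusConst_coeFn (d := d) x),
    Lp.coeFn_zero ℝ 2 (volume : Measure (UnitAddTorus (Fin d)))] with ξ h1 h2 h3 h4
  rw [h1, h4]
  refine integral_eq_zero_of_ae ?_
  filter_upwards [h3] with z hz
  rw [hz, h2]
  simp

/-- The jump operator depends measurably on the coefficient. -/
theorem stronglyMeasurable_jumpOperator {Θ : Type*} [MeasurableSpace Θ] (ha : IsJumpKernel a)
    {m : Θ → UnitAddTorus (Fin d) → UnitAddTorus (Fin d) → ℝ}
    (hm : Measurable fun q : Θ × (UnitAddTorus (Fin d) × UnitAddTorus (Fin d)) =>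
      m q.1 q.2.1 q.2.2) {C : ℝ} (hC : ∀ θ x y, |m θ x y| ≤ C) (f : TorusL2 d) :
    StronglyMeasurable fun θ => jumpOperator a (m θ) f := by
  refine stronglyMeasurable_of_inner fun h => ?_
  have hmθ : ∀ θ, Measurable fun q : UnitAddTorus (Fin d) × UnitAddTorus (Fin d) =>
      m θ q.1 q.2 := fun θ => hm.comp measurable_prodMk_left
  -- The kernel is measurable only up to null sets; a genuinely measurable version is needed for
  -- joint measurability in the parameter.
  set a' := ha.integrable.aestronglyMeasurable.mk a with ha'
  have haa' : a =ᵐ[volume] a' := ha.integrable.aestronglyMeasurable.ae_eq_mk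
  have ha'm : StronglyMeasurable a' := ha.integrable.aestronglyMeasurable.stronglyMeasurable_mk
  have key : ∀ θ, (inner ℝ (jumpOperator a (m θ) f) h : ℝ) =
      ∫ ξ, (∫ z, (f (ξ - toTorus z) - f ξ) * a' z * m θ ξ (ξ - toTorus z)) * h ξ := by
    intro θ
    rw [TorusL2.inner_eq]
    refine integral_congr_ae ?_
    filter_upwards [jumpOperator_spec ha (hmθ θ) (hC θ) f] with ξ hξ
    rw [hξ]
    congr 1
    refine integral_congr_ae ?_
    filter_upwards [haa'] with z hz
    rw [hz]
  simp only [key]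
  have hf : StronglyMeasurable f := Lp.stronglyMeasurable f
  have hT : Measurable fun q : (Θ × UnitAddTorus (Fin d)) × EuclideanSpace ℝ (Fin d) =>
      q.1.2 - toTorus q.2 :=
    (measurable_snd.comp measurable_fst).sub (measurable_toTorus.comp measurable_snd)
  have h1 : StronglyMeasurable fun q : (Θ × UnitAddTorus (Fin d)) × EuclideanSpace ℝ (Fin d) =>
      (f (q.1.2 - toTorus q.2) - f q.1.2) * a' q.2 * m q.1.1 q.1.2 (q.1.2 - toTorus q.2) := by
    refine (((hf.comp_measurable hT).sub (hf.comp_measurable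
      (measurable_snd.comp measurable_fst))).mul (ha'm.comp_measurable measurable_snd)).mul ?_
    exact (hm.comp ((measurable_fst.comp measurable_fst).prodMk
      ((measurable_snd.comp measurable_fst).prodMk hT))).stronglyMeasurable
  have h2 : StronglyMeasurable fun q : Θ × UnitAddTorus (Fin d) =>
      (∫ z, (f (q.2 - toTorus z) - f q.2) * a' z * m q.1 q.2 (q.2 - toTorus z)) * h q.2 :=
    (StronglyMeasurable.integral_prod_right (f := fun (q : Θ × UnitAddTorus (Fin d))
      (z : EuclideanSpace ℝ (Fin d)) => (f (q.2 - toTorus z) - f q.2) * a' z *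
        m q.1 q.2 (q.2 - toTorus z)) h1).mul
      ((Lp.stronglyMeasurable h).comp_measurable measurable_snd)
  exact (StronglyMeasurable.integral_prod_right (f := fun (θ : Θ) (ξ : UnitAddTorus (Fin d)) =>
    (∫ z, (f (ξ - toTorus z) - f ξ) * a' z * m θ ξ (ξ - toTorus z)) * h ξ) h2).measurable

/-- The convolution operator `f ↦ ∫ f(· - z) a(z) dz` on `L²(𝕋^d)`. -/
noncomputable def jumpAverage (a : EuclideanSpace ℝ (Fin d) → ℝ) : TorusL2 d →L[ℝ] TorusL2 d :=
  jumpOperator a (fun _ _ => 1) + ContinuousLinearMap.id ℝ _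

theorem jumpAverage_ae (ha : IsJumpKernel a) (f : TorusL2 d) :
    ∀ᵐ ξ, Integrable (fun z => f (ξ - toTorus z) * a z) ∧
      jumpAverage a f ξ = ∫ z, f (ξ - toTorus z) * a z := by
  have h1m : Measurable fun _ : UnitAddTorus (Fin d) × UnitAddTorus (Fin d) => (1 : ℝ) :=
    measurable_const
  have h1 : ∀ x y : UnitAddTorus (Fin d), |(fun _ _ => (1 : ℝ)) x y| ≤ 1 := fun _ _ => by simp
  filter_upwards [jumpOperator_spec ha (m := fun _ _ => 1) h1m h1 f,
    jumpIntegrand_integrable ha (m := fun _ _ => 1) h1m h1 f,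
    Lp.coeFn_add (jumpOperator a (fun _ _ => 1) f) f] with ξ e1 e2 e3
  have e4 : Integrable fun z => jumpIntegrand a (fun _ _ => 1) f ξ z + f ξ * a z :=
    e2.add (ha.integrable.const_mul (f ξ))
  have e5 : ∀ z, jumpIntegrand a (fun _ _ => 1) f ξ z + f ξ * a z = f (ξ - toTorus z) * a z := by
    intro z
    rw [jumpIntegrand]
    ring
  refine ⟨by simpa only [e5] using e4, ?_⟩
  have e6 : jumpAverage a f = jumpOperator a (fun _ _ => 1) f + f := rfl
  rw [e6, e3, Pi.add_apply, e1]
  simp only [← e5]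
  rw [integral_add e2 (ha.integrable.const_mul (f ξ)), integral_const_mul, ha.integral_eq_one,
    mul_one]
  rfl

theorem jumpAverage_nonneg (ha : IsJumpKernel a) {f : TorusL2 d} (hf : 0 ≤ f) :
    0 ≤ jumpAverage a f := by
  rw [← Lp.coeFn_nonneg] at hf ⊢
  filter_upwards [jumpAverage_ae ha f, jump_ae hf] with ξ h1 h2
  rw [h1.2]
  refine integral_nonneg_of_ae ?_
  filter_upwards [h2] with z hz using mul_nonneg hz (ha.nonneg z)

variable {α₁ α₂ : ℝ}

/-- The left side of A f + α₂ f splits as ∫ f(ξ - z) a m dz + f(ξ) ∫ (α₂ - m) a dz; the first term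
is at least α₁ K f and the second is nonnegative. -/
theorem smul_jumpAverage_le (ha : IsJumpKernel a)
    (hm : Measurable fun q : UnitAddTorus (Fin d) × UnitAddTorus (Fin d) => m q.1 q.2)
    (hα₁ : 0 < α₁) (hb : ∀ x y, α₁ ≤ m x y ∧ m x y ≤ α₂) {f : TorusL2 d} (hf : 0 ≤ f) :
    α₁ • jumpAverage a f ≤ jumpOperator a m f + α₂ • f := by
  have hC : ∀ x y, |m x y| ≤ α₂ := fun x y => abs_le.2 ⟨by linarith [hb x y], (hb x y).2⟩
  rw [← Lp.coeFn_nonneg] at hf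
  rw [← Lp.coeFn_le]
  filter_upwards [jumpAverage_ae ha f, jump_ae hf, hf, jumpOperator_spec ha hm hC f,
    jumpIntegrand_integrable ha hm hC f, Lp.coeFn_add (jumpOperator a m f) (α₂ • f),
    Lp.coeFn_smul α₂ f, Lp.coeFn_smul α₁ (jumpAverage a f)] with ξ h1 h2 h3 h4 h5 h6 h7 h8
  rw [h8, h6, Pi.add_apply, Pi.smul_apply, h7, Pi.smul_apply, h1.2, h4, smul_eq_mul, smul_eq_mul]
  have e1 : α₂ * f ξ = ∫ z, α₂ * f ξ * a z := by
    rw [integral_const_mul, ha.integral_eq_one, mul_one]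
  have e2 : jumpIntegral a m f ξ = ∫ z, jumpIntegrand a m f ξ z := rfl
  rw [e1, e2, ← integral_add h5 (ha.integrable.const_mul _), ← integral_const_mul]
  refine integral_mono_ae (h1.1.const_mul α₁) (h5.add (ha.integrable.const_mul _)) ?_
  filter_upwards [h2] with z hz
  rw [jumpIntegrand]
  obtain ⟨b1, b2⟩ := hb ξ (ξ - toTorus z)
  have k1 := mul_nonneg (mul_nonneg hz (ha.nonneg z)) (sub_nonneg.2 b1)
  have k2 := mul_nonneg (mul_nonneg h3 (ha.nonneg z)) (sub_nonneg.2 b2)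
  change _ ≤ (f (ξ - toTorus z) - f ξ) * a z * m ξ (ξ - toTorus z) + α₂ * f ξ * a z
  linarith

/-- The gain term is at most its value with coefficient α₂ and absolute values; the loss term is at
least α₁ q², since `a` has integral one. -/
theorem inner_jumpOperator_self_le (ha : IsJumpKernel a)
    (hm : Measurable fun q : UnitAddTorus (Fin d) × UnitAddTorus (Fin d) => m q.1 q.2)
    (hα₁ : 0 < α₁) (hb : ∀ x y, α₁ ≤ m x y ∧ m x y ≤ α₂) (q : TorusL2 d) :
    inner ℝ (jumpOperator a m q) q ≤ α₂ * inner ℝ (jumpAverage a |q|) |q| - α₁ * ‖q‖ ^ 2 := by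
  have hC : ∀ x y, |m x y| ≤ α₂ := fun x y => abs_le.2 ⟨by linarith [hb x y], (hb x y).2⟩
  have hα₂ : 0 < α₂ := hα₁.trans_le ((hb 0 0).1.trans (hb 0 0).2)
  rw [← real_inner_self_eq_norm_sq, TorusL2.inner_eq, TorusL2.inner_eq, TorusL2.inner_eq,
    ← integral_const_mul, ← integral_const_mul,
    ← integral_sub ((TorusL2.integrable_mul _ _).const_mul _)
      ((TorusL2.integrable_mul _ _).const_mul _)]
  refine integral_mono_ae (TorusL2.integrable_mul _ _)
    (((TorusL2.integrable_mul _ _).const_mul _).sub ((TorusL2.integrable_mul _ _).const_mul _)) ?_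
  filter_upwards [jumpAverage_ae ha |q|, jump_ae (Lp.coeFn_abs q), Lp.coeFn_abs q,
    jumpOperator_spec ha hm hC q, jumpIntegrand_integrable ha hm hC q] with ξ h1 h2 h3 h4 h5
  have e2 : jumpIntegral a m q ξ = ∫ z, jumpIntegrand a m q ξ z := rfl
  have e1 : α₁ * (q ξ * q ξ) = ∫ z, α₁ * (q ξ * q ξ) * a z := by
    rw [integral_const_mul, ha.integral_eq_one, mul_one]
  rw [h4, e2, h1.2, e1, mul_comm _ ((|q| : TorusL2 d) ξ), ← mul_assoc, ← integral_const_mul,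
    ← integral_mul_const, ← integral_sub (h1.1.const_mul _) (ha.integrable.const_mul _)]
  refine integral_mono_ae (h5.mul_const _) ((h1.1.const_mul _).sub (ha.integrable.const_mul _)) ?_
  filter_upwards [h2] with z hz
  rw [hz, h3, jumpIntegrand]
  obtain ⟨b1, b2⟩ := hb ξ (ξ - toTorus z)
  set x := q ξ
  set y := q (ξ - toTorus z)
  set μ' := m ξ (ξ - toTorus z)
  have k1 : y * x * μ' ≤ |x| * |y| * α₂ := by
    calc y * x * μ' ≤ |y * x| * μ' := by
          gcongr
          · linarith
          · exact le_abs_self _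
      _ = |x| * |y| * μ' := by rw [abs_mul, mul_comm |y|]
      _ ≤ _ := by gcongr
  have k2 : α₁ * (x * x) ≤ x * x * μ' := by
    rw [mul_comm]
    exact mul_le_mul_of_nonneg_left b1 (mul_self_nonneg x)
  have k4 : (y - x) * a z * μ' * x = (y * x * μ' - x * x * μ') * a z := by ring
  rw [k4]
  refine le_trans (mul_le_mul_of_nonneg_right (sub_le_sub k1 k2) (ha.nonneg z)) (le_of_eq ?_)
  ring

end Jump

/-! ### Convolution powers on the torus -/

section Convolution

variable {d : ℕ}

instance : (volume : Measure (UnitAddTorus (Fin d))).IsNegInvariant :=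
  Measure.IsAddHaarMeasure.isNegInvariant_of_regular volume

/-- The operator `F ↦ ∫ F(· - y) dν(y)` on nonnegative functions. -/
noncomputable def lconv (ν : Measure (UnitAddTorus (Fin d))) (F : UnitAddTorus (Fin d) → ENNReal)
    (ξ : UnitAddTorus (Fin d)) : ENNReal :=
  ∫⁻ y, F (ξ - y) ∂ν

variable {ν : Measure (UnitAddTorus (Fin d))} {F F' : UnitAddTorus (Fin d) → ENNReal}

theorem measurable_lconv [SFinite ν] (hF : Measurable F) : Measurable (lconv ν F) := by
  have : Measurable fun q : UnitAddTorus (Fin d) × UnitAddTorus (Fin d) => F (q.1 - q.2) :=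
    hF.comp (measurable_fst.sub measurable_snd)
  exact this.lintegral_prod_right'

theorem measurable_iterate_lconv [SFinite ν] (hF : Measurable F) (n : ℕ) :
    Measurable ((lconv ν)^[n] F) := by
  induction n with
  | zero => exact hF
  | succ n ih =>
    rw [Function.iterate_succ_apply']
    exact measurable_lconv ih

/-- Some convolution power of `ν` dominates a positive multiple of Lebesgue measure on `U`. -/
def IsMinorizedOn (ν : Measure (UnitAddTorus (Fin d))) (U : Set (UnitAddTorus (Fin d))) : Prop :=
  ∃ (n : ℕ) (c : ENNReal), c ≠ 0 ∧ ∀ F : UnitAddTorus (Fin d) → ENNReal, Measurable F →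
    ∀ ξ, c * ∫⁻ y in U, F (ξ - y) ≤ (lconv ν)^[n] F ξ

theorem setLIntegral_comp_sub (F : UnitAddTorus (Fin d) → ENNReal)
    {V : Set (UnitAddTorus (Fin d))} (hV : MeasurableSet V) (ξ u : UnitAddTorus (Fin d)) :
    ∫⁻ v in V, F (ξ - u - v) = ∫⁻ z, V.indicator 1 (z - u) * F (ξ - z) := by
  rw [← lintegral_indicator hV, ← lintegral_sub_right_eq_self _ u]
  refine lintegral_congr fun z => ?_
  by_cases hz : z - u ∈ V
  · simp [hz]
  · simp [hz]

/-- Minorization sets add up: a neighbourhood version. -/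
theorem IsMinorizedOn.add [SFinite ν] {x y : UnitAddTorus (Fin d)}
    {U V : Set (UnitAddTorus (Fin d))}
    (hxU : U ∈ 𝓝 x) (hyV : V ∈ 𝓝 y) (hU : IsMinorizedOn ν U) (hV : IsMinorizedOn ν V) :
    ∃ W ∈ 𝓝 (x + y), IsMinorizedOn ν W := by
  obtain ⟨n, c, hc, hn⟩ := hU
  obtain ⟨n', c', hc', hn'⟩ := hV
  obtain ⟨V₀, hV₀V, hV₀o, hyV₀⟩ := mem_nhds_iff.1 hyV
  have h1 : Tendsto (fun q : UnitAddTorus (Fin d) × UnitAddTorus (Fin d) => y + (q.1 - q.2))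
      (𝓝 (0, 0)) (𝓝 y) := by
    have : Continuous fun q : UnitAddTorus (Fin d) × UnitAddTorus (Fin d) => y + (q.1 - q.2) := by
      fun_prop
    simpa using this.tendsto (0, 0)
  have h2 : Tendsto (fun w : UnitAddTorus (Fin d) => x + w) (𝓝 0) (𝓝 x) := by
    have : Continuous fun w : UnitAddTorus (Fin d) => x + w := by fun_prop
    simpa using this.tendsto 0
  have h3 := h1 (hV₀o.mem_nhds hyV₀)
  -- A small neighbourhood W of 0 is wanted with y + (W - W) ⊆ V₀ and x + W ⊆ U. For u ∈ x + W and z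
  -- ∈ x + y + W it follows that z - u ∈ V₀, so the convolution of the two indicators is at least
  -- vol(x + W) on x + y + W.
  rw [nhds_prod_eq, Filter.mem_map, mem_prod_same_iff] at h3
  obtain ⟨W₁, hW₁, hW₁V⟩ := h3
  obtain ⟨W, hWsub, hWo, hW0⟩ := mem_nhds_iff.1 (inter_mem hW₁ (h2 hxU))
  set X : Set (UnitAddTorus (Fin d)) := (fun w => -x + w) ⁻¹' W with hX
  set Z : Set (UnitAddTorus (Fin d)) := (fun w => -(x + y) + w) ⁻¹' W with hZ
  have hXo : IsOpen X := hWo.preimage (by fun_prop)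
  have hZo : IsOpen Z := hWo.preimage (by fun_prop)
  have hXU : X ⊆ U := by
    intro u hu
    have := (hWsub hu).2
    simpa using this
  have hXne : X.Nonempty := ⟨x, by simpa [hX] using hW0⟩
  refine ⟨Z, hZo.mem_nhds (by simpa [hZ] using hW0), n + n', c * c' * volume X, ?_, ?_⟩
  · exact mul_ne_zero (mul_ne_zero hc hc') (hXo.measure_pos volume hXne).ne'
  intro F hF ξ
  rw [Function.iterate_add_apply]
  refine le_trans ?_ (hn _ (measurable_iterate_lconv hF n') ξ)
  have hstep : ∀ u ∈ X, c' * ∫⁻ z in Z, F (ξ - z) ≤ (lconv ν)^[n'] F (ξ - u) := by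
    intro u hu
    refine le_trans ?_ (hn' F hF (ξ - u))
    refine mul_le_mul' le_rfl ?_
    refine le_trans ?_ (lintegral_mono_set hV₀V)
    rw [setLIntegral_comp_sub F hV₀o.measurableSet, ← lintegral_indicator hZo.measurableSet]
    refine lintegral_mono fun z => ?_
    by_cases hz : z ∈ Z
    · have : z - u ∈ V₀ := by
        have := hW₁V (mk_mem_prod (hWsub hz).1 (hWsub hu).1)
        simp only [mem_preimage] at this
        convert this using 1
        abel
      simp [hz, this]
    · simp [hz]
  calc _ = c * ∫⁻ _ in X, c' * ∫⁻ z in Z, F (ξ - z) := by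
        rw [setLIntegral_const]
        ring
    _ ≤ c * ∫⁻ u in X, (lconv ν)^[n'] F (ξ - u) := by
        exact mul_le_mul' le_rfl (setLIntegral_mono' hXo.measurableSet hstep)
    _ ≤ _ := mul_le_mul' le_rfl (lintegral_mono_set hXU)

/-- The density exceeds some δ on a set E of positive measure, so ν ∗ ν dominates δ² times 1_E ∗
1_E. The latter is continuous with integral |E|² > 0, hence bounded below near some point. -/
theorem exists_isMinorizedOn [IsProbabilityMeasure ν] (hν : ν ≪ volume) :
    ∃ x, ∃ U ∈ 𝓝 x, IsMinorizedOn ν U := by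
  set g := ν.rnDeriv volume with hg
  have hgm : Measurable g := Measure.measurable_rnDeriv _ _
  have hνg : volume.withDensity g = ν := Measure.withDensity_rnDeriv_eq _ _ hν
  -- a set of positive measure on which the density is bounded below
  obtain ⟨δ, hδ, hE⟩ : ∃ δ : ENNReal, 0 < δ ∧ volume {x | δ ≤ g x} ≠ 0 := by
    by_contra hcon
    push Not at hcon
    have h0 : g =ᵐ[volume] 0 := by
      have h1 : ∀ n : ℕ, ∀ᵐ x, g x < ((n : ENNReal) + 1)⁻¹ := by
        intro n
        have := hcon ((n : ENNReal) + 1)⁻¹ (by simp)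
        rw [ae_iff]
        simpa using this
      filter_upwards [ae_all_iff.2 h1] with x hx
      by_contra hne
      obtain ⟨n, hn⟩ := ENNReal.exists_inv_nat_lt hne
      refine absurd (hx n) (not_lt.2 (le_trans ?_ hn.le))
      exact ENNReal.inv_le_inv.2 (by simp)
    have h2 : ν univ = 0 := by
      rw [← hνg, withDensity_congr_ae h0]
      simp
    simp at h2
  set E := {x | δ ≤ g x} with hEdef
  have hEm : MeasurableSet E := measurableSet_le measurable_const hgm
  have hlow : ∀ H : UnitAddTorus (Fin d) → ENNReal, Measurable H →
      δ * ∫⁻ y in E, H y ≤ ∫⁻ y, H y ∂ν := by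
    intro H hH
    rw [← hνg, lintegral_withDensity_eq_lintegral_mul _ hgm hH, ← lintegral_const_mul _ hH,
      ← lintegral_indicator hEm]
    refine lintegral_mono fun y => ?_
    by_cases hy : y ∈ E
    · simp only [hy, indicator_of_mem, Pi.mul_apply]
      gcongr
      exact hy
    · simp [hy]
  -- the density of the second convolution power
  set h : UnitAddTorus (Fin d) → ENNReal := fun z => ∫⁻ u in E, E.indicator 1 (z - u) with hh
  have hind : Measurable fun q : UnitAddTorus (Fin d) × UnitAddTorus (Fin d) =>
      E.indicator (1 : UnitAddTorus (Fin d) → ENNReal) (q.1 - q.2) :=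
    (measurable_one.indicator hEm).comp (measurable_fst.sub measurable_snd)
  have hconv : ∀ F, Measurable F → ∀ ξ, δ * δ * ∫⁻ z, h z * F (ξ - z) ≤ (lconv ν)^[2] F ξ := by
    intro F hF ξ
    have e1 : (lconv ν)^[2] F ξ = ∫⁻ u, lconv ν F (ξ - u) ∂ν := rfl
    have hm1 : Measurable fun u => lconv ν F (ξ - u) :=
      (measurable_lconv hF).comp (measurable_const_sub ξ)
    rw [e1]
    refine le_trans ?_ (hlow _ hm1)
    rw [mul_assoc]
    gcongr
    have e2 : ∀ u, δ * ∫⁻ z, E.indicator 1 (z - u) * F (ξ - z) ≤ lconv ν F (ξ - u) := by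
      intro u
      rw [← setLIntegral_comp_sub F hEm]
      exact hlow _ (hF.comp (measurable_const_sub _))
    refine le_trans ?_ (lintegral_mono e2)
    have hm2 : Measurable fun q : UnitAddTorus (Fin d) × UnitAddTorus (Fin d) =>
        E.indicator 1 (q.2 - q.1) * F (ξ - q.2) :=
      (hind.comp measurable_swap).mul (hF.comp (measurable_const.sub measurable_snd))
    rw [lintegral_const_mul _ hm2.lintegral_prod_right', lintegral_lintegral_swap hm2.aemeasurable]
    refine mul_le_mul' le_rfl (lintegral_mono fun z => le_of_eq ?_)
    exact (lintegral_mul_const (F (ξ - z)) (hind.comp measurable_prodMk_left)).symm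
  have hcont : Continuous fun z => (h z).toReal := by
    have hE' : MeasurableSet (-E) := hEm.neg
    have hmp : ∀ z : UnitAddTorus (Fin d), MeasurePreserving
        ((ContinuousMap.mk (fun q : UnitAddTorus (Fin d) × UnitAddTorus (Fin d) => q.2 - q.1)
          (by fun_prop)).curry z) volume volume := fun z => measurePreserving_sub_right volume z
    -- Continuity of the convolution: it is the L² pairing of 1_E with a translate of 1_{-E}, and
    -- translations act continuously on L².
    have hc := Continuous.compMeasurePreservingLp (p := 2) (E := ℝ)
      (f := fun _ => indicatorConstLp 2 hE' (measure_ne_top volume _) (1 : ℝ)) continuous_const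
      (ContinuousMap.continuous _) hmp (by simp)
    have hc2 := (continuous_const (y := indicatorConstLp 2 hEm (measure_ne_top volume _)
      (1 : ℝ))).inner (𝕜 := ℝ) hc
    refine hc2.congr fun z => ?_
    rw [L2.inner_indicatorConstLp_one, ← integral_toReal]
    · refine setIntegral_congr_ae hEm ?_
      have e1 := Lp.coeFn_compMeasurePreserving
        (indicatorConstLp 2 hE' (measure_ne_top volume _) (1 : ℝ)) (hmp z)
      have e2 := (hmp z).quasiMeasurePreserving.ae (indicatorConstLp_coeFn (p := 2) (hs := hE')
        (hμs := measure_ne_top (volume : Measure (UnitAddTorus (Fin d))) _) (c := (1 : ℝ)))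
      filter_upwards [e1, e2] with u h1 h2 _
      rw [h1, Function.comp_apply, h2]
      by_cases hu : z - u ∈ E
      · have : u - z ∈ -E := by simpa using hu
        simp [hu, this]
      · have : u - z ∉ -E := by simpa using hu
        simp [hu, this]
    · exact (hind.comp measurable_prodMk_left).aemeasurable
    · refine Eventually.of_forall fun u => ?_
      by_cases hu : z - u ∈ E
      · simp [hu]
      · simp [hu]
  obtain ⟨x, hx⟩ : ∃ x, h x ≠ 0 := by
    by_contra hcon
    push Not at hcon
    have e1 : ∫⁻ z, h z = volume E * volume E := by
      simp only [hh]
      rw [lintegral_lintegral_swap hind.aemeasurable]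
      have : ∀ u, ∫⁻ z, E.indicator (1 : UnitAddTorus (Fin d) → ENNReal) (z - u) = volume E := by
        intro u
        rw [lintegral_sub_right_eq_self
            (fun z => E.indicator (1 : UnitAddTorus (Fin d) → ENNReal) z) u,
          lintegral_indicator_one hEm]
      simp only [this, setLIntegral_const]
    simp only [hcon, lintegral_zero] at e1
    exact mul_ne_zero hE hE e1.symm
  have hhtop : ∀ z, h z ≠ ⊤ := by
    intro z
    refine ne_top_of_le_ne_top (measure_ne_top volume E) ?_
    rw [← setLIntegral_one]
    exact lintegral_mono fun u => indicator_le_self' (by simp) _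
  have hxpos : 0 < (h x).toReal := ENNReal.toReal_pos hx (hhtop x)
  set U := {z | (h x).toReal / 2 < (h z).toReal} with hU
  have hUo : IsOpen U := isOpen_lt continuous_const hcont
  refine ⟨x, U, hUo.mem_nhds (by simp only [hU, mem_ofPred_eq]; linarith), 2,
    δ * δ * ENNReal.ofReal ((h x).toReal / 2), ?_, fun F hF ξ => ?_⟩
  · refine mul_ne_zero (mul_ne_zero hδ.ne' hδ.ne') ?_
    simpa using hxpos
  · refine le_trans ?_ (hconv F hF ξ)
    rw [mul_assoc]
    refine mul_le_mul' le_rfl ?_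
    have hm : Measurable fun y => F (ξ - y) := hF.comp (measurable_const_sub ξ)
    rw [← lintegral_const_mul _ hm, ← lintegral_indicator hUo.measurableSet]
    refine lintegral_mono fun z => ?_
    by_cases hz : z ∈ U
    · simp only [hz, indicator_of_mem]
      gcongr
      exact ENNReal.ofReal_le_of_le_toReal (le_of_lt hz)
    · simp [hz]

/-- The set S of good points is open, nonempty and closed under addition. In a compact group the
submonoid generated by S is dense as soon as the subgroup is, and an open subgroup of the connected
torus is everything. So the submonoid meets the open set x - S, which writes x as a sum of good
points. -/
theorem forall_exists_isMinorizedOn [IsProbabilityMeasure ν] (hν : ν ≪ volume)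
    (x : UnitAddTorus (Fin d)) : ∃ U ∈ 𝓝 x, IsMinorizedOn ν U := by
  set S : Set (UnitAddTorus (Fin d)) := {x | ∃ U ∈ 𝓝 x, IsMinorizedOn ν U} with hS
  have hSo : IsOpen S := by
    rw [isOpen_iff_mem_nhds]
    rintro y ⟨U, hU, hmin⟩
    filter_upwards [eventually_mem_nhds_iff.2 hU] with z hz using ⟨U, hz, hmin⟩
  have hSne : S.Nonempty := exists_isMinorizedOn hν
  have hadd : ∀ y ∈ S, ∀ z ∈ S, y + z ∈ S := by
    rintro y ⟨U, hU, hmin⟩ z ⟨V, hV, hmin'⟩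
    exact hmin.add hU hV hmin'
  have hclosure : ∀ y ∈ AddSubmonoid.closure S, y = 0 ∨ y ∈ S := by
    intro y hy
    induction hy using AddSubmonoid.closure_induction with
    | mem y hy => exact Or.inr hy
    | zero => exact Or.inl rfl
    | add y z _ _ hy hz =>
      rcases hy with rfl | hy
      · simpa using hz
      · rcases hz with rfl | hz
        · exact Or.inr (by simpa using hy)
        · exact Or.inr (hadd y hy z hz)
  have hdense : Dense (AddSubmonoid.closure S : Set (UnitAddTorus (Fin d))) := by
    rw [dense_addSubmonoidClosure_iff_addSubgroupClosure]
    obtain ⟨y, hy⟩ := hSne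
    have ho : IsOpen (AddSubgroup.closure S : Set (UnitAddTorus (Fin d))) :=
      AddSubgroup.isOpen_of_mem_nhds _ (mem_of_superset (hSo.mem_nhds hy)
        AddSubgroup.subset_closure)
    have hcl : IsClosed (AddSubgroup.closure S : Set (UnitAddTorus (Fin d))) :=
      AddSubgroup.isClosed_of_isOpen _ ho
    rw [IsClopen.eq_univ ⟨hcl, ho⟩ ⟨0, zero_mem _⟩]
    exact dense_univ
  obtain ⟨w, hwS, hw⟩ := hdense.exists_mem_open
    (hSo.preimage (f := fun w => x - w) (by fun_prop)) (by
    obtain ⟨y, hy⟩ := hSne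
    exact ⟨x - y, by simpa using hy⟩)
  change x ∈ S
  rcases hclosure w hwS with rfl | hw'
  · simpa using hw
  · simpa using hadd w hw' _ hw

/-- Doeblin's condition for an absolutely continuous probability measure on the torus. -/
theorem exists_doeblin [IsProbabilityMeasure ν] (hν : ν ≪ volume) :
    ∃ (m : ℕ) (c : ENNReal), c ≠ 0 ∧ ∀ F : UnitAddTorus (Fin d) → ENNReal, Measurable F →
      ∀ ξ, c * ∫⁻ y, F y ≤ ∑ k ∈ Finset.range m, (lconv ν)^[k] F ξ := by
  have key : ∃ (m : ℕ) (c : ENNReal), c ≠ 0 ∧ ∀ F : UnitAddTorus (Fin d) → ENNReal, Measurable F →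
      ∀ ξ, c * ∫⁻ y in univ, F (ξ - y) ≤ ∑ k ∈ Finset.range m, (lconv ν)^[k] F ξ := by
    -- The exponent depends on the patch, so on finite unions the powers are summed over a common
    -- range.
    refine isCompact_univ.induction_on (p := fun U : Set (UnitAddTorus (Fin d)) =>
      ∃ (m : ℕ) (c : ENNReal), c ≠ 0 ∧ ∀ F : UnitAddTorus (Fin d) → ENNReal, Measurable F →
        ∀ ξ, c * ∫⁻ y in U, F (ξ - y) ≤ ∑ k ∈ Finset.range m, (lconv ν)^[k] F ξ) ?_ ?_ ?_ ?_
    · exact ⟨0, 1, one_ne_zero, fun F _ ξ => by simp⟩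
    · rintro U V hUV ⟨m, c, hc, h⟩
      exact ⟨m, c, hc, fun F hF ξ => le_trans (by gcongr) (h F hF ξ)⟩
    · rintro U V ⟨m, c, hc, h⟩ ⟨m', c', hc', h'⟩
      refine ⟨max m m', min c c' / 2, ?_, fun F hF ξ => ?_⟩
      · simp [hc, hc']
      set B := ∑ k ∈ Finset.range (max m m'), (lconv ν)^[k] F ξ with hB
      have h1 : min c c' * ∫⁻ y in U, F (ξ - y) ≤ B :=
        le_trans (by gcongr; exact min_le_left _ _) ((h F hF ξ).trans
          (Finset.sum_le_sum_of_subset (Finset.range_mono (le_max_left _ _))))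
      have h2 : min c c' * ∫⁻ y in V, F (ξ - y) ≤ B :=
        le_trans (by gcongr; exact min_le_right _ _) ((h' F hF ξ).trans
          (Finset.sum_le_sum_of_subset (Finset.range_mono (le_max_right _ _))))
      calc _ ≤ min c c' / 2 * ((∫⁻ y in U, F (ξ - y)) + ∫⁻ y in V, F (ξ - y)) :=
            mul_le_mul' le_rfl (lintegral_union_le _ _ _)
        _ = (min c c' * ∫⁻ y in U, F (ξ - y)) / 2 + (min c c' * ∫⁻ y in V, F (ξ - y)) / 2 := by
            simp only [div_eq_mul_inv]
            ring
        _ ≤ B / 2 + B / 2 := by gcongr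
        _ = B := ENNReal.add_halves _
    · intro x _
      obtain ⟨U, hU, n, c, hc, h⟩ := forall_exists_isMinorizedOn hν x
      refine ⟨U, mem_nhdsWithin_of_mem_nhds hU, n + 1, c, hc, fun F hF ξ => (h F hF ξ).trans ?_⟩
      exact Finset.single_le_sum (f := fun k => (lconv ν)^[k] F ξ) (fun _ _ => zero_le)
        (Finset.mem_range.2 (Nat.lt_succ_self n))
  obtain ⟨m, c, hc, h⟩ := key
  refine ⟨m, c, hc, fun F hF ξ => ?_⟩
  have := h F hF ξ
  rwa [Measure.restrict_univ, lintegral_sub_left_eq_self F ξ] at this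

end Convolution

/-! ### The jump law: Doeblin condition and energy inequality -/

section StepMeasure

variable {d : ℕ}

/-- The law on the torus of a jump with density `a`. -/
noncomputable def stepMeasure (a : EuclideanSpace ℝ (Fin d) → ℝ) :
    Measure (UnitAddTorus (Fin d)) :=
  (volume.withDensity fun z => ENNReal.ofReal (a z)).map toTorus

variable {a : EuclideanSpace ℝ (Fin d) → ℝ}

theorem lintegral_stepMeasure (ha : IsJumpKernel a) {F : UnitAddTorus (Fin d) → ENNReal}
    (hF : Measurable F) :
    ∫⁻ y, F y ∂stepMeasure a = ∫⁻ z, F (toTorus z) * ENNReal.ofReal (a z) := by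
  have haA : AEMeasurable (fun z => ENNReal.ofReal (a z)) volume :=
    ha.integrable.aestronglyMeasurable.aemeasurable.ennreal_ofReal
  have hFt : AEMeasurable (fun z => F (toTorus z)) volume :=
    (hF.comp measurable_toTorus).aemeasurable
  rw [stepMeasure, lintegral_map hF measurable_toTorus,
    lintegral_withDensity_eq_lintegral_mul₀ haA hFt]
  simp only [Pi.mul_apply, mul_comm]

theorem isProbabilityMeasure_stepMeasure (ha : IsJumpKernel a) :
    IsProbabilityMeasure (stepMeasure a) := by
  refine ⟨?_⟩
  rw [← lintegral_one, lintegral_stepMeasure ha measurable_const]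
  simp only [one_mul]
  rw [← ofReal_integral_eq_lintegral_ofReal ha.integrable (Eventually.of_forall ha.nonneg),
    ha.integral_eq_one, ENNReal.ofReal_one]

/-- The covering map pulls null sets back to null sets; the reflection z ↦ -z adjusts the sign
convention. -/
theorem stepMeasure_absolutelyContinuous : stepMeasure a ≪ volume := by
  refine Measure.AbsolutelyContinuous.mk fun s hs h0 => ?_
  rw [stepMeasure, Measure.map_apply measurable_toTorus hs]
  refine withDensity_absolutelyContinuous _ _ ?_
  have h1 := ae_sub_toTorus (measure_eq_zero_iff_ae_notMem.1 h0) 0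
  have hmp := Measure.measurePreserving_neg (volume : Measure (EuclideanSpace ℝ (Fin d)))
  rw [measure_eq_zero_iff_ae_notMem]
  filter_upwards [hmp.quasiMeasurePreserving.ae h1] with z hz
  have h2 : (0 : UnitAddTorus (Fin d)) - toTorus (-z) = toTorus z := by
    funext i
    simp [toTorus]
  rwa [h2] at hz

theorem ae_sub_stepMeasure {q : UnitAddTorus (Fin d) → Prop} (hq : ∀ᵐ x, q x)
    (ξ : UnitAddTorus (Fin d)) : ∀ᵐ y ∂stepMeasure a, q (ξ - y) :=
  stepMeasure_absolutelyContinuous.ae_le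
    ((Measure.measurePreserving_sub_left volume ξ).quasiMeasurePreserving.ae hq)

theorem ofReal_jumpAverage (ha : IsJumpKernel a) {f : TorusL2 d} (hf : 0 ≤ f) :
    ∀ᵐ ξ, ENNReal.ofReal (jumpAverage a f ξ) =
      lconv (stepMeasure a) (fun x => ENNReal.ofReal (f x)) ξ := by
  have hfm : Measurable fun x => ENNReal.ofReal (f x) :=
    (Lp.stronglyMeasurable f).measurable.ennreal_ofReal
  rw [← Lp.coeFn_nonneg] at hf
  filter_upwards [jumpAverage_ae ha f, jump_ae hf] with ξ h1 h2
  have h3 : ∀ᵐ z, 0 ≤ f (ξ - toTorus z) * a z := by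
    filter_upwards [h2] with z hz using mul_nonneg hz (ha.nonneg z)
  rw [h1.2, ofReal_integral_eq_lintegral_ofReal h1.1 h3, lconv,
    lintegral_stepMeasure ha (F := fun y => ENNReal.ofReal (f (ξ - y)))
      (hfm.comp (measurable_const_sub ξ))]
  refine lintegral_congr fun z => ?_
  rw [ENNReal.ofReal_mul' (ha.nonneg z)]

theorem jumpAverage_pow_nonneg (ha : IsJumpKernel a) {f : TorusL2 d} (hf : 0 ≤ f) (k : ℕ) :
    0 ≤ (jumpAverage a ^ k) f := by
  induction k with
  | zero => exact hf
  | succ k ih =>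
    rw [pow_succ', mul_apply_eq_comp]
    exact jumpAverage_nonneg ha ih

theorem ofReal_jumpAverage_pow (ha : IsJumpKernel a) {f : TorusL2 d} (hf : 0 ≤ f) (k : ℕ) :
    ∀ᵐ ξ, ENNReal.ofReal ((jumpAverage a ^ k) f ξ) =
      (lconv (stepMeasure a))^[k] (fun x => ENNReal.ofReal (f x)) ξ := by
  induction k with
  | zero => exact Eventually.of_forall fun ξ => rfl
  | succ k ih =>
    rw [pow_succ', mul_apply_eq_comp]
    filter_upwards [ofReal_jumpAverage ha (jumpAverage_pow_nonneg ha hf k)] with ξ hξ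
    rw [hξ, Function.iterate_succ_apply']
    -- Identities valid almost everywhere survive convolution at every point, since the jump law is
    -- absolutely continuous.
    exact lintegral_congr_ae (ae_sub_stepMeasure ih ξ)

theorem TorusL2.ofReal_inner_one {f : TorusL2 d} (hf : 0 ≤ f) :
    ENNReal.ofReal (inner ℝ f (torusConst d 1)) = ∫⁻ ξ, ENNReal.ofReal (f ξ) := by
  rw [inner_torusConst_one, ofReal_integral_eq_lintegral_ofReal _ ((Lp.coeFn_nonneg f).2 hf)]
  have := TorusL2.integrable_mul f (torusConst d 1)
  refine this.congr ?_
  filter_upwards [torusConst_coeFn (d := d) 1] with ξ h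
  rw [h, mul_one]

theorem exists_jumpAverage_doeblin (ha : IsJumpKernel a) :
    ∃ (m : ℕ) (c : ℝ), 0 < c ∧ ∀ f : TorusL2 d, 0 ≤ f →
      (c * inner ℝ f (torusConst d 1)) • torusConst d 1 ≤
        ∑ k ∈ Finset.range m, (jumpAverage a ^ k) f := by
  have := isProbabilityMeasure_stepMeasure ha
  obtain ⟨m, c, hc, h⟩ := exists_doeblin (stepMeasure_absolutelyContinuous (a := a))
  -- The constant could be infinite; truncation at 1 keeps its real value positive.
  refine ⟨m, (min c 1).toReal, ENNReal.toReal_pos (by simp [hc]) (by simp), fun f hf => ?_⟩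
  have hfm : Measurable fun x => ENNReal.ofReal (f x) :=
    (Lp.stronglyMeasurable f).measurable.ennreal_ofReal
  have hsum : (∑ k ∈ Finset.range m, (jumpAverage a ^ k) f : TorusL2 d) =ᵐ[volume]
      fun ξ => ∑ k ∈ Finset.range m, (jumpAverage a ^ k) f ξ := by
    have := Lp.coeFn_finsetSum (Finset.range m) (fun k => (jumpAverage a ^ k) f)
    filter_upwards [this] with ξ hξ
    rw [hξ, Finset.sum_apply]
  rw [← Lp.coeFn_le]
  filter_upwards [hsum, Lp.coeFn_smul ((min c 1).toReal * inner ℝ f (torusConst d 1))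
    (torusConst d 1), torusConst_coeFn (d := d) 1,
    ae_all_iff.2 fun k => ofReal_jumpAverage_pow ha hf k,
    ae_all_iff.2 fun k => (Lp.coeFn_nonneg _).2 (jumpAverage_pow_nonneg ha hf k)]
    with ξ h1 h2 h3 h4 h5
  rw [h1, h2, Pi.smul_apply, h3, smul_eq_mul, mul_one]
  have hnn : 0 ≤ ∑ k ∈ Finset.range m, (jumpAverage a ^ k) f ξ :=
    Finset.sum_nonneg fun k _ => h5 k
  rw [← ENNReal.ofReal_le_ofReal_iff hnn, ENNReal.ofReal_mul ENNReal.toReal_nonneg,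
    TorusL2.ofReal_inner_one hf, ENNReal.ofReal_toReal (by simp),
    ENNReal.ofReal_sum_of_nonneg fun k _ => h5 k]
  simp only [h4]
  exact (mul_le_mul' (min_le_left _ _) le_rfl).trans (h _ hfm ξ)

/-- Where the density of the jump law is at most n, convolution is bounded by n times the L¹ norm.
The rest has small mass for large n, and convolution with it has small norm on L². Integrability of
`a` is thus enough. -/
theorem exists_inner_jumpAverage_le (ha : IsJumpKernel a) {ε : ℝ} (hε : 0 < ε) :
    ∃ M : ℝ, 0 ≤ M ∧ ∀ f : TorusL2 d, 0 ≤ f →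
      inner ℝ (jumpAverage a f) f ≤ M * f.norm₁ ^ 2 + ε * ‖f‖ ^ 2 := by
  have := isProbabilityMeasure_stepMeasure ha
  set ν := stepMeasure a with hν
  set g := ν.rnDeriv volume with hg
  have hgm : Measurable g := Measure.measurable_rnDeriv _ _
  have hνg : volume.withDensity g = ν :=
    Measure.withDensity_rnDeriv_eq _ _ stepMeasure_absolutelyContinuous
  set S : ℕ → Set (UnitAddTorus (Fin d)) := fun n => {x | (n : ENNReal) < g x} with hS
  have hSm : ∀ n, MeasurableSet (S n) := fun n => measurableSet_lt measurable_const hgm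
  have hlim : Tendsto (ν ∘ S) atTop (𝓝 (ν (⋂ n, S n))) := by
    refine tendsto_measure_iInter_atTop (fun n => (hSm n).nullMeasurableSet) ?_
      ⟨0, measure_ne_top _ _⟩
    intro n k hnk x hx
    exact lt_of_le_of_lt (Nat.cast_le.2 hnk) (show (k : ENNReal) < g x from hx)
  have h0 : ν (⋂ n, S n) = 0 := by
    refine stepMeasure_absolutelyContinuous ?_
    rw [measure_eq_zero_iff_ae_notMem]
    filter_upwards [Measure.rnDeriv_lt_top ν volume] with x hx hmem
    obtain ⟨n, hn⟩ := ENNReal.exists_nat_gt hx.ne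
    exact absurd (mem_iInter.1 hmem n) (not_lt.2 hn.le)
  rw [h0] at hlim
  obtain ⟨n, hn⟩ := (hlim.eventually_lt_const
    (ENNReal.ofReal_pos.2 (half_pos hε) : 0 < ENNReal.ofReal (ε / 2))).exists
  have hsplit : ∀ H : UnitAddTorus (Fin d) → ENNReal, Measurable H →
      ∫⁻ y, H y ∂ν ≤ n * (∫⁻ y, H y) + ∫⁻ y in S n, H y ∂ν := by
    intro H hH
    rw [← lintegral_add_compl H (hSm n) (μ := ν), add_comm]
    gcongr
    rw [← hνg, setLIntegral_withDensity_eq_setLIntegral_mul _ hgm hH (hSm n).compl,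
      ← lintegral_const_mul _ hH]
    refine le_trans (setLIntegral_mono' (hSm n).compl fun y hy => ?_)
      (setLIntegral_le_lintegral _ _)
    simp only [Pi.mul_apply]
    gcongr
    simpa [hS] using hy
  refine ⟨n, Nat.cast_nonneg n, fun f hf => ?_⟩
  set F : UnitAddTorus (Fin d) → ENNReal := fun x => ENNReal.ofReal (f x) with hF
  have hFm : Measurable F := (Lp.stronglyMeasurable f).measurable.ennreal_ofReal
  have hf' := (Lp.coeFn_nonneg f).2 hf
  have hnorm : ENNReal.ofReal (‖f‖ ^ 2) = ∫⁻ x, F x ^ 2 := by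
    rw [← real_inner_self_eq_norm_sq, TorusL2.inner_eq,
      ofReal_integral_eq_lintegral_ofReal (TorusL2.integrable_mul f f)]
    · refine lintegral_congr_ae ?_
      filter_upwards [hf'] with x hx
      rw [ENNReal.ofReal_mul hx, sq]
    · filter_upwards with x using mul_self_nonneg _
  have hnorm₁ : ENNReal.ofReal f.norm₁ = ∫⁻ x, F x := by
    rw [TorusL2.norm₁_of_nonneg hf, TorusL2.ofReal_inner_one hf]
  have hlhs : ENNReal.ofReal (inner ℝ (jumpAverage a f) f) = ∫⁻ ξ, lconv ν F ξ * F ξ := by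
    have hK := (Lp.coeFn_nonneg _).2 (jumpAverage_nonneg ha hf)
    rw [TorusL2.inner_eq, ofReal_integral_eq_lintegral_ofReal (TorusL2.integrable_mul _ _)]
    · refine lintegral_congr_ae ?_
      filter_upwards [hf', ofReal_jumpAverage ha hf] with x hx h2
      rw [ENNReal.ofReal_mul' hx, h2]
    · filter_upwards [hf', hK] with x hx hx' using mul_nonneg hx' hx
  have hm2 : Measurable fun q : UnitAddTorus (Fin d) × UnitAddTorus (Fin d) => F (q.1 - q.2) :=
    hFm.comp (measurable_fst.sub measurable_snd)
  have hpart : ∫⁻ ξ, (∫⁻ y in S n, F (ξ - y) ∂ν) * F ξ ≤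
      ENNReal.ofReal ε * ∫⁻ x, F x ^ 2 := by
    have hmq : ∀ ξ, Measurable fun y => F (ξ - y) := fun ξ => hFm.comp (measurable_const_sub ξ)
    calc ∫⁻ ξ, (∫⁻ y in S n, F (ξ - y) ∂ν) * F ξ
        = ∫⁻ ξ, ∫⁻ y in S n, F (ξ - y) * F ξ ∂ν := by
          refine lintegral_congr fun ξ => ?_
          rw [lintegral_mul_const _ (hmq ξ)]
      -- Bounding the product by the sum of squares yields 2ν(S n)‖f‖², which explains the threshold
      -- ε/2.
      _ ≤ ∫⁻ ξ, ∫⁻ y in S n, (F (ξ - y) ^ 2 + F ξ ^ 2) ∂ν := by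
          refine lintegral_mono fun ξ => lintegral_mono fun y => ?_
          rcases le_total (F (ξ - y)) (F ξ) with h | h
          · exact (mul_le_mul' h le_rfl).trans ((sq (F ξ)).symm.le.trans le_add_self)
          · exact (mul_le_mul' le_rfl h).trans ((sq (F (ξ - y))).symm.le.trans le_self_add)
      _ = ∫⁻ y in S n, (∫⁻ ξ, (F (ξ - y) ^ 2 + F ξ ^ 2)) ∂ν := by
          rw [lintegral_lintegral_swap]
          exact ((hm2.pow_const 2).add ((hFm.comp measurable_fst).pow_const 2)).aemeasurable
      _ = ∫⁻ _ in S n, ((∫⁻ x, F x ^ 2) + ∫⁻ x, F x ^ 2) ∂ν := by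
          refine lintegral_congr fun y => ?_
          rw [lintegral_add_right _ (hFm.pow_const 2),
            lintegral_sub_right_eq_self (fun x => F x ^ 2) y]
      _ = (2 * ν (S n)) * ∫⁻ x, F x ^ 2 := by
          rw [setLIntegral_const]
          ring
      _ ≤ _ := by
          gcongr
          calc 2 * ν (S n) ≤ 2 * ENNReal.ofReal (ε / 2) := by
                gcongr
                exact hn.le
            _ = ENNReal.ofReal ε := by
                rw [← ENNReal.ofReal_ofNat 2, ← ENNReal.ofReal_mul (by norm_num)]
                congr 1
                ring
  have hmain : ∫⁻ ξ, lconv ν F ξ * F ξ ≤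
      n * (∫⁻ x, F x) ^ 2 + ENNReal.ofReal ε * ∫⁻ x, F x ^ 2 := by
    have hm3 : Measurable fun ξ => ∫⁻ y in S n, F (ξ - y) ∂ν := hm2.lintegral_prod_right'
    calc _ ≤ ∫⁻ ξ, (n * (∫⁻ x, F x) * F ξ + (∫⁻ y in S n, F (ξ - y) ∂ν) * F ξ) := by
          refine lintegral_mono fun ξ => ?_
          rw [← add_mul]
          gcongr
          have := hsplit (fun y => F (ξ - y)) (hFm.comp (measurable_const_sub ξ))
          rwa [lintegral_sub_left_eq_self (μ := volume) F ξ] at this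
      _ = n * (∫⁻ x, F x) * (∫⁻ x, F x) + ∫⁻ ξ, (∫⁻ y in S n, F (ξ - y) ∂ν) * F ξ := by
          rw [lintegral_add_left (hFm.const_mul _), lintegral_const_mul _ hFm]
      _ ≤ _ := by
          rw [mul_assoc, ← sq]
          gcongr
  have hrhs : 0 ≤ (n : ℝ) * f.norm₁ ^ 2 + ε * ‖f‖ ^ 2 := by positivity
  rw [← ENNReal.ofReal_le_ofReal_iff hrhs, hlhs, ENNReal.ofReal_add (by positivity) (by positivity),
    ENNReal.ofReal_mul (by positivity), ENNReal.ofReal_mul hε.le,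
    ENNReal.ofReal_pow (TorusL2.norm₁_nonneg f), hnorm, hnorm₁, ENNReal.ofReal_natCast]
  exact hmain

/-- The jump operators with coefficients in `[α₁, α₂]` generate Markov evolutions, with uniform
constants. -/
theorem exists_isMarkovFamily_jumpOperator (ha : IsJumpKernel a) {α₁ α₂ : ℝ} (hα₁ : 0 < α₁)
    (hα : α₁ ≤ α₂) :
    ∃ (K : TorusL2 d →L[ℝ] TorusL2 d) (C M κ c : ℝ) (m : ℕ), IsMarkovData K α₁ α₂ C M κ c m ∧
      ∀ μ : ℝ → UnitAddTorus (Fin d) → UnitAddTorus (Fin d) → ℝ,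
        (Measurable fun q : ℝ × (UnitAddTorus (Fin d) × UnitAddTorus (Fin d)) =>
          μ q.1 q.2.1 q.2.2) →
        (∀ t x y, α₁ ≤ μ t x y ∧ μ t x y ≤ α₂) →
        IsMarkovFamily K α₁ α₂ C M κ (fun t => jumpOperator a (μ t)) := by
  have hα₂ : 0 < α₂ := hα₁.trans_le hα
  obtain ⟨m, c, hc, hdoe⟩ := exists_jumpAverage_doeblin ha
  -- With ε = α₁/(2α₂) the gain consumes half of the loss α₁‖q‖², leaving κ = α₁/2.
  obtain ⟨M, hM, hen⟩ := exists_inner_jumpAverage_le ha (ε := α₁ / 2 / α₂) (by positivity)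
  refine ⟨jumpAverage a, max 1 (2 * α₂), α₂ * M, α₁ / 2, c, m,
    ⟨fun f hf => jumpAverage_nonneg ha hf, hdoe, hα₁, hα₂.le, le_max_left _ _, by positivity,
      by positivity, hc⟩, fun μ hμ hb => ?_⟩
  have hC : ∀ t x y, |μ t x y| ≤ α₂ := fun t x y =>
    abs_le.2 ⟨by linarith [hb t x y], (hb t x y).2⟩
  have hm : ∀ t, Measurable fun q : UnitAddTorus (Fin d) × UnitAddTorus (Fin d) => μ t q.1 q.2 :=
    fun t => hμ.comp measurable_prodMk_left
  refine ⟨fun f => stronglyMeasurable_jumpOperator ha hμ hC f,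
    fun t => (norm_jumpOperator_le ha (hm t) (hC t)).trans (le_max_right _ _),
    fun t => jumpOperator_torusConst ha (hm t) (hC t) 1,
    fun t f hf => smul_jumpAverage_le ha (hm t) hα₁ (hb t) hf, fun t q => ?_⟩
  have h1 := inner_jumpOperator_self_le ha (hm t) hα₁ (hb t) q
  have h2 := hen |q| (abs_nonneg q)
  have h3 : TorusL2.norm₁ |q| = q.norm₁ := by
    rw [TorusL2.norm₁, abs_abs, TorusL2.norm₁]
  rw [h3, norm_abs_eq_norm] at h2
  have h4 := mul_le_mul_of_nonneg_left h2 hα₂.le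
  have h5 : α₂ * (M * q.norm₁ ^ 2 + α₁ / 2 / α₂ * ‖q‖ ^ 2) =
      α₂ * M * q.norm₁ ^ 2 + α₁ / 2 * ‖q‖ ^ 2 := by
    field_simp
  linarith

end StepMeasure

/-! ### Bounded solutions on the whole line -/

section WholeLine

variable {d : ℕ}

/-- A bounded measurable family of generators whose evolution preserves the pairing with `p_∞` and
is exponentially stable, in the sense of Duhamel, on the orthogonal complement of `p_∞`. -/
structure IsForwardStable (A : ℝ → TorusL2 d →L[ℝ] TorusL2 d) (C γ D : ℝ) : Prop where
  meas : ∀ x, StronglyMeasurable fun r => A r x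
  one_le : 1 ≤ C
  norm_le : ∀ r, ‖A r‖ ≤ C
  map_one : ∀ r, A r (torusConst d 1) = 0
  rate_pos : 0 < γ
  D_nonneg : 0 ≤ D
  inner_one : ∀ s, inner ℝ (pInfty A s) (torusConst d 1) = (1 : ℝ)
  inner_eq : ∀ (g v : ℝ → TorusL2 d) (s t : ℝ), s ≤ t →
    HasBoundedDerivOn (fun r => A r (v r) + g r) v s t →
    (∀ r ∈ Icc s t, inner ℝ (g r) (pInfty A r) = (0 : ℝ)) →
    (inner ℝ (v t) (pInfty A t) : ℝ) = inner ℝ (v s) (pInfty A s)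
  norm_forward_le : ∀ (g v : ℝ → TorusL2 d) (s t : ℝ), s ≤ t →
    HasBoundedDerivOn (fun r => A r (v r) + g r) v s t →
    (∀ r ∈ Icc s t, inner ℝ (g r) (pInfty A r) = (0 : ℝ)) →
    ∀ R, (∀ r ∈ Icc s t, ‖g r‖ ≤ R) → inner ℝ (v s) (pInfty A s) = (0 : ℝ) →
    ‖v t‖ ≤ D * Real.exp (-γ * (t - s)) * ‖v s‖ + D * R

/-- A measurable source, bounded by `R` and orthogonal to `p_∞`. -/
structure IsOrthogonalSource (A : ℝ → TorusL2 d →L[ℝ] TorusL2 d) (g : ℝ → TorusL2 d)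
    (R : ℝ) : Prop where
  meas : StronglyMeasurable g
  norm_le : ∀ r, ‖g r‖ ≤ R
  inner_eq_zero : ∀ r, inner ℝ (g r) (pInfty A r) = (0 : ℝ)

/-- The solution of `v' = A v + g` for times `s ≥ b` with `v(b) = 0`. -/
noncomputable def solFrom (A : ℝ → TorusL2 d →L[ℝ] TorusL2 d) (g : ℝ → TorusL2 d)
    (b s : ℝ) : TorusL2 d :=
  picardSol (fun r => A (b + r)) (fun r => g (b + r)) 0 (s - b)

/-- The limit of the solutions which vanish at time `-M`, as `M → ∞`. -/
noncomputable def pullbackSol (A : ℝ → TorusL2 d →L[ℝ] TorusL2 d) (g : ℝ → TorusL2 d)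
    (s : ℝ) : TorusL2 d :=
  limUnder atTop fun M : ℕ => solFrom A g (s - M) s

/-- The starting times are relative to the evaluation time, so shift equivariance is an identity
between the approximants, regardless of convergence. Stationarity thus holds for every ω, not just
almost every one. -/
theorem pullbackSol_add (A : ℝ → TorusL2 d →L[ℝ] TorusL2 d) (g : ℝ → TorusL2 d) (t s : ℝ) :
    pullbackSol A g (t + s) = pullbackSol (fun r => A (r + s)) (fun r => g (r + s)) t := by
  have h : ∀ M : ℕ, solFrom A g (t + s - M) (t + s) =
      solFrom (fun r => A (r + s)) (fun r => g (r + s)) (t - M) t := by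
    intro M
    have h1 : ∀ r : ℝ, t + s - M + r = t - M + r + s := fun r => by ring
    simp only [solFrom, h1, sub_sub_cancel]
  simp only [pullbackSol, h]

theorem stronglyMeasurable_pullbackSol {Ω : Type*} [MeasurableSpace Ω]
    {A : Ω → ℝ → TorusL2 d →L[ℝ] TorusL2 d} {g : Ω → ℝ → TorusL2 d}
    (hA : ∀ x, StronglyMeasurable fun q : Ω × ℝ => A q.1 q.2 x)
    (hg : StronglyMeasurable fun q : Ω × ℝ => g q.1 q.2) :
    StronglyMeasurable fun q : Ω × ℝ => pullbackSol (A q.1) (g q.1) q.2 := by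
  have hm : Measurable fun q : (Ω × ℝ) × ℝ => (q.1.1, q.1.2 + q.2) := by fun_prop
  have h := stronglyMeasurable_picardSol (Θ := Ω × ℝ)
    (b := fun θ r => A θ.1 (θ.2 + r)) (h := fun θ r => g θ.1 (θ.2 + r))
    (fun x => (hA x).comp_measurable hm) (hg.comp_measurable hm) 0
  refine StronglyMeasurable.limUnder fun M => ?_
  have hM : Measurable fun q : Ω × ℝ => ((q.1, q.2 - (M : ℝ)), q.2 - (q.2 - M)) := by fun_prop
  exact h.comp_measurable hM

variable {A : ℝ → TorusL2 d →L[ℝ] TorusL2 d} {g : ℝ → TorusL2 d} {C γ D R : ℝ}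

namespace IsForwardStable

theorem isPicardData (hA : IsForwardStable A C γ D) (hg : IsOrthogonalSource A g R) (b : ℝ) :
    IsPicardData (fun r => A (b + r)) (fun r => g (b + r)) C R :=
  ⟨fun x => (hA.meas x).comp_measurable (measurable_const_add b), hA.one_le,
    fun _ => hA.norm_le _, hg.meas.comp_measurable (measurable_const_add b),
    fun _ => hg.norm_le _⟩

theorem solFrom_self (hA : IsForwardStable A C γ D) (hg : IsOrthogonalSource A g R) (b : ℝ) :
    solFrom A g b b = 0 := by
  rw [solFrom, sub_self, picardSol_zero (hA.isPicardData hg b)]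

theorem hasBoundedDerivOn_solFrom (hA : IsForwardStable A C γ D) (hg : IsOrthogonalSource A g R)
    (b t : ℝ) :
    HasBoundedDerivOn (fun r => A r (solFrom A g b r) + g r) (solFrom A g b) b t := by
  have h := (hasBoundedDerivOn_picardSol (hA.isPicardData hg b) 0 (t - b)).comp_add_left (-b)
  rw [zero_sub, neg_neg, sub_neg_eq_add, sub_add_cancel] at h
  refine h.congr (fun r _ => ?_) fun r _ => ?_
  · simp only [solFrom, add_neg_cancel_left, sub_eq_neg_add]
  · simp only [solFrom, sub_eq_neg_add]

theorem inner_solFrom (hA : IsForwardStable A C γ D) (hg : IsOrthogonalSource A g R) {b s : ℝ}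
    (hbs : b ≤ s) : inner ℝ (solFrom A g b s) (pInfty A s) = (0 : ℝ) := by
  rw [hA.inner_eq g _ b s hbs (hA.hasBoundedDerivOn_solFrom hg b s) fun r _ => hg.inner_eq_zero r,
    hA.solFrom_self hg, inner_zero_left]

theorem norm_solFrom_le (hA : IsForwardStable A C γ D) (hg : IsOrthogonalSource A g R) {b s : ℝ}
    (hbs : b ≤ s) : ‖solFrom A g b s‖ ≤ D * R := by
  have h := hA.norm_forward_le g _ b s hbs (hA.hasBoundedDerivOn_solFrom hg b s)
    (fun r _ => hg.inner_eq_zero r) R (fun r _ => hg.norm_le r)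
    (hA.inner_solFrom hg le_rfl)
  simpa [hA.solFrom_self hg] using h

/-- Homogeneous solutions orthogonal to `p_∞` decay. -/
theorem norm_homogeneous_le (hA : IsForwardStable A C γ D) {w : ℝ → TorusL2 d} {s t : ℝ}
    (hst : s ≤ t) (hw : HasBoundedDerivOn (fun r => A r (w r)) w s t)
    (h0 : inner ℝ (w s) (pInfty A s) = (0 : ℝ)) :
    ‖w t‖ ≤ D * Real.exp (-γ * (t - s)) * ‖w s‖ := by
  have h := hA.norm_forward_le (fun _ => 0) w s t hst (by simpa using hw) (by simp) 0 (by simp) h0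
  simpa using h

/-- From time `b` on the difference solves the homogeneous equation, is orthogonal to p_∞, and
starts with norm at most D R; it is forgotten exponentially. -/
theorem norm_solFrom_sub_le (hA : IsForwardStable A C γ D) (hg : IsOrthogonalSource A g R)
    {b' b s : ℝ} (hb : b' ≤ b) (hbs : b ≤ s) :
    ‖solFrom A g b s - solFrom A g b' s‖ ≤ D * Real.exp (-γ * (s - b)) * (D * R) := by
  have h1 := (hA.hasBoundedDerivOn_solFrom hg b s).sub
    ((hA.hasBoundedDerivOn_solFrom hg b' s).mono hb le_rfl)
  have h2 := hA.norm_homogeneous_le hbs (w := fun r => solFrom A g b r - solFrom A g b' r)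
    (h1.congr (fun r _ => by rw [map_sub]; abel) fun r _ => rfl)
    (by rw [inner_sub_left, hA.inner_solFrom hg le_rfl, hA.inner_solFrom hg hb, sub_zero])
  refine h2.trans ?_
  have hD := hA.D_nonneg
  rw [hA.solFrom_self hg, zero_sub, norm_neg]
  gcongr
  exact hA.norm_solFrom_le hg hb

theorem tendsto_solFrom (hA : IsForwardStable A C γ D) (hg : IsOrthogonalSource A g R) (s : ℝ) :
    Tendsto (fun M : ℕ => solFrom A g (s - M) s) atTop (𝓝 (pullbackSol A g s)) := by
  refine CauchySeq.tendsto_limUnder (cauchySeq_of_le_tendsto_0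
    (fun M : ℕ => D * Real.exp (-γ * ((M : ℝ) - 0)) * (D * R) +
      D * Real.exp (-γ * ((M : ℝ) - 0)) * (D * R)) ?_ ?_)
  · intro n k N hn hk
    have h : ∀ j : ℕ, N ≤ j → ‖solFrom A g (s - N) s - solFrom A g (s - j) s‖ ≤
        D * Real.exp (-γ * ((N : ℝ) - 0)) * (D * R) := by
      intro j hj
      have hj' : (N : ℝ) ≤ j := Nat.cast_le.2 hj
      have := hA.norm_solFrom_sub_le hg (b' := s - j) (b := s - N) (s := s) (by linarith)
        (by simp)
      rw [sub_zero]
      rwa [sub_sub_cancel] at this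
    rw [dist_eq_norm]
    refine (norm_sub_le_norm_sub_add_norm_sub _ (solFrom A g (s - N) s) _).trans
      (add_le_add ?_ (h k hk))
    rw [norm_sub_rev]
    exact h n hn
  · have h := ((tendsto_exp_neg_mul_sub_atTop hA.rate_pos 0).comp tendsto_natCast_atTop_atTop)
    have h2 := (h.const_mul D).mul_const (D * R)
    simpa using h2.add h2

theorem norm_solFrom_sub_pullbackSol_le (hA : IsForwardStable A C γ D)
    (hg : IsOrthogonalSource A g R) {b s : ℝ} (hbs : b ≤ s) :
    ‖solFrom A g b s - pullbackSol A g s‖ ≤ D * Real.exp (-γ * (s - b)) * (D * R) := by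
  refine le_of_tendsto ((hA.tendsto_solFrom hg s).const_sub _).norm ?_
  filter_upwards [tendsto_natCast_atTop_atTop.eventually_ge_atTop (s - b)] with M hM
  exact hA.norm_solFrom_sub_le hg (by linarith) hbs

theorem norm_pullbackSol_le (hA : IsForwardStable A C γ D) (hg : IsOrthogonalSource A g R)
    (s : ℝ) : ‖pullbackSol A g s‖ ≤ D * R :=
  le_of_tendsto (hA.tendsto_solFrom hg s).norm
    (Eventually.of_forall fun M => hA.norm_solFrom_le hg (by simp))

/-- The same limit along starting times independent of `s`. Relative starting times give
stationarity, fixed ones give a single solution whose equation passes to the limit. -/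
theorem tendsto_solFrom_atBot (hA : IsForwardStable A C γ D) (hg : IsOrthogonalSource A g R)
    (s : ℝ) : Tendsto (fun N : ℕ => solFrom A g (-N) s) atTop (𝓝 (pullbackSol A g s)) := by
  rw [tendsto_iff_norm_sub_tendsto_zero]
  have h := ((tendsto_exp_neg_mul_sub_atTop hA.rate_pos (-s)).comp tendsto_natCast_atTop_atTop)
  have h2 := (h.const_mul D).mul_const (D * R)
  rw [mul_zero, zero_mul] at h2
  refine squeeze_zero' (Eventually.of_forall fun _ => norm_nonneg _) ?_ h2
  filter_upwards [tendsto_natCast_atTop_atTop.eventually_ge_atTop (-s)] with N hN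
  have h3 := hA.norm_solFrom_sub_pullbackSol_le hg (b := -N) (s := s) (by linarith)
  have h4 : s - -(N : ℝ) = N - -s := by ring
  rwa [h4] at h3

theorem stronglyMeasurable_pullbackSol_right (hA : IsForwardStable A C γ D)
    (hg : IsOrthogonalSource A g R) : StronglyMeasurable (pullbackSol A g) := by
  have h1 : ∀ x, StronglyMeasurable fun q : Unit × ℝ => A q.2 x := fun x =>
    (hA.meas x).comp_measurable measurable_snd
  have h2 : StronglyMeasurable fun q : Unit × ℝ => g q.2 := hg.meas.comp_measurable measurable_snd
  have h3 := stronglyMeasurable_pullbackSol (A := fun _ : Unit => A) (g := fun _ => g) h1 h2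
  have hm : Measurable fun r : ℝ => ((), r) := measurable_prodMk_left
  have h4 := StronglyMeasurable.comp_measurable h3 hm
  exact h4

theorem tendsto_integral_solFrom (hA : IsForwardStable A C γ D)
    (hg : IsOrthogonalSource A g R) {s x : ℝ} (hx : s ≤ x) :
    Tendsto (fun N : ℕ => ∫ r in s..x, (A r (solFrom A g (-N) r) + g r)) atTop
      (𝓝 (∫ r in s..x, (A r (pullbackSol A g r) + g r))) := by
  have hC : 0 ≤ C := zero_le_one.trans hA.one_le
  have hN : ∀ᶠ N : ℕ in atTop, -(N : ℝ) ≤ s := by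
    filter_upwards [tendsto_natCast_atTop_atTop.eventually_ge_atTop (-s)] with N hN
    linarith
  refine intervalIntegral.tendsto_integral_filter_of_dominated_convergence
    (fun _ => C * (D * R) + R) ?_ ?_ intervalIntegrable_const ?_
  · filter_upwards [hN] with N hN
    have := (hA.hasBoundedDerivOn_solFrom hg (-N) x).intervalIntegrable
      (x := s) (y := x) ⟨hN, hx⟩ ⟨hN.trans hx, le_rfl⟩
    exact this.def'.aestronglyMeasurable
  · filter_upwards [hN] with N hN
    refine Eventually.of_forall fun r hr => ?_
    rw [uIoc_of_le hx] at hr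
    refine (norm_add_le _ _).trans (add_le_add
      (((A r).le_of_opNorm_le (hA.norm_le r) _).trans ?_) (hg.norm_le r))
    gcongr
    exact hA.norm_solFrom_le hg (hN.trans hr.1.le)
  · exact Eventually.of_forall fun r _ =>
      (((A r).continuous.tendsto _).comp (hA.tendsto_solFrom_atBot hg r)).add_const _

theorem hasBoundedDerivOn_pullbackSol (hA : IsForwardStable A C γ D)
    (hg : IsOrthogonalSource A g R) (s t : ℝ) :
    HasBoundedDerivOn (fun r => A r (pullbackSol A g r) + g r) (pullbackSol A g) s t := by
  have hC : 0 ≤ C := zero_le_one.trans hA.one_le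
  have hm := hA.stronglyMeasurable_pullbackSol_right hg
  refine ⟨((StronglyMeasurable.apply_clm hA.meas hm).add hg.meas).aestronglyMeasurable,
    ⟨C * (D * R) + R, fun r _ => (norm_add_le _ _).trans (add_le_add
      (((A r).le_of_opNorm_le (hA.norm_le r) _).trans ?_) (hg.norm_le r))⟩, fun x hx => ?_⟩
  · gcongr
    exact hA.norm_pullbackSol_le hg r
  refine tendsto_nhds_unique (hA.tendsto_solFrom_atBot hg x)
    (((hA.tendsto_solFrom_atBot hg s).add (hA.tendsto_integral_solFrom hg hx.1)).congr' ?_)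
  filter_upwards [tendsto_natCast_atTop_atTop.eventually_ge_atTop (-s)] with N hN
  have hN' : -(N : ℝ) ≤ s := by linarith
  rw [← (hA.hasBoundedDerivOn_solFrom hg (-N) x).sub_eq (x := s) (y := x) ⟨hN', hx.1⟩
    ⟨hN'.trans hx.1, le_rfl⟩]
  abel

/-- The equation is integrated, so the source may be altered on a null set of times; this permits
truncating it. -/
theorem isEvolutionSolution_pullbackSol (hA : IsForwardStable A C γ D)
    (hg : IsOrthogonalSource A g R) {g' : ℝ → TorusL2 d} (hgg' : g' =ᵐ[volume] g) :
    MemLp (pullbackSol A g) ⊤ volume ∧ IsEvolutionSolution A g' (pullbackSol A g) := by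
  have hd := hA.hasBoundedDerivOn_pullbackSol hg
  have hc : Continuous (pullbackSol A g) := by
    refine continuous_iff_continuousAt.2 fun x => ?_
    exact (hd (x - 1) (x + 1)).continuousOn.continuousAt
      (Icc_mem_nhds (by linarith) (by linarith))
  have hF : (fun r => A r (pullbackSol A g r) + g r) =ᵐ[volume]
      fun r => A r (pullbackSol A g r) + g' r := by
    filter_upwards [hgg'] with r hr
    rw [hr]
  refine ⟨memLp_top_of_bound hc.aestronglyMeasurable (D * R)
    (Eventually.of_forall (hA.norm_pullbackSol_le hg)), hc, fun s t => ⟨?_, ?_⟩⟩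
  · exact ((hd (min s t) (max s t)).intervalIntegrable ⟨min_le_left _ _, le_max_left _ _⟩
      ⟨min_le_right _ _, le_max_right _ _⟩).congr_ae (ae_restrict_of_ae hF)
  · rw [(hd (min s t) (max s t)).sub_eq ⟨min_le_left _ _, le_max_left _ _⟩
      ⟨min_le_right _ _, le_max_right _ _⟩]
    exact intervalIntegral.integral_congr_ae (hF.mono fun r hr _ => hr)

theorem hasBoundedDerivOn_sub_of_isEvolutionSolution (hA : IsForwardStable A C γ D)
    {u v : ℝ → TorusL2 d} (hu : IsEvolutionSolution A g u) (hv : IsEvolutionSolution A g v)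
    (s t : ℝ) :
    HasBoundedDerivOn (fun r => A r (u r - v r)) (fun r => u r - v r) s t := by
  have hc : Continuous fun r => u r - v r := hu.1.sub hv.1
  obtain ⟨B, hB⟩ := (isCompact_Icc (a := s) (b := t)).exists_bound_of_continuousOn hc.continuousOn
  have hC : 0 ≤ C := zero_le_one.trans hA.one_le
  refine ⟨(StronglyMeasurable.apply_clm hA.meas hc.stronglyMeasurable).aestronglyMeasurable,
    ⟨C * B, fun r hr => ((A r).le_of_opNorm_le (hA.norm_le r) _).trans ?_⟩, fun r _ => ?_⟩
  · gcongr
    exact hB r hr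
  · have h1 := (hu.2 s r).2
    have h2 := (hv.2 s r).2
    have h3 : ∫ x in s..r, A x (u x - v x) = (u r - u s) - (v r - v s) := by
      rw [h1, h2, ← intervalIntegral.integral_sub (hu.2 s r).1 (hv.2 s r).1]
      congr 1
      funext x
      rw [map_sub]
      abel
    rw [h3]
    abel

/-- The difference of two solutions has a constant pairing with `p_∞`, and converges to this
constant. -/
theorem sub_of_isEvolutionSolution (hA : IsForwardStable A C γ D)
    {u v : ℝ → TorusL2 d} (hu : IsEvolutionSolution A g u) (hv : IsEvolutionSolution A g v)
    {s t : ℝ} (hst : s ≤ t) :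
    (inner ℝ (u t - v t) (pInfty A t) : ℝ) = inner ℝ (u s - v s) (pInfty A s) ∧
      ‖u t - v t - torusConst d (inner ℝ (u t - v t) (pInfty A t))‖ ≤
        D * Real.exp (-γ * (t - s)) *
          ‖u s - v s - torusConst d (inner ℝ (u s - v s) (pInfty A s))‖ := by
  have hw := hA.hasBoundedDerivOn_sub_of_isEvolutionSolution hu hv s t
  have h1 := hA.inner_eq (fun _ => 0) (fun r => u r - v r) s t hst
    (by simpa only [add_zero] using hw) (by simp)
  refine ⟨h1, ?_⟩
  rw [h1]
  set φ : ℝ := inner ℝ (u s - v s) (pInfty A s)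
  have hconst : HasBoundedDerivOn (fun _ => (0 : TorusL2 d)) (fun _ => torusConst d φ) s t :=
    ⟨aestronglyMeasurable_const, ⟨0, by simp⟩, by simp⟩
  -- Constants solve the homogeneous equation, and as p_∞ has mean one, subtracting the constant `φ`
  -- makes the difference orthogonal to p_∞.
  refine hA.norm_homogeneous_le hst (w := fun r => u r - v r - torusConst d φ)
    ((hw.sub hconst).congr (fun r _ => ?_) fun r _ => rfl) ?_
  · rw [map_sub (A r), torusConst_eq_smul, map_smul, hA.map_one, smul_zero]
  · rw [inner_sub_left, torusConst_eq_smul, inner_smul_left,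
      real_inner_comm (pInfty A s) (torusConst d 1), hA.inner_one]
    simp [φ]

end IsForwardStable

end WholeLine

/-! ### Stationary processes over an ergodic flow -/

section Stationary

variable {Ω : Type*} [MeasurableSpace Ω] {P : Measure Ω} {τ : ℝ → Ω → Ω}

theorem IsStationaryProcess.comp_measurable_right {E F : Type*} [TopologicalSpace E]
    [TopologicalSpace F] {X : Ω → ℝ → E} (hX : IsStationaryProcess τ X) {f : E → F}
    (hf : StronglyMeasurable fun q : Ω × ℝ => f (X q.1 q.2)) :
    IsStationaryProcess τ fun ω s => f (X ω s) :=
  ⟨hf, fun t s ω => congrArg f (hX.2 t s ω)⟩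

theorem IsStationaryProcess.stronglyMeasurable_time {E : Type*} [TopologicalSpace E]
    {X : Ω → ℝ → E} (hX : IsStationaryProcess τ X) (s : ℝ) : StronglyMeasurable fun ω => X ω s := by
  have hm : Measurable fun ω : Ω => (ω, s) := measurable_prodMk_right
  exact StronglyMeasurable.comp_measurable hX.1 hm

theorem IsStationaryProcess.stronglyMeasurable_path {E : Type*} [TopologicalSpace E]
    {X : Ω → ℝ → E} (hX : IsStationaryProcess τ X) (ω : Ω) : StronglyMeasurable (X ω) := by
  have hm : Measurable fun s : ℝ => (ω, s) := measurable_prodMk_left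
  have h := StronglyMeasurable.comp_measurable hX.1 hm
  exact h

/-- A stationary process stays in a given measurable set for almost all times either almost surely
or almost never. -/
theorem IsErgodicFlow.ae_mem_zero_or_one (hτ : IsErgodicFlow P τ) {X : Ω → ℝ → ℝ}
    (hX : IsStationaryProcess τ X) {U : Set ℝ} (hU : MeasurableSet U) :
    MeasurableSet {ω | ∀ᵐ s, X ω s ∈ U} ∧
      (P {ω | ∀ᵐ s, X ω s ∈ U} = 0 ∨ P {ω | ∀ᵐ s, X ω s ∈ U} = 1) := by
  have hm : MeasurableSet {ω | ∀ᵐ s, X ω s ∈ U} := by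
    have h1 : MeasurableSet {q : Ω × ℝ | X q.1 q.2 ∈ Uᶜ} := hX.1.measurable hU.compl
    exact measurable_measure_prodMk_left (ν := (volume : Measure ℝ)) h1
      (measurableSet_singleton 0)
  -- Ergodicity asks for exact invariance. An event about almost all times is exactly invariant,
  -- since the flow only translates the time axis.
  refine ⟨hm, hτ.ergodic _ hm fun a => ?_⟩
  ext ω
  have h1 : ∀ s, X (τ a ω) s = X ω (s + a) := fun s => (hX.2 s a ω).symm
  simp only [mem_preimage, mem_ofPred_eq, h1]
  constructor
  · intro h
    have h2 := (measurePreserving_sub_right (volume : Measure ℝ) a).quasiMeasurePreserving.ae h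
    simpa using h2
  · intro h
    exact (measurePreserving_add_right (volume : Measure ℝ) a).quasiMeasurePreserving.ae h

/-- The event X(0) ∈ U is invariant only almost surely, but it agrees almost surely with the exactly
invariant event that X(s) ∈ U for almost all s. The zero-one law for all measurable U forces a
constant. -/
theorem IsErgodicFlow.exists_const [IsProbabilityMeasure P] (hτ : IsErgodicFlow P τ)
    {X : Ω → ℝ → ℝ} (hX : IsStationaryProcess τ X) (hc : ∀ᵐ ω ∂P, ∀ s, X ω s = X ω 0) :
    ∃ c, ∀ᵐ ω ∂P, X ω 0 = c := by
  refine exists_eventuallyEq_const_of_forall_separating (l := ae P) (f := fun ω => X ω 0)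
    MeasurableSet fun U hU => ?_
  obtain ⟨hm, h⟩ := hτ.ae_mem_zero_or_one hX hU
  have hiff : ∀ᵐ ω ∂P, (∀ᵐ s, X ω s ∈ U) ↔ X ω 0 ∈ U := by
    filter_upwards [hc] with ω hω
    simp [hω]
  rcases h with h | h
  · right
    filter_upwards [hiff, measure_eq_zero_iff_ae_notMem.1 h] with ω h1 h2 h3
    exact h2 (h1.2 h3)
  · left
    filter_upwards [hiff, (prob_compl_eq_zero_iff hm).2 h] with ω h1 h2
    exact h1.1 h2

/-- An almost surely bounded stationary process is bounded by a deterministic constant. -/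
theorem IsErgodicFlow.exists_ae_norm_le [IsProbabilityMeasure P] (hτ : IsErgodicFlow P τ)
    {E : Type*} [NormedAddCommGroup E] {g : Ω → ℝ → E} (hg : IsStationaryProcess τ g)
    (hb : ∀ᵐ ω ∂P, MemLp (g ω) ⊤ volume) :
    ∃ R : ℝ, 0 ≤ R ∧ ∀ᵐ ω ∂P, ∀ᵐ s, ‖g ω s‖ ≤ R := by
  have hX : IsStationaryProcess τ fun ω s => ‖g ω s‖ := hg.comp_measurable_right hg.1.norm
  have hall : ∀ᵐ ω ∂P, ∃ n : ℕ, ∀ᵐ s, ‖g ω s‖ ∈ Iic (n : ℝ) := by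
    filter_upwards [hb] with ω hω
    obtain ⟨n, hn⟩ := exists_nat_ge (eLpNorm (g ω) ⊤ volume).toReal
    refine ⟨n, ?_⟩
    filter_upwards [ae_le_eLpNormEssSup (f := g ω) (μ := volume)] with s hs
    rw [← eLpNorm_exponent_top] at hs
    have := ENNReal.toReal_mono hω.eLpNorm_ne_top hs
    rw [toReal_enorm] at this
    exact this.trans hn
  by_contra hcon
  have hzero : ∀ n : ℕ, P {ω | ∀ᵐ s, ‖g ω s‖ ∈ Iic (n : ℝ)} = 0 := by
    intro n
    obtain ⟨hm, h⟩ := hτ.ae_mem_zero_or_one hX (measurableSet_Iic (a := (n : ℝ)))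
    refine h.resolve_right fun h1 => hcon ⟨n, Nat.cast_nonneg n, ?_⟩
    exact (prob_compl_eq_zero_iff hm).2 h1
  have hnone : ∀ᵐ ω ∂P, ∀ n : ℕ, ¬ ∀ᵐ s, ‖g ω s‖ ∈ Iic (n : ℝ) :=
    ae_all_iff.2 fun n => measure_eq_zero_iff_ae_notMem.1 (hzero n)
  have hF : ∀ᵐ _ ∂P, False := by
    filter_upwards [hall, hnone] with ω ⟨n, hn⟩ h using h n hn
  exact (NeZero.ne P) (by simpa using hF)

/-- A nonnegative random variable which contracts along a measure preserving sequence vanishes. -/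
theorem ae_eq_zero_of_comp_le [IsProbabilityMeasure P] {T : ℕ → Ω → Ω}
    (hT : ∀ n, MeasurePreserving (T n) P P) {X : Ω → ℝ} (hX : Measurable X) (h0 : ∀ ω, 0 ≤ X ω)
    {c : ℕ → ℝ} (hc : Tendsto c atTop (𝓝 0)) (hle : ∀ n, ∀ᵐ ω ∂P, X (T n ω) ≤ c n * X ω) :
    ∀ᵐ ω ∂P, X ω = 0 := by
  -- `X` need not be integrable, so it is truncated: E min(1, X) = E min(1, X∘T_n) ≤ E min(1, c_n
  -- X), which tends to 0.
  have hm : Measurable fun ω => min 1 (ENNReal.ofReal (X ω)) :=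
    measurable_const.min hX.ennreal_ofReal
  have hlim : Tendsto (fun n => ∫⁻ ω, min 1 (ENNReal.ofReal (c n * X ω)) ∂P) atTop
      (𝓝 (∫⁻ _, 0 ∂P)) := by
    refine tendsto_lintegral_of_dominated_convergence (fun _ => 1)
      (fun n => measurable_const.min (hX.const_mul _).ennreal_ofReal)
      (fun n => Eventually.of_forall fun ω => min_le_left _ _) (by simp)
      (Eventually.of_forall fun ω => ?_)
    have h1 : Tendsto (fun n => ENNReal.ofReal (c n * X ω)) atTop (𝓝 0) := by
      have := ENNReal.tendsto_ofReal (hc.mul_const (X ω))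
      simpa using this
    have h2 := (tendsto_const_nhds (x := (1 : ENNReal))).min h1
    simpa using h2
  have hzero : ∫⁻ ω, min 1 (ENNReal.ofReal (X ω)) ∂P = 0 := by
    rw [lintegral_zero] at hlim
    refine le_antisymm (ge_of_tendsto hlim (Eventually.of_forall fun n => ?_)) zero_le
    rw [← (hT n).lintegral_comp hm]
    refine lintegral_mono_ae ?_
    filter_upwards [hle n] with ω hω
    gcongr
  rw [lintegral_eq_zero_iff hm] at hzero
  filter_upwards [hzero] with ω hω
  have h1 : ENNReal.ofReal (X ω) = 0 := by
    have : min 1 (ENNReal.ofReal (X ω)) = 0 := hω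
    rcases min_eq_iff.1 this with h | h
    · exact absurd h.1 one_ne_zero
    · exact h.1
  exact le_antisymm (ENNReal.ofReal_eq_zero.1 h1) (h0 ω)

end Stationary

/-! ### Uniqueness and the main theorem -/

section Main

variable {d : ℕ} {Ω : Type*} [MeasurableSpace Ω] {P : Measure Ω} {τ : ℝ → Ω → Ω}

/-- Two stationary solutions differ by a deterministic constant. -/
theorem IsErgodicFlow.exists_eq_add_torusConst [IsProbabilityMeasure P] (hτ : IsErgodicFlow P τ)
    {A : Ω → ℝ → TorusL2 d →L[ℝ] TorusL2 d} {C γ D : ℝ} (hA : ∀ ω, IsForwardStable (A ω) C γ D)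
    (hp : IsStationaryProcess τ fun ω s => pInfty (A ω) s) {g u v : Ω → ℝ → TorusL2 d}
    (hu : IsStationaryProcess τ u) (hv : IsStationaryProcess τ v)
    (hu' : ∀ᵐ ω ∂P, IsEvolutionSolution (A ω) (g ω) (u ω))
    (hv' : ∀ᵐ ω ∂P, IsEvolutionSolution (A ω) (g ω) (v ω)) :
    ∃ c : ℝ, ∀ᵐ ω ∂P, ∀ s : ℝ, u ω s = v ω s + torusConst d c := by
  rcases isEmpty_or_nonempty Ω with hΩ | ⟨⟨ω₀⟩⟩
  · exact ⟨0, Eventually.of_forall fun ω => isEmptyElim ω⟩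
  have hγ := (hA ω₀).rate_pos
  set φ : Ω → ℝ → ℝ := fun ω s => inner ℝ (u ω s - v ω s) (pInfty (A ω) s) with hφ
  have hφs : IsStationaryProcess τ φ :=
    ⟨(hu.1.sub hv.1).inner hp.1, fun t s ω => by simp only [hφ, hu.2 t s ω, hv.2 t s ω, hp.2 t s ω]⟩
  set X : Ω → ℝ → ℝ := fun ω s => ‖u ω s - v ω s - torusConst d (φ ω s)‖ with hX
  have hXs : IsStationaryProcess τ X := by
    refine ⟨?_, fun t s ω => by simp only [hX, hu.2 t s ω, hv.2 t s ω, hφs.2 t s ω]⟩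
    refine ((hu.1.sub hv.1).sub ?_).norm
    have h : (fun q : Ω × ℝ => torusConst d (φ q.1 q.2)) =
        fun q => φ q.1 q.2 • torusConst d 1 := funext fun q => torusConst_eq_smul _
    rw [h]
    exact hφs.1.smul_const _
  have hstep : ∀ᵐ ω ∂P, ∀ s t, s ≤ t →
      φ ω t = φ ω s ∧ X ω t ≤ D * Real.exp (-γ * (t - s)) * X ω s := by
    filter_upwards [hu', hv'] with ω h1 h2 s t hst
    exact (hA ω).sub_of_isEvolutionSolution h1 h2 hst
  have hX0 : ∀ᵐ ω ∂P, X ω 0 = 0 := by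
    have hlim := ((tendsto_exp_neg_mul_sub_atTop hγ 0).comp
      tendsto_natCast_atTop_atTop).const_mul D
    rw [mul_zero] at hlim
    refine ae_eq_zero_of_comp_le (T := fun n : ℕ => τ n) (fun n => hτ.measurePreserving n)
      (hXs.stronglyMeasurable_time 0).measurable (fun ω => norm_nonneg _) hlim fun n => ?_
    filter_upwards [hstep] with ω hω
    have h1 := (hω 0 n (Nat.cast_nonneg n)).2
    have h2 := hXs.2 0 n ω
    rw [zero_add] at h2
    rw [← h2]
    exact h1
  -- Vanishing is first spread to countably many times going to -∞; the contraction then gives it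
  -- for all real times on a single full event.
  have hXn : ∀ᵐ ω ∂P, ∀ n : ℕ, X ω (-n) = 0 := by
    refine ae_all_iff.2 fun n => ?_
    filter_upwards [(hτ.measurePreserving (-n)).quasiMeasurePreserving.ae hX0] with ω hω
    have h2 := hXs.2 0 (-n) ω
    rwa [zero_add, hω] at h2
  obtain ⟨c, hc⟩ := hτ.exists_const hφs (by
    filter_upwards [hstep] with ω hω s
    rcases le_total s 0 with h | h
    · exact (hω s 0 h).1.symm
    · exact (hω 0 s h).1)
  refine ⟨c, ?_⟩
  filter_upwards [hstep, hXn, hc] with ω h1 h2 h3 s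
  obtain ⟨n, hn⟩ := exists_nat_ge (-s)
  have h4 : φ ω s = c := by
    rw [← h3]
    rcases le_total s 0 with h | h
    · exact (h1 s 0 h).1.symm
    · exact (h1 0 s h).1
  have h5 := (h1 (-n) s (by linarith)).2
  rw [h2 n, mul_zero] at h5
  have h6 := norm_le_zero_iff.1 h5
  rw [h4, sub_sub, sub_eq_zero] at h6
  exact h6

/-- The constants depend only on the kernel and on the bounds α₁, α₂; the same ones therefore serve
every ω. -/
theorem exists_isForwardStable_jumpOperator {a : EuclideanSpace ℝ (Fin d) → ℝ}
    (ha : IsJumpKernel a) {α₁ α₂ : ℝ} (hα₁ : 0 < α₁) (hα : α₁ ≤ α₂) :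
    ∃ C γ D : ℝ, ∀ μ : ℝ → UnitAddTorus (Fin d) → UnitAddTorus (Fin d) → ℝ,
      (Measurable fun q : ℝ × (UnitAddTorus (Fin d) × UnitAddTorus (Fin d)) =>
        μ q.1 q.2.1 q.2.2) →
      (∀ t x y, α₁ ≤ μ t x y ∧ μ t x y ≤ α₂) →
      IsForwardStable (fun t => jumpOperator a (μ t)) C γ D := by
  obtain ⟨K, C, M, κ, c, m, hK, hfam⟩ := exists_isMarkovFamily_jumpOperator ha hα₁ hα
  obtain ⟨γ, D, hγ, hD, hbd⟩ := hK.exists_forward_bounds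
  refine ⟨C, γ, D, fun μ hμ hb => ?_⟩
  have hA := hfam μ hμ hb
  obtain ⟨-, h1, h2⟩ := hbd _ hA
  exact ⟨hA.meas, hK.one_le, hA.norm_le, hA.map_one, hγ, hD, h1,
    fun g v s t hst hv hg => (h2 g v s t hst hv hg).1,
    fun g v s t hst hv hg => (h2 g v s t hst hv hg).2⟩

end Main

theorem lemma3p7 {d : ℕ} {Ω : Type*} [MeasurableSpace Ω] (P : Measure Ω) [IsProbabilityMeasure P]
    (τ : ℝ → Ω → Ω) (hτ : IsErgodicFlow P τ)
    (a : EuclideanSpace ℝ (Fin d) → ℝ) (ha : IsJumpKernel a)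
    (α₁ α₂ : ℝ) (hα₁ : 0 < α₁)
    (μ : Ω → ℝ → UnitAddTorus (Fin d) → UnitAddTorus (Fin d) → ℝ)
    (hμ : IsStationaryCoefficient τ α₁ α₂ μ)
    -- the operators `A_ω(s)` and the process `p_∞`
    (A : Ω → ℝ → TorusL2 d →L[ℝ] TorusL2 d) (hA : A = fun ω s => jumpOperator a (μ ω s))
    (p : Ω → ℝ → TorusL2 d) (hp : p = fun ω s => pInfty (A ω) s)
    -- the right-hand side
    (g : Ω → ℝ → TorusL2 d) (hg : IsStationaryProcess τ g)
    (hg_bdd : ∀ᵐ ω ∂P, MemLp (g ω) ⊤ volume)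
    (hgp : IsStationaryProcess τ (fun ω s => (g ω s, p ω s)))
    (hg_orth : ∀ᵐ ω ∂P, ∀ s : ℝ, ∫ ξ, g ω s ξ * p ω s ξ = 0) :
    ∃ v : Ω → ℝ → TorusL2 d,
      IsStationaryProcess τ v ∧
      (∀ᵐ ω ∂P, MemLp (v ω) ⊤ volume ∧ IsEvolutionSolution (A ω) (g ω) (v ω)) ∧
      -- every other stationary solution differs from `v` by an additive constant
      ∀ u : Ω → ℝ → TorusL2 d, IsStationaryProcess τ u →
        (∀ᵐ ω ∂P, IsEvolutionSolution (A ω) (g ω) (u ω)) →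
        ∃ c : ℝ, ∀ᵐ ω ∂P, ∀ s : ℝ, u ω s = v ω s + torusConst d c := by
  subst hp
  obtain ⟨ω₀⟩ : Nonempty Ω := P.nonempty_of_neZero
  have hα : α₁ ≤ α₂ := (hμ.bounds ω₀ 0 0 0).1.trans (hμ.bounds ω₀ 0 0 0).2
  have hC : ∀ ω t x y, |μ ω t x y| ≤ α₂ := fun ω t x y =>
    abs_le.2 ⟨by linarith [(hμ.bounds ω t x y).1], (hμ.bounds ω t x y).2⟩
  obtain ⟨C, γ, D, hstab⟩ := exists_isForwardStable_jumpOperator ha hα₁ hα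
  have hAs : ∀ ω, IsForwardStable (A ω) C γ D := by
    intro ω
    rw [hA]
    have hm : Measurable fun q : ℝ × (UnitAddTorus (Fin d) × UnitAddTorus (Fin d)) =>
        ((ω, q.1), q.2) := by fun_prop
    exact hstab (μ ω) (hμ.measurable.comp hm) (hμ.bounds ω)
  have hAm : ∀ x, StronglyMeasurable fun q : Ω × ℝ => A q.1 q.2 x := by
    intro x
    rw [hA]
    exact stronglyMeasurable_jumpOperator (Θ := Ω × ℝ) (m := fun q => μ q.1 q.2) ha
      hμ.measurable (fun q => hC q.1 q.2) x
  have hAτ : ∀ ω s, (fun r => A ω (r + s)) = A (τ s ω) := by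
    intro ω s
    rw [hA]
    exact funext fun r => jumpOperator_congr (hμ.stationary r s ω)
  have hps : IsStationaryProcess τ fun ω s => pInfty (A ω) s :=
    hgp.comp_measurable_right (f := Prod.snd) (continuous_snd.comp_stronglyMeasurable hgp.1)
  obtain ⟨R, hR, hgR⟩ := hτ.exists_ae_norm_le hg hg_bdd
  -- The bound by `R` holds only almost surely and for almost all times. Cutting off large values
  -- acts pointwise on `g ω s`, so it keeps stationarity and orthogonality and makes the bound hold
  -- everywhere.
  set h : Ω → ℝ → TorusL2 d := fun ω s => (Metric.closedBall 0 R).indicator id (g ω s) with hh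
  have hhs : IsStationaryProcess τ h := by
    refine hg.comp_measurable_right (f := (Metric.closedBall 0 R).indicator id) ?_
    have h1 : MeasurableSet {q : Ω × ℝ | ‖g q.1 q.2‖ ≤ R} :=
      hg.1.norm.measurable measurableSet_Iic
    convert hg.1.indicator h1 using 1
    funext q
    simp [indicator]
  have hhR : ∀ ω s, ‖h ω s‖ ≤ R := by
    intro ω s
    by_cases hs : g ω s ∈ Metric.closedBall 0 R
    · simpa [hh, indicator_of_mem hs] using hs
    · simpa [hh, indicator_of_notMem hs] using hR
  have hsrc : ∀ᵐ ω ∂P, IsOrthogonalSource (A ω) (h ω) R ∧ g ω =ᵐ[volume] h ω := by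
    filter_upwards [hg_orth, hgR] with ω h1 h2
    refine ⟨⟨hhs.stronglyMeasurable_path ω, hhR ω, fun r => ?_⟩, ?_⟩
    · by_cases hs : g ω r ∈ Metric.closedBall 0 R
      · simp only [hh, indicator_of_mem hs, id]
        rw [TorusL2.inner_eq]
        exact h1 r
      · simp only [hh, indicator_of_notMem hs, inner_zero_left]
    · filter_upwards [h2] with s hs
      have hs' : g ω s ∈ Metric.closedBall 0 R := by simpa using hs
      simp only [hh, indicator_of_mem hs', id]
  have hv : IsStationaryProcess τ fun ω s => pullbackSol (A ω) (h ω) s := by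
    refine ⟨stronglyMeasurable_pullbackSol hAm hhs.1, fun t s ω => ?_⟩
    have h1 : (fun r => h ω (r + s)) = h (τ s ω) := funext fun r => hhs.2 r s ω
    beta_reduce
    rw [pullbackSol_add, hAτ, h1]
  have hsol : ∀ᵐ ω ∂P, MemLp (fun s => pullbackSol (A ω) (h ω) s) ⊤ volume ∧
      IsEvolutionSolution (A ω) (g ω) (fun s => pullbackSol (A ω) (h ω) s) := by
    filter_upwards [hsrc] with ω hω
    exact (hAs ω).isEvolutionSolution_pullbackSol hω.1 hω.2
  exact ⟨_, hv, hsol, fun u hu hu' =>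
    hτ.exists_eq_add_torusConst hAs hps hu hv hu' (hsol.mono fun ω hω => hω.2)⟩
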